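/- For $\eta\in[0,1]$ let $\mathcal A(\rho)=K_0\rho K_0^\dagger+K_1\rho K_1^\dagger$ be the qubit amplitude damping channel of transmissivity $\eta$, where $K_0=|1\rangle\langle 1|+\sqrt{\eta}\,|0\rangle\langle 0|$ and $K_1=\sqrt{1-\eta}\,|1\rangle\langle 0|$. For a finite ensemble $\{p_X(x),|\phi^x\rangle_{AA'}\}$ of pure states on $AA'$, where $A'$ is a qubit and $A$ is a reference system of any finite dimension, put $$\rho_{XAB}=\sum_x p_X(x)\,|x\rangle\langle x|_X\otimes(\mathrm{id}_A\otimes\mathcal A_{A'\to B})\bigl(|\phi^x\rangle\langle\phi^x|_{AA'}\bigr).$$ With the von Neumann entropies $H$ (logarithms to base $2$) of this state and of its marginals, put $I(AX;B)=H(AX)+H(B)-H(ABX)$, $I(A\rangle BX)=H(BX)-H(ABX)$ and $I(X;B)=H(X)+H(B)-H(BX)$. The single-letter triple (classical, quantum, entanglement) trade-off region of $\mathcal A$ is the union, over all such ensembles, of the polyhedra of all $(C,Q,E)\in\mathbb R^3$ with $$C+2Q\le I(AX;B),\qquad Q+E\le I(A\rangle BX),\qquad C+Q+E\le I(X;B)+I(A\rangle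 BX).$$ Let $h_2(y)=-y\log_2 y-(1-y)\log_2(1-y)$ for $y\in[0,1]$ (with $0\log_2 0=0$) and $$g(q,z,\nu)=h_2\!\left(\frac{1+\sqrt{(1-2zq)^2+4z\nu^2q(1-q)}}{2}\right).$$ Theorem. For every $\eta\in[0,1]$, the single-letter triple trade-off region of $\mathcal A$ equals the union, over all $p_0,q_0,q_1,\nu_0,\nu_1\in[0,1]$, with $p_1=1-p_0$ and $p=p_0q_0+p_1q_1$, of the polyhedra of all $(C,Q,E)\in\mathbb R^3$ with $$C+2Q\le h_2(\eta p)+\sum_{x\in\{0,1\}}p_x\,[g(q_x,1,\nu_x)-g(q_x,1-\eta,\nu_x)],$$ $$Q+E\le\sum_{x\in\{0,1\}}p_x\,[g(q_x,\eta,\nu_x)-g(q_x,1-\eta,\nu_x)],$$ $$C+Q+E\le h_2(\eta p)-\sum_{x\in\{0,1\}}p_x\,g(q_x,1-\eta,\nu_x).$$ -/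

import Mathlib

open scoped Matrix Kronecker

noncomputable section

namespace TripleTradeoff

/-- The von Neumann entropy `H(ρ) = -Tr (ρ log₂ ρ)` of a Hermitian matrix, i.e. the sum of
`-t log₂ t` over its eigenvalues `t` with multiplicity (and `0 log₂ 0 = 0`).
It is only used for density matrices; the value at a non-Hermitian matrix is set to `0`. -/
def vnEntropy {n : Type*} [Fintype n] [DecidableEq n] (ρ : Matrix n n ℂ) : ℝ :=
  open Classical in
  if h : ρ.IsHermitian then ∑ i, -(h.eigenvalues i * Real.logb 2 (h.eigenvalues i)) else 0

/-- The map `id_A ⊗ 𝒩` for the map `𝒩(ρ) = ∑ j, K j * ρ * (K j)ᴴ` with Kraus operators `K`. -/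
def applyKraus {κ A A' B : Type*} [Fintype κ] [Fintype A] [DecidableEq A] [Fintype A']
    (K : κ → Matrix B A' ℂ) (ρ : Matrix (A × A') (A × A') ℂ) : Matrix (A × B) (A × B) ℂ :=
  ∑ j, ((1 : Matrix A A ℂ) ⊗ₖ K j) * ρ * ((1 : Matrix A A ℂ) ⊗ₖ K j)ᴴ

/-- The classical-quantum state
`ρ_XAB = ∑ x, p x |x⟩⟨x| ⊗ (id_A ⊗ 𝒩)(|φ x⟩⟨φ x|)` of an ensemble of pure states `φ x` on `AA'`. -/
def cqState {κ X A A' B : Type*} [Fintype κ] [Fintype X] [DecidableEq X] [Fintype A]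
    [DecidableEq A] [Fintype A'] (K : κ → Matrix B A' ℂ) (p : X → ℝ) (φ : X → A × A' → ℂ) :
    Matrix (X × A × B) (X × A × B) ℂ :=
  ∑ x, ((p x : ℝ) : ℂ) •
    (Matrix.single x x (1 : ℂ) ⊗ₖ applyKraus K (Matrix.vecMulVec (φ x) (star (φ x))))

section Marginals

variable {X A B : Type*} [Fintype X] [Fintype A] [Fintype B]

/-- The reduced state on `XA` (trace over `B`). -/
def margXA (ρ : Matrix (X × A × B) (X × A × B) ℂ) : Matrix (X × A) (X × A) ℂ :=
  Matrix.of fun i j => ∑ b, ρ (i.1, i.2, b) (j.1, j.2, b)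

/-- The reduced state on `XB` (trace over `A`). -/
def margXB (ρ : Matrix (X × A × B) (X × A × B) ℂ) : Matrix (X × B) (X × B) ℂ :=
  Matrix.of fun i j => ∑ a, ρ (i.1, a, i.2) (j.1, a, j.2)

/-- The reduced state on `X` (trace over `AB`). -/
def margX (ρ : Matrix (X × A × B) (X × A × B) ℂ) : Matrix X X ℂ :=
  Matrix.of fun i j => ∑ a, ∑ b, ρ (i, a, b) (j, a, b)

/-- The reduced state on `B` (trace over `XA`). -/
def margB (ρ : Matrix (X × A × B) (X × A × B) ℂ) : Matrix B B ℂ :=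
  Matrix.of fun i j => ∑ x, ∑ a, ρ (x, a, i) (x, a, j)

variable [DecidableEq X] [DecidableEq A] [DecidableEq B]

/-- The quantum mutual information `I(AX;B) = H(AX) + H(B) - H(ABX)`. -/
def mutualInfo (ρ : Matrix (X × A × B) (X × A × B) ℂ) : ℝ :=
  vnEntropy (margXA ρ) + vnEntropy (margB ρ) - vnEntropy ρ

/-- The coherent information `I(A⟩BX) = H(BX) - H(ABX)`. -/
def coherentInfo (ρ : Matrix (X × A × B) (X × A × B) ℂ) : ℝ :=
  vnEntropy (margXB ρ) - vnEntropy ρ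

/-- The Holevo information `I(X;B) = H(X) + H(B) - H(BX)`. -/
def holevoInfo (ρ : Matrix (X × A × B) (X × A × B) ℂ) : ℝ :=
  vnEntropy (margX ρ) + vnEntropy (margB ρ) - vnEntropy (margXB ρ)

end Marginals

/-- The polyhedron of all rate triples `(C, Q, E)` with
`C + 2Q ≤ a`, `Q + E ≤ b` and `C + Q + E ≤ c`. -/
def ratePolyhedron (a b c : ℝ) : Set (ℝ × ℝ × ℝ) :=
  {r | r.1 + 2 * r.2.1 ≤ a ∧ r.2.1 + r.2.2 ≤ b ∧ r.1 + r.2.1 + r.2.2 ≤ c}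

/-- The single-letter triple trade-off region of the channel with Kraus operators `K`: the union
of the polyhedra `C + 2Q ≤ I(AX;B)`, `Q + E ≤ I(A⟩BX)`, `C + Q + E ≤ I(X;B) + I(A⟩BX)` over all
ensembles `{p x, |φ x⟩}` of finitely many pure states on `AA'`, with `A` of any finite dimension. -/
def tripleRegion {κ A' B : Type*} [Fintype κ] [Fintype A'] [Fintype B] [DecidableEq B]
    (K : κ → Matrix B A' ℂ) : Set (ℝ × ℝ × ℝ) :=
  {r | ∃ (n d : ℕ) (p : Fin n → ℝ) (φ : Fin n → Fin d × A' → ℂ),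
    (∀ x, 0 ≤ p x) ∧ ∑ x, p x = 1 ∧ (∀ x, ∑ i, ‖φ x i‖ ^ 2 = 1) ∧
    r ∈ ratePolyhedron (mutualInfo (cqState K p φ)) (coherentInfo (cqState K p φ))
      (holevoInfo (cqState K p φ) + coherentInfo (cqState K p φ))}

/-- The Kraus operators `K₀ = |1⟩⟨1| + √η |0⟩⟨0|` and `K₁ = √(1-η) |1⟩⟨0|` of the qubit amplitude
damping channel of transmissivity `η`. The index `0 : Fin 2` stands for `|0⟩`, which decays to
`|1⟩`. -/
def ampDampKraus (η : ℝ) : Fin 2 → Matrix (Fin 2) (Fin 2) ℂ :=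
  ![Matrix.single 1 1 (1 : ℂ) + Matrix.single 0 0 ((√η : ℝ) : ℂ),
    Matrix.single 1 0 ((√(1 - η) : ℝ) : ℂ)]

/-- The binary entropy `h₂(y) = -y log₂ y - (1-y) log₂ (1-y)`. -/
def h2 (y : ℝ) : ℝ := -y * Real.logb 2 y - (1 - y) * Real.logb 2 (1 - y)

/-- The function `g(q, z, ν)`. -/
def g (q z ν : ℝ) : ℝ :=
  h2 ((1 + √((1 - 2 * z * q) ^ 2 + 4 * z * ν ^ 2 * q * (1 - q))) / 2)

end TripleTradeoff

end

noncomputable section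

namespace TripleTradeoff

open Real Set

/-! ### Hyperbolic inequalities behind the entropy estimates. -/

section Hyperbolic

/-! A reduced state on `A'` enters through its |0⟩-population q and its determinant Y. Let E_z(q, Y)
be the entropy of the output at transmissivity z; the output determinant is z(Y + (1-z)q²). Since
each φ^x is pure and the environment of the channel sees transmissivity 1-η, the entropies H(AX),
H(BX), H(ABX) are H(X) plus the averages of E_1, E_η, E_{1-η}, and H(X) cancels in all three rates.
Only H(B) depends on the phases of the coherences. It is at most h₂(ηp), with equality when every
state is paired with its copy of opposite coherence. The pairing gives the inclusion of the explicit
region in the triple region.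

For the converse a single state suffices: by `exists_dominating`, an ensemble can be replaced by one
state of the same mean population such that E_1 - E_{1-η} and E_η - E_{1-η} do not drop below their
averages and E_{1-η} does not exceed its average. The state is chosen by matching the average of a
function U: E_{1-η} if η ≥ 1/2, and E_{1-η} - E_η if η < 1/2. Another function V then does not
decrease if V is concave as a function of (q, U) (`exists_jensen`). This concavity means that V'' ≤
0 along every curve on which q is affine and U'' = 0.

Let S(D) be the entropy at determinant D and define Ω by S'' = -S'/(Ω + 2D). Then (S∘D)'' =
S'(D)(D'' - D'²/(Ω + 2D)), and Cauchy-Schwarz in the form (Σaᵢ)²/Σbᵢ ≤ Σaᵢ²/bᵢ reduces V'' ≤ 0 to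
comparisons of Ω. Matching one output entropy needs cΩ(V) ≤ Ω(X) whenever cV ≤ X
(`mul_detDefect_le`). Matching E_{1-η} - E_η needs a weighted inequality between three determinants
(`three_point_weights`), which follows from convexity of 1/(S'√D) and concavity of Ω/√D as functions
of √D. The substitution √D = 1/(2 cosh a) turns these properties into hyperbolic inequalities, the
hardest being `hyperbolic_key`. -/

theorem nonneg_of_deriv_nonneg_of_zero {F F' : ℝ → ℝ} (h0 : F 0 = 0)
    (hd : ∀ a, HasDerivAt F (F' a) a) (hF' : ∀ a, 0 ≤ a → 0 ≤ F' a) {a : ℝ} (ha : 0 ≤ a) :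
    0 ≤ F a := by
  have hm : MonotoneOn F (Ici 0) := by
    refine monotoneOn_of_deriv_nonneg (convex_Ici 0)
      (fun x _ => (hd x).continuousAt.continuousWithinAt)
      (fun x _ => (hd x).differentiableAt.differentiableWithinAt) fun x hx => ?_
    rw [(hd x).deriv]
    exact hF' x (interior_subset hx)
  simpa [h0] using hm (mem_Ici.2 le_rfl) (mem_Ici.2 ha) ha

theorem sinh_le_mul_cosh {a : ℝ} (ha : 0 ≤ a) : sinh a ≤ a * cosh a := by
  have := nonneg_of_deriv_nonneg_of_zero (F := fun a => a * cosh a - sinh a)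
    (F' := fun a => a * sinh a) (by simp)
    (fun a => by
      refine (((hasDerivAt_id a).mul (hasDerivAt_cosh a)).sub (hasDerivAt_sinh a)).congr_deriv ?_
      simp)
    (fun a ha => mul_nonneg ha (sinh_nonneg_iff.2 ha)) ha
  simpa using this

theorem sinh_lt_mul_cosh {a : ℝ} (ha : 0 < a) : sinh a < a * cosh a := by
  have hm : StrictMonoOn (fun a => a * cosh a - sinh a) (Ici 0) := by
    refine strictMonoOn_of_deriv_pos (convex_Ici 0) (by fun_prop) fun x hx => ?_
    have hx : 0 < x := by simpa using hx
    have : HasDerivAt (fun a => a * cosh a - sinh a) (x * sinh x) x := by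
      refine (((hasDerivAt_id x).mul (hasDerivAt_cosh x)).sub (hasDerivAt_sinh x)).congr_deriv ?_
      simp
    rw [this.deriv]
    exact mul_pos hx (sinh_pos_iff.2 hx)
  have := hm (mem_Ici.2 le_rfl) (mem_Ici.2 ha.le) ha
  simp at this
  linarith

theorem lt_sinh_mul_cosh {a : ℝ} (ha : 0 < a) : a < sinh a * cosh a := by
  have h1 := self_lt_sinh_iff.2 ha
  have h2 := one_lt_cosh.2 ha.ne'
  nlinarith

theorem sinh_sq_cosh_bound' {a : ℝ} (ha : 0 ≤ a) :
    0 ≤ 3 * sinh a * cosh a ^ 2 - 3 * a * cosh a - 2 * a ^ 2 * sinh a := by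
  refine nonneg_of_deriv_nonneg_of_zero
    (F := fun a => 3 * sinh a * cosh a ^ 2 - 3 * a * cosh a - 2 * a ^ 2 * sinh a)
    (F' := fun a => 7 * sinh a * (sinh a * cosh a - a) + 2 * cosh a * (sinh a ^ 2 - a ^ 2))
    (by simp) (fun a => ?_) (fun a ha => ?_) ha
  · have hs := hasDerivAt_sinh a
    have hc := hasDerivAt_cosh a
    refine ((((hs.const_mul 3).mul (hc.pow 2)).sub (((hasDerivAt_id a).const_mul 3).mul hc)).sub
      ((((hasDerivAt_id a).pow 2).const_mul 2).mul hs)).congr_deriv ?_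
    have := cosh_sq a
    simp
    linear_combination (3 * cosh a) * this
  · have h1 := self_le_sinh_iff.2 ha
    have h2 := one_le_cosh a
    have h3 : 0 ≤ sinh a := ha.trans h1
    have h4 : a ≤ sinh a * cosh a := by nlinarith
    have h5 : a ^ 2 ≤ sinh a ^ 2 := by gcongr
    have := mul_nonneg h3 (sub_nonneg.2 h4)
    have := mul_nonneg (cosh_pos a).le (sub_nonneg.2 h5)
    nlinarith

/-- Up to the factor `sinh a`, this is the numerator of the derivative that makes `detDefect D / D`
monotone; see `detDefect_div_antitoneOn`. -/
theorem two_sq_mul_cosh_le {a : ℝ} (ha : 0 ≤ a) :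
    0 ≤ sinh a ^ 2 * cosh a + a * sinh a - 2 * a ^ 2 * cosh a := by
  refine nonneg_of_deriv_nonneg_of_zero
    (F := fun a => sinh a ^ 2 * cosh a + a * sinh a - 2 * a ^ 2 * cosh a)
    (F' := fun a => 3 * sinh a * cosh a ^ 2 - 3 * a * cosh a - 2 * a ^ 2 * sinh a)
    (by simp) (fun a => ?_) (fun a ha => sinh_sq_cosh_bound' ha) ha
  have hs := hasDerivAt_sinh a
  have hc := hasDerivAt_cosh a
  refine ((((hs.pow 2).mul hc).add ((hasDerivAt_id a).mul hs)).sub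
      ((((hasDerivAt_id a).pow 2).const_mul 2).mul hc)).congr_deriv ?_
  have := cosh_sq a
  simp
  linear_combination (- sinh a) * this

/-- This expression carries the sign of the derivative of `defectRatio`. Two differentiations reduce
it to `sinh_le_mul_cosh`. -/
theorem two_sinh_sq_le {a : ℝ} (ha : 0 ≤ a) :
    0 ≤ a ^ 2 + a * sinh a * cosh a - 2 * sinh a ^ 2 := by
  refine nonneg_of_deriv_nonneg_of_zero
    (F := fun a => a ^ 2 + a * sinh a * cosh a - 2 * sinh a ^ 2)
    (F' := fun a => 3 * a - 3 * sinh a * cosh a + 2 * a * sinh a ^ 2)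
    (by simp) (fun a => ?_) (fun a ha => ?_) ha
  · have hs := hasDerivAt_sinh a
    have hc := hasDerivAt_cosh a
    refine ((((hasDerivAt_id a).pow 2).add (((hasDerivAt_id a).mul hs).mul hc)).sub
      ((hs.pow 2).const_mul 2)).congr_deriv ?_
    have := cosh_sq a
    simp
    linear_combination a * this
  · refine nonneg_of_deriv_nonneg_of_zero
      (F := fun a => 3 * a - 3 * sinh a * cosh a + 2 * a * sinh a ^ 2)
      (F' := fun a => 4 * sinh a * (a * cosh a - sinh a)) (by simp) (fun a => ?_) (fun a ha => ?_) ha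
    · have hs := hasDerivAt_sinh a
      have hc := hasDerivAt_cosh a
      refine ((((hasDerivAt_id a).const_mul 3).sub ((hs.const_mul 3).mul hc)).add
        (((hasDerivAt_id a).const_mul 2).mul (hs.pow 2))).congr_deriv ?_
      have := cosh_sq a
      simp
      linear_combination (-3) * this
    · have := sinh_le_mul_cosh ha
      have := sinh_nonneg_iff.2 ha
      have : 0 ≤ a * cosh a - sinh a := by linarith
      positivity

/-- Needed for the monotonicity of `(a * cosh a - sinh a) / a ^ 3` in `slopeRatio_deriv_monotoneOn`.
-/
theorem three_mul_sub_le {a : ℝ} (ha : 0 ≤ a) :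
    0 ≤ a ^ 2 * sinh a - 3 * (a * cosh a - sinh a) := by
  refine nonneg_of_deriv_nonneg_of_zero
    (F := fun a => a ^ 2 * sinh a - 3 * (a * cosh a - sinh a))
    (F' := fun a => a * (a * cosh a - sinh a))
    (by simp) (fun a => ?_) (fun a ha => mul_nonneg ha (by linarith [sinh_le_mul_cosh ha])) ha
  have hs := hasDerivAt_sinh a
  have hc := hasDerivAt_cosh a
  refine ((((hasDerivAt_id a).pow 2).mul hs).sub
    ((((hasDerivAt_id a).mul hc).sub hs).const_mul 3)).congr_deriv ?_
  simp
  ring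

/-- This series and the next three are all written against the weights `B ^ (2 * n) / (2 * n)!`, so
that they can be added coefficientwise. The falling factorials of `2 * n` absorb the index shifts,
since they vanish at the missing initial terms. -/
theorem hasSum_cosh_mul (m B : ℝ) :
    HasSum (fun n : ℕ => m ^ (2 * n) * (B ^ (2 * n) / (2 * n).factorial)) (cosh (m * B)) := by
  convert! Real.hasSum_cosh (m * B) using 2 with n
  rw [mul_pow]; ring

theorem hasSum_mul_sinh_mul {m : ℝ} (hm : m ≠ 0) (B : ℝ) :
    HasSum (fun n : ℕ => (2 * n) * m ^ (2 * n) / m * (B ^ (2 * n) / (2 * n).factorial))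
      (B * sinh (m * B)) := by
  rw [← hasSum_nat_add_iff' 1]
  convert! (Real.hasSum_sinh (m * B)).mul_left B using 1
  · ext n
    have h : ((2 * (n + 1)).factorial : ℝ) = (2 * (n + 1)) * (2 * n + 1).factorial := by
      rw [show 2 * (n + 1) = (2 * n + 1) + 1 by ring, Nat.factorial_succ]; push_cast; ring
    rw [h]
    have : ((2 * n + 1).factorial : ℝ) ≠ 0 := by positivity
    push_cast
    field_simp
    ring
  · simp

theorem hasSum_sq_mul_cosh_mul {m : ℝ} (hm : m ≠ 0) (B : ℝ) :
    HasSum (fun n : ℕ => (2 * n) * (2 * n - 1) * m ^ (2 * n) / m ^ 2 *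
      (B ^ (2 * n) / (2 * n).factorial)) (B ^ 2 * cosh (m * B)) := by
  rw [← hasSum_nat_add_iff' 1]
  convert! (Real.hasSum_cosh (m * B)).mul_left (B ^ 2) using 1
  · ext n
    have h : ((2 * (n + 1)).factorial : ℝ) = (2 * (n + 1)) * ((2 * n + 1) * (2 * n).factorial) := by
      rw [show 2 * (n + 1) = (2 * n + 1) + 1 by ring, Nat.factorial_succ, Nat.factorial_succ]
      push_cast; ring
    rw [h]
    have : ((2 * n).factorial : ℝ) ≠ 0 := by positivity
    push_cast
    field_simp
    ring
  · simp

theorem hasSum_cube_mul_sinh_mul {m : ℝ} (hm : m ≠ 0) (B : ℝ) :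
    HasSum (fun n : ℕ => (2 * n) * (2 * n - 1) * (2 * n - 2) * m ^ (2 * n) / m ^ 3 *
      (B ^ (2 * n) / (2 * n).factorial)) (B ^ 3 * sinh (m * B)) := by
  rw [← hasSum_nat_add_iff' 1]
  convert! (hasSum_mul_sinh_mul hm B).mul_left (B ^ 2) using 1
  · ext n
    have h : ((2 * (n + 1)).factorial : ℝ) = (2 * (n + 1)) * ((2 * n + 1) * (2 * n).factorial) := by
      rw [show 2 * (n + 1) = (2 * n + 1) + 1 by ring, Nat.factorial_succ, Nat.factorial_succ]
      push_cast; ring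
    rw [h]
    have : ((2 * n).factorial : ℝ) ≠ 0 := by positivity
    push_cast
    field_simp
    ring
  · simp
    ring

/-- The bracket is 16 times the quadratic multiplying `9 ^ n` in `hyperbolic_coeff_nonneg`, with its
constant 15/16 rounded up to 1. The surplus `9 ^ n / 16` pays for the purely polynomial terms
through `nine_pow_ge`. -/
theorem twentyfive_pow_ge (n : ℕ) (hn : 5 ≤ n) :
    (9 : ℝ) ^ n * ((32 * n ^ 2 - 96 * n) / 3 + 16) ≤ 25 ^ n := by
  induction n, hn using Nat.le_induction with
  | base => norm_num
  | succ n hn ih =>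
    have hn' : (5 : ℝ) ≤ n := by exact_mod_cast hn
    have h9 : (0 : ℝ) < 9 ^ n := by positivity
    rw [pow_succ, pow_succ]
    push_cast
    have : 9 * ((32 * ((n : ℝ) + 1) ^ 2 - 96 * (n + 1)) / 3 + 16)
        ≤ 25 * ((32 * (n : ℝ) ^ 2 - 96 * n) / 3 + 16) := by nlinarith
    calc (9 : ℝ) ^ n * 9 * ((32 * ((n : ℝ) + 1) ^ 2 - 96 * (n + 1)) / 3 + 16)
        = 9 ^ n * (9 * ((32 * ((n : ℝ) + 1) ^ 2 - 96 * (n + 1)) / 3 + 16)) := by ring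
      _ ≤ 9 ^ n * (25 * ((32 * (n : ℝ) ^ 2 - 96 * n) / 3 + 16)) := by gcongr
      _ ≤ 25 ^ n * 25 := by linarith

theorem nine_pow_ge (n : ℕ) (hn : 5 ≤ n) :
    48 * (n : ℝ) * (2 * n - 1) + 48 * n + 64 * n * (2 * n - 1) * (2 * n - 2) ≤ 9 ^ n := by
  induction n, hn using Nat.le_induction with
  | base => norm_num
  | succ n hn ih =>
    have hn' : (5 : ℝ) ≤ n := by exact_mod_cast hn
    rw [pow_succ]
    push_cast
    nlinarith [mul_nonneg (sub_nonneg.2 hn') (sub_nonneg.2 hn'), mul_nonneg (mul_nonneg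
      (sub_nonneg.2 hn') (sub_nonneg.2 hn')) (sub_nonneg.2 hn')]

theorem hyperbolic_coeff_nonneg (n : ℕ) :
    0 ≤ (25 : ℝ) ^ n / 16 - 15 / 16 * 9 ^ n + 7 / 8 - 3 / 2 * (2 * n * (2 * n - 1) * 9 ^ n / 9)
      - 3 / 2 * (2 * n * (2 * n - 1)) + 5 / 2 * (2 * n * 9 ^ n / 3) - 3 / 2 * (2 * n)
      - 2 * (2 * n * (2 * n - 1) * (2 * n - 2)) := by
  rcases lt_or_ge n 5 with h | h
  · interval_cases n <;> norm_num
  · have h1 := twentyfive_pow_ge n h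
    have h2 := nine_pow_ge n h
    nlinarith

/-- Multiple-angle formulas make the expression a combination of `cosh (5 * a)`, `cosh (3 * a)`,
`cosh a` and of hyperbolic functions of `3 * a` and `a` times powers of `a`. Its even power series
has nonnegative coefficients because `25 ^ n`, from `cosh (5 * a)`, dominates. The inequality is the
sign of the derivative in `defectRatio_deriv_monotoneOn`. -/
theorem hyperbolic_key (a : ℝ) :
    0 ≤ sinh a ^ 4 * cosh a - 3 * sinh a ^ 2 * cosh a - 6 * a ^ 2 * sinh a ^ 2 * cosh a
      + 10 * a * sinh a ^ 3 + 6 * a * sinh a - 2 * a ^ 3 * sinh a - 3 * a ^ 2 * cosh a := by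
  have h5 := hasSum_cosh_mul 5 a
  have h3 := hasSum_cosh_mul 3 a
  have h1 := hasSum_cosh_mul 1 a
  have k3 := hasSum_sq_mul_cosh_mul (m := 3) (by norm_num) a
  have k1 := hasSum_sq_mul_cosh_mul (m := 1) (by norm_num) a
  have s3 := hasSum_mul_sinh_mul (m := 3) (by norm_num) a
  have s1 := hasSum_mul_sinh_mul (m := 1) (by norm_num) a
  have c1 := hasSum_cube_mul_sinh_mul (m := 1) (by norm_num) a
  have H := (((((((h5.mul_left (1 / 16)).sub (h3.mul_left (15 / 16))).add (h1.mul_left (7 / 8))).sub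
    (k3.mul_left (3 / 2))).sub (k1.mul_left (3 / 2))).add (s3.mul_left (5 / 2))).sub
    (s1.mul_left (3 / 2))).sub (c1.mul_left 2)
  have hnn := H.nonneg fun n => by
    have hB : 0 ≤ a ^ (2 * n) / (2 * n).factorial := by
      have : 0 ≤ a ^ (2 * n) := by rw [pow_mul]; positivity
      positivity
    have := mul_nonneg (hyperbolic_coeff_nonneg n) hB
    have e5 : (5 : ℝ) ^ (2 * n) = 25 ^ n := by rw [pow_mul]; norm_num
    have e3 : (3 : ℝ) ^ (2 * n) = 9 ^ n := by rw [pow_mul]; norm_num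
    rw [e5, e3]
    simp only [one_pow]
    refine this.trans (le_of_eq ?_)
    ring
  have hc3 : cosh (3 * a) = 4 * cosh a ^ 3 - 3 * cosh a := cosh_three_mul a
  have hs3 : sinh (3 * a) = 4 * sinh a ^ 3 + 3 * sinh a := sinh_three_mul a
  have hc5 : cosh (5 * a) = cosh a * (16 * sinh a ^ 4 + 12 * sinh a ^ 2 + 1) := by
    rw [show 5 * a = 3 * a + 2 * a by ring, cosh_add, hc3, hs3, cosh_two_mul, sinh_two_mul]
    have := cosh_sq a
    linear_combination (4 * cosh a ^ 3 + 8 * cosh a * sinh a ^ 2 + cosh a) * this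
  rw [hc5, hc3, hs3, one_mul] at hnn
  refine hnn.trans (le_of_eq ?_)
  have := cosh_sq a
  have h3 : cosh a ^ 3 = cosh a * (sinh a ^ 2 + 1) := by rw [pow_succ', this]
  rw [h3]
  ring

end Hyperbolic

end TripleTradeoff

/-! ### The angle parametrisation, and convexity of the slope and defect ratios. -/

noncomputable section

namespace TripleTradeoff

open Real Set

/-- The parameter `a > 0` with `cosh a = 1 / (2 x)`. -/
def halfAngle (x : ℝ) : ℝ := arcosh (1 / (2 * x))

theorem one_lt_inv_two_mul {x : ℝ} (hx : x ∈ Ioo (0 : ℝ) (1 / 2)) : 1 < 1 / (2 * x) := by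
  have h0 := hx.1
  have h1 := hx.2
  rw [lt_div_iff₀ (by linarith)]
  linarith

theorem halfAngle_pos {x : ℝ} (hx : x ∈ Ioo (0 : ℝ) (1 / 2)) : 0 < halfAngle x :=
  arcosh_pos (one_lt_inv_two_mul hx)

theorem cosh_halfAngle {x : ℝ} (hx : x ∈ Ioo (0 : ℝ) (1 / 2)) :
    cosh (halfAngle x) = 1 / (2 * x) :=
  cosh_arcosh (one_lt_inv_two_mul hx).le

theorem sinh_halfAngle_pos {x : ℝ} (hx : x ∈ Ioo (0 : ℝ) (1 / 2)) : 0 < sinh (halfAngle x) :=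
  sinh_pos_iff.2 (halfAngle_pos hx)

theorem eq_inv_two_mul_cosh {x : ℝ} (hx : x ∈ Ioo (0 : ℝ) (1 / 2)) :
    x = 1 / (2 * cosh (halfAngle x)) := by
  have := hx.1
  rw [cosh_halfAngle hx]
  field_simp

theorem hasDerivAt_halfAngle {x : ℝ} (hx : x ∈ Ioo (0 : ℝ) (1 / 2)) :
    HasDerivAt halfAngle (-(2 * cosh (halfAngle x) ^ 2 / sinh (halfAngle x))) x := by
  have h0 := hx.1
  have h1 : HasDerivAt (fun x : ℝ => 1 / (2 * x)) (-(2 * (1 / (2 * x)) ^ 2)) x := by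
    have := ((hasDerivAt_id x).const_mul 2).inv (by simpa using h0.ne')
    simp only [id, one_div] at this ⊢
    refine this.congr_deriv ?_
    field_simp
  have h2 := (hasDerivAt_arcosh (one_lt_inv_two_mul hx)).comp x h1
  refine h2.congr_deriv ?_
  rw [← sinh_arcosh (one_lt_inv_two_mul hx).le, ← cosh_halfAngle hx]
  rw [arcosh_cosh (halfAngle_pos hx).le]
  ring

theorem halfAngle_antitoneOn : AntitoneOn halfAngle (Ioo (0 : ℝ) (1 / 2)) := by
  intro x hx y hy hxy
  refine (arcosh_le_arcosh ?_ ?_).2 ?_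
  · linarith [one_lt_inv_two_mul hy]
  · linarith [one_lt_inv_two_mul hx]
  · have := hx.1
    gcongr

theorem mapsTo_halfAngle : MapsTo halfAngle (Ioo (0 : ℝ) (1 / 2)) (Ioi 0) :=
  fun _ hx => halfAngle_pos hx

theorem monotoneOn_Ioi_of_hasDerivAt {F F' : ℝ → ℝ} (hd : ∀ a, 0 < a → HasDerivAt F (F' a) a)
    (h : ∀ a, 0 < a → 0 ≤ F' a) : MonotoneOn F (Ioi 0) := by
  refine monotoneOn_of_deriv_nonneg (convex_Ioi 0)
    (fun x hx => (hd x hx).continuousAt.continuousWithinAt)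
    (fun x hx => (hd x (interior_subset hx)).differentiableAt.differentiableWithinAt) fun x hx => ?_
  rw [(hd x (interior_subset hx)).deriv]
  exact h x (interior_subset hx)

/-- `σ / √D`, where `σ` is the reciprocal of the slope of the entropy in the determinant. -/
def slopeRatio (a : ℝ) : ℝ := sinh a / a

/-- `Ω / √D`, where `Ω` is the curvature defect of the entropy in the determinant. -/
def defectRatio (a : ℝ) : ℝ := (a * cosh a - sinh a) / (sinh a * cosh a - a)

theorem hasDerivAt_mul_cosh_sub (a : ℝ) :
    HasDerivAt (fun a => a * cosh a - sinh a) (a * sinh a) a := by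
  refine (((hasDerivAt_id a).mul (hasDerivAt_cosh a)).sub (hasDerivAt_sinh a)).congr_deriv ?_
  simp

theorem hasDerivAt_sinh_mul_cosh_sub (a : ℝ) :
    HasDerivAt (fun a => sinh a * cosh a - a) (2 * sinh a ^ 2) a := by
  refine (((hasDerivAt_sinh a).mul (hasDerivAt_cosh a)).sub (hasDerivAt_id a)).congr_deriv ?_
  have := cosh_sq a
  linear_combination this

theorem hasDerivAt_slopeRatio {a : ℝ} (ha : 0 < a) :
    HasDerivAt slopeRatio ((a * cosh a - sinh a) / a ^ 2) a := by
  refine ((hasDerivAt_sinh a).div (hasDerivAt_id a) ha.ne').congr_deriv ?_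
  simp only [id, mul_one]
  ring

theorem hasDerivAt_defectRatio {a : ℝ} (ha : 0 < a) :
    HasDerivAt defectRatio
      (-(sinh a * (a ^ 2 + a * sinh a * cosh a - 2 * sinh a ^ 2) / (sinh a * cosh a - a) ^ 2)) a := by
  have h := lt_sinh_mul_cosh ha
  refine ((hasDerivAt_mul_cosh_sub a).div (hasDerivAt_sinh_mul_cosh_sub a)
    (by linarith)).congr_deriv ?_
  rw [← neg_div]
  congr 1
  ring

theorem slopeRatio_monotoneOn : MonotoneOn slopeRatio (Ioi 0) :=
  monotoneOn_Ioi_of_hasDerivAt (fun _ ha => hasDerivAt_slopeRatio ha) fun a ha =>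
    div_nonneg (by linarith [sinh_lt_mul_cosh ha]) (sq_nonneg a)

theorem defectRatio_antitoneOn : AntitoneOn defectRatio (Ioi 0) := by
  have h : MonotoneOn (fun a => -defectRatio a) (Ioi 0) :=
    monotoneOn_Ioi_of_hasDerivAt (fun _ ha => (hasDerivAt_defectRatio ha).neg) fun a ha => by
      have h1 := two_sinh_sq_le (le_of_lt ha)
      have h2 := sinh_pos_iff.2 ha
      rw [neg_neg]
      positivity
  intro x hx y hy hxy
  simpa using h hx hy hxy

/-- Up to sign this is the derivative of `slopeRatio (halfAngle x)` in `x`. It is twice the product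
of the nonnegative increasing functions `(a * cosh a - sinh a) / a ^ 3`, `a * cosh a / sinh a` and
`cosh a`. As `halfAngle` decreases, monotonicity here is convexity in `x`. -/
theorem slopeRatio_deriv_monotoneOn :
    MonotoneOn (fun a => (a * cosh a - sinh a) / a ^ 2 * (2 * cosh a ^ 2 / sinh a)) (Ioi 0) := by
  have h1 : MonotoneOn (fun a => (a * cosh a - sinh a) / a ^ 3) (Ioi 0) := by
    refine monotoneOn_Ioi_of_hasDerivAt (fun a ha => (hasDerivAt_mul_cosh_sub a).div
      ((hasDerivAt_id a).pow 3) (by simpa using ha.ne')) fun a ha => ?_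
    simp only [id]
    refine div_nonneg ?_ (by positivity)
    have := mul_nonneg (sq_nonneg a) (three_mul_sub_le ha.le)
    norm_num
    nlinarith
  have h2 : MonotoneOn (fun a => a * cosh a / sinh a) (Ioi 0) := by
    refine monotoneOn_Ioi_of_hasDerivAt (fun a ha => (((hasDerivAt_id a).mul (hasDerivAt_cosh a)).div
      (hasDerivAt_sinh a) (sinh_pos_iff.2 ha).ne')) fun a ha => ?_
    refine div_nonneg ?_ (by positivity)
    have := lt_sinh_mul_cosh ha
    have h := cosh_sq a
    simp only [id, Pi.mul_apply]
    nlinarith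
  have h3 : MonotoneOn cosh (Ioi 0) := fun x hx y hy hxy =>
    cosh_le_cosh.2 (by rwa [abs_of_pos hx, abs_of_pos hy])
  have p1 : ∀ a ∈ Ioi (0 : ℝ), 0 ≤ (a * cosh a - sinh a) / a ^ 3 := fun a ha => by
    have ha : 0 < a := ha
    exact div_nonneg (by linarith [sinh_lt_mul_cosh ha]) (by positivity)
  have p2 : ∀ a ∈ Ioi (0 : ℝ), 0 ≤ a * cosh a / sinh a := fun a ha => by
    have ha : 0 < a := ha
    have := sinh_pos_iff.2 ha
    positivity
  have h12 := (h1.mul h2 p1 p2).mul h3 (fun a ha => mul_nonneg (p1 a ha) (p2 a ha))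
    (fun a _ => (cosh_pos a).le)
  intro x hx y hy hxy
  have h := h12 hx hy hxy
  have e : ∀ a ∈ Ioi (0 : ℝ), (a * cosh a - sinh a) / a ^ 2 * (2 * cosh a ^ 2 / sinh a)
      = 2 * ((a * cosh a - sinh a) / a ^ 3 * (a * cosh a / sinh a) * cosh a) := fun a ha => by
    have ha : 0 < a := ha
    have := sinh_pos_iff.2 ha
    field_simp
  simp only [Pi.mul_apply] at h
  simp only [e x hx, e y hy]
  linarith

/-- Up to the factor 2 this is the derivative of `defectRatio (halfAngle x)` in `x`. Its own
derivative is a positive multiple of the expression in `hyperbolic_key`. -/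
theorem defectRatio_deriv_monotoneOn :
    MonotoneOn (fun a => cosh a ^ 2 * (a ^ 2 + a * sinh a * cosh a - 2 * sinh a ^ 2) /
      (sinh a * cosh a - a) ^ 2) (Ioi 0) := by
  refine monotoneOn_Ioi_of_hasDerivAt (F' := fun a => cosh a * (sinh a ^ 4 * cosh a
      - 3 * sinh a ^ 2 * cosh a - 6 * a ^ 2 * sinh a ^ 2 * cosh a
      + 10 * a * sinh a ^ 3 + 6 * a * sinh a - 2 * a ^ 3 * sinh a - 3 * a ^ 2 * cosh a) /
      (sinh a * cosh a - a) ^ 3) (fun a ha => ?_) fun a ha => ?_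
  · have hs := hasDerivAt_sinh a
    have hc := hasDerivAt_cosh a
    have hp : sinh a * cosh a - a ≠ 0 := by linarith [lt_sinh_mul_cosh ha]
    refine (((hc.pow 2).mul ((((hasDerivAt_id a).pow 2).add (((hasDerivAt_id a).mul hs).mul hc)).sub
      ((hs.pow 2).const_mul 2))).div ((hasDerivAt_sinh_mul_cosh_sub a).pow 2)
      (pow_ne_zero 2 hp)).congr_deriv ?_
    have h := cosh_sq a
    have hs2 : sinh a ^ 2 = cosh a ^ 2 - 1 := by linarith
    have hs3 : sinh a ^ 3 = (cosh a ^ 2 - 1) * sinh a := by rw [← hs2]; ring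
    have hs4 : sinh a ^ 4 = (cosh a ^ 2 - 1) ^ 2 := by rw [← hs2]; ring
    simp only [id, Pi.mul_apply, Pi.add_apply, Pi.sub_apply, Pi.pow_apply]
    rw [div_eq_div_iff (by positivity) (by positivity)]
    set S := sinh a
    set C := cosh a
    have key : ((((2 : ℕ) : ℝ) * C ^ (2 - 1) * S) * (a ^ 2 + a * S * C - 2 * S ^ 2) + C ^ 2 *
        (((2 : ℕ) : ℝ) * a ^ (2 - 1) * 1 + ((1 * S + a * C) * C + a * S * S)
          - 2 * (((2 : ℕ) : ℝ) * S ^ (2 - 1) * C))) * (S * C - a)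
        - C ^ 2 * (a ^ 2 + a * S * C - 2 * S ^ 2) * 2 * (2 * S ^ 2)
        = C * (S ^ 4 * C - 3 * S ^ 2 * C - 6 * a ^ 2 * S ^ 2 * C
      + 10 * a * S ^ 3 + 6 * a * S - 2 * a ^ 3 * S - 3 * a ^ 2 * C) := by
      norm_num
      rw [hs4, hs3]
      ring_nf
      rw [hs4, hs3, hs2]
      ring
    norm_num at key ⊢
    linear_combination (S * C - a) ^ 4 * key
  · have := hyperbolic_key a
    have h2 : 0 < sinh a * cosh a - a := by linarith [lt_sinh_mul_cosh ha]
    have := cosh_pos a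
    positivity

theorem slopeRatio_halfAngle_antitoneOn :
    AntitoneOn (fun x => slopeRatio (halfAngle x)) (Ioo 0 (1 / 2)) :=
  fun _ hx _ hy hxy => slopeRatio_monotoneOn (mapsTo_halfAngle hy) (mapsTo_halfAngle hx)
    (halfAngle_antitoneOn hx hy hxy)

theorem defectRatio_halfAngle_monotoneOn :
    MonotoneOn (fun x => defectRatio (halfAngle x)) (Ioo 0 (1 / 2)) :=
  defectRatio_antitoneOn.comp halfAngle_antitoneOn mapsTo_halfAngle

theorem slopeRatio_halfAngle_convexOn :
    ConvexOn ℝ (Ioo 0 (1 / 2)) fun x => slopeRatio (halfAngle x) := by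
  have hd : ∀ x ∈ Ioo (0 : ℝ) (1 / 2), HasDerivAt (fun x => slopeRatio (halfAngle x)) _ x :=
    fun x hx => (hasDerivAt_slopeRatio (halfAngle_pos hx)).comp x (hasDerivAt_halfAngle hx)
  refine MonotoneOn.convexOn_of_deriv (convex_Ioo _ _)
    (fun x hx => (hd x hx).continuousAt.continuousWithinAt)
    (fun x hx => (hd x (interior_subset hx)).differentiableAt.differentiableWithinAt) ?_
  rw [interior_Ioo]
  intro x hx y hy hxy
  rw [(hd x hx).deriv, (hd y hy).deriv]
  have := slopeRatio_deriv_monotoneOn (mapsTo_halfAngle hy) (mapsTo_halfAngle hx)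
    (halfAngle_antitoneOn hx hy hxy)
  simp only at this
  linarith

theorem defectRatio_halfAngle_concaveOn :
    ConcaveOn ℝ (Ioo 0 (1 / 2)) fun x => defectRatio (halfAngle x) := by
  have hd : ∀ x ∈ Ioo (0 : ℝ) (1 / 2), HasDerivAt (fun x => defectRatio (halfAngle x)) _ x :=
    fun x hx => (hasDerivAt_defectRatio (halfAngle_pos hx)).comp x (hasDerivAt_halfAngle hx)
  refine AntitoneOn.concaveOn_of_deriv (convex_Ioo _ _)
    (fun x hx => (hd x hx).continuousAt.continuousWithinAt)
    (fun x hx => (hd x (interior_subset hx)).differentiableAt.differentiableWithinAt) ?_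
  rw [interior_Ioo]
  intro x hx y hy hxy
  rw [(hd x hx).deriv, (hd y hy).deriv]
  have := defectRatio_deriv_monotoneOn (mapsTo_halfAngle hy) (mapsTo_halfAngle hx)
    (halfAngle_antitoneOn hx hy hxy)
  have e : ∀ x ∈ Ioo (0 : ℝ) (1 / 2),
      -(sinh (halfAngle x) * (halfAngle x ^ 2 + halfAngle x * sinh (halfAngle x) *
        cosh (halfAngle x) - 2 * sinh (halfAngle x) ^ 2) /
        (sinh (halfAngle x) * cosh (halfAngle x) - halfAngle x) ^ 2) *
        -(2 * cosh (halfAngle x) ^ 2 / sinh (halfAngle x))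
      = 2 * (cosh (halfAngle x) ^ 2 * (halfAngle x ^ 2 + halfAngle x * sinh (halfAngle x) *
        cosh (halfAngle x) - 2 * sinh (halfAngle x) ^ 2) /
        (sinh (halfAngle x) * cosh (halfAngle x) - halfAngle x) ^ 2) := fun x hx => by
    have := sinh_halfAngle_pos hx
    have : sinh (halfAngle x) * cosh (halfAngle x) - halfAngle x ≠ 0 := by
      linarith [lt_sinh_mul_cosh (halfAngle_pos hx)]
    field_simp
  rw [e x hx, e y hy]
  simp only at this
  linarith

end TripleTradeoff

/-! ### The qubit entropy as a function of the determinant. -/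

noncomputable section

namespace TripleTradeoff

open Real Set

/-- The entropy (in nats) of a qubit state of determinant `D`. -/
def detEntropy (D : ℝ) : ℝ := binEntropy ((1 + √(1 - 4 * D)) / 2)

/-- The derivative of `detEntropy`. -/
def detSlope (D : ℝ) : ℝ := 1 / (√D * slopeRatio (halfAngle √D))

/-- The curvature defect: `detSlope' = - detSlope / (detDefect + 2 D)`. -/
def detDefect (D : ℝ) : ℝ := √D * defectRatio (halfAngle √D)

theorem sqrt_mem_Ioo {D : ℝ} (hD : D ∈ Ioo (0 : ℝ) (1 / 4)) : √D ∈ Ioo (0 : ℝ) (1 / 2) :=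
  ⟨sqrt_pos.2 hD.1, (sqrt_lt' (by norm_num)).2 (by norm_num; linarith [hD.2])⟩

theorem slopeRatio_pos {a : ℝ} (ha : 0 < a) : 0 < slopeRatio a :=
  div_pos (sinh_pos_iff.2 ha) ha

theorem defectRatio_pos {a : ℝ} (ha : 0 < a) : 0 < defectRatio a :=
  div_pos (by linarith [sinh_lt_mul_cosh ha]) (by linarith [lt_sinh_mul_cosh ha])

theorem detSlope_pos {D : ℝ} (hD : D ∈ Ioo (0 : ℝ) (1 / 4)) : 0 < detSlope D := by
  have h := sqrt_mem_Ioo hD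
  exact one_div_pos.2 (mul_pos h.1 (slopeRatio_pos (halfAngle_pos h)))

theorem detDefect_pos {D : ℝ} (hD : D ∈ Ioo (0 : ℝ) (1 / 4)) : 0 < detDefect D := by
  have h := sqrt_mem_Ioo hD
  exact mul_pos h.1 (defectRatio_pos (halfAngle_pos h))

theorem detEntropy_continuous : Continuous detEntropy := by
  unfold detEntropy
  fun_prop

theorem eq_inv_four_mul_cosh_sq {D : ℝ} (hD : D ∈ Ioo (0 : ℝ) (1 / 4)) :
    D = 1 / (4 * cosh (halfAngle √D) ^ 2) := by
  have h := eq_inv_two_mul_cosh (sqrt_mem_Ioo hD)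
  calc D = √D ^ 2 := (sq_sqrt hD.1.le).symm
    _ = (1 / (2 * cosh (halfAngle √D))) ^ 2 := by rw [← h]
    _ = _ := by rw [div_pow]; ring

/-- The eigenvalue gap is `tanh a`, so the eigenvalues are `exp (±a) / (2 * cosh a)` and their
log-ratio is `2 * a`. This is what makes the angle the natural parameter. -/
theorem sqrt_one_sub_four_mul {D : ℝ} (hD : D ∈ Ioo (0 : ℝ) (1 / 4)) :
    √(1 - 4 * D) = sinh (halfAngle √D) / cosh (halfAngle √D) := by
  have h := eq_inv_four_mul_cosh_sq hD
  have hs := sinh_halfAngle_pos (sqrt_mem_Ioo hD)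
  have hc := cosh_pos (halfAngle √D)
  set a := halfAngle √D
  rw [sqrt_eq_iff_mul_self_eq_of_pos (by positivity), h]
  have := cosh_sq a
  field_simp
  linarith

theorem detSlope_eq {D : ℝ} (hD : D ∈ Ioo (0 : ℝ) (1 / 4)) :
    detSlope D = 2 * halfAngle √D * cosh (halfAngle √D) / sinh (halfAngle √D) := by
  have h := eq_inv_two_mul_cosh (sqrt_mem_Ioo hD)
  have hs := sinh_halfAngle_pos (sqrt_mem_Ioo hD)
  have hc := cosh_pos (halfAngle √D)
  have ha := halfAngle_pos (sqrt_mem_Ioo hD)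
  have e : detSlope D = 1 / (1 / (2 * cosh (halfAngle √D)) * slopeRatio (halfAngle √D)) := by
    rw [← h]; rfl
  rw [e, slopeRatio]
  field_simp

theorem hasDerivAt_detEntropy {D : ℝ} (hD : D ∈ Ioo (0 : ℝ) (1 / 4)) :
    HasDerivAt detEntropy (detSlope D) D := by
  have hpos : 0 < 1 - 4 * D := by linarith [hD.2]
  have hr := sqrt_one_sub_four_mul hD
  have hs := sinh_halfAngle_pos (sqrt_mem_Ioo hD)
  have hc := cosh_pos (halfAngle √D)
  rw [detSlope_eq hD]
  set a := halfAngle √D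
  have hr1 : sinh a / cosh a < 1 := by
    rw [div_lt_one hc]
    have := exp_pos (-a)
    have := cosh_sub_sinh a
    linarith
  have hr0 : 0 < sinh a / cosh a := by positivity
  have h1 : HasDerivAt (fun D : ℝ => (1 + √(1 - 4 * D)) / 2) ((-4 / (2 * √(1 - 4 * D))) / 2) D := by
    have := ((((hasDerivAt_id D).const_mul 4).const_sub 1).sqrt hpos.ne').const_add 1
    simpa using this.div_const 2
  have h2 := hasDerivAt_binEntropy (p := (1 + √(1 - 4 * D)) / 2) (by rw [hr]; linarith)
    (by rw [hr]; linarith)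
  refine (h2.comp D h1).congr_deriv ?_
  rw [hr]
  have e1 : 1 - (1 + sinh a / cosh a) / 2 = exp (-a) / (2 * cosh a) := by
    rw [← cosh_sub_sinh]; field_simp; ring
  have e2 : (1 + sinh a / cosh a) / 2 = exp a / (2 * cosh a) := by
    rw [← cosh_add_sinh]; field_simp
  rw [e1, e2, log_div (exp_pos _).ne' (by positivity), log_div (exp_pos _).ne' (by positivity),
    log_exp, log_exp]
  field_simp
  ring

theorem hasDerivAt_detAngle {D : ℝ} (hD : D ∈ Ioo (0 : ℝ) (1 / 4)) :
    HasDerivAt (fun D => halfAngle √D)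
      (-(2 * cosh (halfAngle √D) ^ 3 / sinh (halfAngle √D))) D := by
  have h1 := hasDerivAt_sqrt hD.1.ne'
  refine ((hasDerivAt_halfAngle (sqrt_mem_Ioo hD)).comp D h1).congr_deriv ?_
  have h := cosh_halfAngle (sqrt_mem_Ioo hD)
  rw [← h]
  ring

theorem detDefect_add_eq {D : ℝ} (hD : D ∈ Ioo (0 : ℝ) (1 / 4)) :
    detDefect D + 2 * D = halfAngle √D * sinh (halfAngle √D) ^ 2 /
      (2 * cosh (halfAngle √D) ^ 2 *
        (sinh (halfAngle √D) * cosh (halfAngle √D) - halfAngle √D)) := by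
  have h := eq_inv_two_mul_cosh (sqrt_mem_Ioo hD)
  have h' := eq_inv_four_mul_cosh_sq hD
  have hs := sinh_halfAngle_pos (sqrt_mem_Ioo hD)
  have hc := cosh_pos (halfAngle √D)
  have ha := lt_sinh_mul_cosh (halfAngle_pos (sqrt_mem_Ioo hD))
  have e : detDefect D + 2 * D = 1 / (2 * cosh (halfAngle √D)) * defectRatio (halfAngle √D)
      + 2 * (1 / (4 * cosh (halfAngle √D) ^ 2)) := by
    rw [← h, ← h']; rfl
  rw [e, defectRatio]
  set a := halfAngle √D
  have hne : sinh a * cosh a - a ≠ 0 := by linarith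
  rw [← sub_eq_zero]
  have e2 : 1 / (2 * cosh a) * ((a * cosh a - sinh a) / (sinh a * cosh a - a)) +
      2 * (1 / (4 * cosh a ^ 2)) - a * sinh a ^ 2 / (2 * cosh a ^ 2 * (sinh a * cosh a - a))
      = a * (cosh a ^ 2 - (sinh a ^ 2 + 1)) / (2 * cosh a ^ 2 * (sinh a * cosh a - a)) := by
    generalize hw : sinh a * cosh a - a = w at hne
    field_simp
    linear_combination (-4) * hw
  rw [e2, cosh_sq a]
  simp

theorem hasDerivAt_detSlope {D : ℝ} (hD : D ∈ Ioo (0 : ℝ) (1 / 4)) :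
    HasDerivAt detSlope (-(detSlope D / (detDefect D + 2 * D))) D := by
  have hs := sinh_halfAngle_pos (sqrt_mem_Ioo hD)
  have hc := cosh_pos (halfAngle √D)
  have ha0 := halfAngle_pos (sqrt_mem_Ioo hD)
  have ha := lt_sinh_mul_cosh ha0
  have h1 : HasDerivAt (fun a => 2 * a * cosh a / sinh a)
      (2 * (sinh (halfAngle √D) * cosh (halfAngle √D) - halfAngle √D) / sinh (halfAngle √D) ^ 2)
      (halfAngle √D) := by
    refine ((((hasDerivAt_id _).const_mul 2).mul (hasDerivAt_cosh _)).div (hasDerivAt_sinh _)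
      hs.ne').congr_deriv ?_
    have := cosh_sq (halfAngle √D)
    simp only [Pi.mul_apply]
    congr 1
    linear_combination (-2 * halfAngle √D) * this
  have h2 := h1.comp D (hasDerivAt_detAngle hD)
  have h3 : HasDerivAt detSlope _ D := h2.congr_of_eventuallyEq (by
    filter_upwards [isOpen_Ioo.mem_nhds hD] with y hy using detSlope_eq hy)
  refine h3.congr_deriv ?_
  rw [detDefect_add_eq hD, detSlope_eq hD]
  set a := halfAngle √D
  have hne : sinh a * cosh a - a ≠ 0 := by linarith
  field_simp

theorem detEntropy_contDiffAt {D : ℝ} (hD : D ∈ Ioo (0 : ℝ) (1 / 4)) :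
    ContDiffAt ℝ 2 detEntropy D := by
  have hpos : 0 < 1 - 4 * D := by linarith [hD.2]
  have hlt : √(1 - 4 * D) < 1 := (sqrt_lt' one_pos).2 (by linarith [hD.1])
  have h0 := sqrt_nonneg (1 - 4 * D)
  have e : detEntropy = fun D => -((1 + √(1 - 4 * D)) / 2 * log ((1 + √(1 - 4 * D)) / 2)) -
      (1 - (1 + √(1 - 4 * D)) / 2) * log (1 - (1 + √(1 - 4 * D)) / 2) := by
    ext D
    simp only [detEntropy, binEntropy_eq_negMulLog_add_negMulLog_one_sub, negMulLog]
    ring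
  rw [e]
  have hq : ContDiffAt ℝ 2 (fun D : ℝ => (1 + √(1 - 4 * D)) / 2) D :=
    (contDiffAt_const.add ((contDiffAt_const.sub (contDiffAt_const.mul contDiffAt_id)).sqrt
      hpos.ne')).div_const 2
  have hq' : ContDiffAt ℝ 2 (fun D : ℝ => 1 - (1 + √(1 - 4 * D)) / 2) D := contDiffAt_const.sub hq
  have n1 : (1 + √(1 - 4 * D)) / 2 ≠ 0 := by positivity
  have n2 : 1 - (1 + √(1 - 4 * D)) / 2 ≠ 0 := by linarith
  exact ((hq.mul (hq.log n1)).neg).sub (hq'.mul (hq'.log n2))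

theorem detEntropy_strictMonoOn : StrictMonoOn detEntropy (Icc 0 (1 / 4)) := by
  refine strictMonoOn_of_deriv_pos (convex_Icc _ _) detEntropy_continuous.continuousOn ?_
  rw [interior_Icc]
  intro D hD
  rw [(hasDerivAt_detEntropy hD).deriv]
  exact detSlope_pos hD

theorem detDefect_monotoneOn : MonotoneOn detDefect (Ioo 0 (1 / 4)) := by
  intro x hx y hy hxy
  have h := sqrt_mem_Ioo hx
  exact mul_le_mul (sqrt_le_sqrt hxy)
    (defectRatio_halfAngle_monotoneOn h (sqrt_mem_Ioo hy) (sqrt_le_sqrt hxy))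
    (defectRatio_pos (halfAngle_pos h)).le (sqrt_nonneg y)

/-- In the angle the quotient is `2 * cosh a * defectRatio a`, which increases with `a`, while the
angle decreases with `D`. -/
theorem detDefect_div_antitoneOn : AntitoneOn (fun D => detDefect D / D) (Ioo 0 (1 / 4)) := by
  have hm : MonotoneOn (fun a => cosh a * (a * cosh a - sinh a) / (sinh a * cosh a - a))
      (Ioi 0) := by
    refine monotoneOn_Ioi_of_hasDerivAt (fun a ha => ((hasDerivAt_cosh a).mul
      (hasDerivAt_mul_cosh_sub a)).div (hasDerivAt_sinh_mul_cosh_sub a)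
      (by linarith [lt_sinh_mul_cosh ha])) fun a ha => ?_
    refine div_nonneg ?_ (sq_nonneg _)
    have := mul_nonneg (sinh_pos_iff.2 ha).le (two_sq_mul_cosh_le ha.le)
    refine this.trans (le_of_eq ?_)
    simp only [Pi.mul_apply]
    ring
  intro x hx y hy hxy
  have e : ∀ D ∈ Ioo (0 : ℝ) (1 / 4), detDefect D / D = 2 * (cosh (halfAngle √D) *
      (halfAngle √D * cosh (halfAngle √D) - sinh (halfAngle √D)) /
      (sinh (halfAngle √D) * cosh (halfAngle √D) - halfAngle √D)) := fun D hD => by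
    have h := cosh_halfAngle (sqrt_mem_Ioo hD)
    have h0 := (sqrt_mem_Ioo hD).1
    calc detDefect D / D = √D * defectRatio (halfAngle √D) / (√D * √D) := by
          rw [mul_self_sqrt hD.1.le]; rfl
      _ = 2 * ((1 / (2 * √D)) * defectRatio (halfAngle √D)) := by field_simp
      _ = _ := by rw [← h, defectRatio]; ring
  simp only [e x hx, e y hy]
  have := hm (halfAngle_pos (sqrt_mem_Ioo hy)) (halfAngle_pos (sqrt_mem_Ioo hx))
    (halfAngle_antitoneOn (sqrt_mem_Ioo hx) (sqrt_mem_Ioo hy) (sqrt_le_sqrt hxy))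
  simp only at this
  linarith

/-- If `V ≤ X`, monotonicity of the defect suffices; if `X ≤ V`, the defect divided by the
determinant is larger at `X`, and `c * V ≤ X` finishes. -/
theorem mul_detDefect_le {c V X : ℝ} (hc : c ∈ Icc (0 : ℝ) 1) (hV : V ∈ Ioo (0 : ℝ) (1 / 4))
    (hX : X ∈ Ioo (0 : ℝ) (1 / 4)) (h : c * V ≤ X) : c * detDefect V ≤ detDefect X := by
  rcases le_total V X with hVX | hVX
  · have := detDefect_monotoneOn hV hX hVX
    have := (detDefect_pos hV).le
    nlinarith [hc.1, hc.2]
  · have h1 := detDefect_div_antitoneOn hX hV hVX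
    simp only at h1
    rw [div_le_div_iff₀ hV.1 hX.1] at h1
    have h2 := (detDefect_pos hV).le
    have h3 : c * V * detDefect V ≤ X * detDefect V := by gcongr
    have : V * (c * detDefect V) ≤ V * detDefect X := by nlinarith
    exact le_of_mul_le_mul_left this hV.1

/-- Cauchy-Schwarz for the numerators `c * P`, `K` over the denominators `c * W`, `2 * e`. The cross
term is controlled by the square of `2 * e * P - W * K`. -/
theorem sq_add_div_le {c W e P K W' : ℝ} (hc : 0 < c) (hW : 0 < W) (he : 0 < e)
    (h : c * W + 2 * e ≤ W') : (c * P + K) ^ 2 / W' ≤ c * P ^ 2 / W + K ^ 2 / (2 * e) := by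
  have h0 : 0 < c * W + 2 * e := by positivity
  calc (c * P + K) ^ 2 / W' ≤ (c * P + K) ^ 2 / (c * W + 2 * e) := by gcongr
    _ ≤ c * P ^ 2 / W + K ^ 2 / (2 * e) := by
      rw [div_add_div _ _ hW.ne' (by positivity), div_le_div_iff₀ h0 (by positivity)]
      nlinarith [mul_nonneg hc.le (sq_nonneg (2 * e * P - W * K))]

/-- Concavity of the entropy at `V` relative to the entropy at `X = c V + e`. -/
theorem detDefect_sq_le {c V X e P K : ℝ} (hc : c ∈ Ioc (0 : ℝ) 1) (hV : V ∈ Ioo (0 : ℝ) (1 / 4))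
    (hX : X ∈ Ioo (0 : ℝ) (1 / 4)) (he : 0 < e) (hXV : X = c * V + e) :
    (c * P + K) ^ 2 / (detDefect X + 2 * X)
      ≤ c * P ^ 2 / (detDefect V + 2 * V) + K ^ 2 / (2 * e) := by
  have h := mul_detDefect_le ⟨hc.1.le, hc.2⟩ hV hX (by linarith)
  refine sq_add_div_le hc.1 (by linarith [detDefect_pos hV, hV.1]) he ?_
  rw [hXV] at h ⊢
  linarith

theorem sq_div_add_le {A B E Wy Wz k P Q K : ℝ} (hA : 0 ≤ A) (hB : 0 ≤ B) (hE : 0 ≤ E)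
    (hy : 0 < Wy) (hz : 0 < Wz) (hk : 0 < k) :
    (A * P + B * Q + E * K) ^ 2 ≤ (A * Wy + B * Wz + E * (2 * k)) *
      (A * (P ^ 2 / Wy) + B * (Q ^ 2 / Wz) + E * (K ^ 2 / (2 * k))) := by
  have aux : ∀ u v p q : ℝ, 0 < u → 0 < v → 2 * (p * q) ≤ u * (q ^ 2 / v) + v * (p ^ 2 / u) := by
    intro u v p q hu hv
    have : u * (q ^ 2 / v) + v * (p ^ 2 / u) - 2 * (p * q) = (u * q - v * p) ^ 2 / (u * v) := by
      field_simp
      ring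
    have h2 : 0 ≤ (u * q - v * p) ^ 2 / (u * v) := by positivity
    linarith
  have self : ∀ u p : ℝ, 0 < u → p ^ 2 = u * (p ^ 2 / u) := fun u p hu => by field_simp
  have h1 := mul_le_mul_of_nonneg_left (aux Wy Wz P Q hy hz) (mul_nonneg hA hB)
  have h2 := mul_le_mul_of_nonneg_left (aux Wy (2 * k) P K hy (by positivity)) (mul_nonneg hA hE)
  have h3 := mul_le_mul_of_nonneg_left (aux Wz (2 * k) Q K hz (by positivity)) (mul_nonneg hB hE)
  have e1 := self Wy P hy
  have e2 := self Wz Q hz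
  have e3 := self (2 * k) K (by positivity)
  generalize P ^ 2 / Wy = p2 at *
  generalize Q ^ 2 / Wz = q2 at *
  generalize K ^ 2 / (2 * k) = k2 at *
  rw [show (A * P + B * Q + E * K) ^ 2 = A ^ 2 * P ^ 2 + B ^ 2 * Q ^ 2 + E ^ 2 * K ^ 2 +
    A * B * (2 * (P * Q)) + A * E * (2 * (P * K)) + B * E * (2 * (Q * K)) by ring, e1, e2, e3]
  linarith

end TripleTradeoff

/-! ### Comparison of the determinants Y, zY + k and ηY + k with z + η = 1. -/

noncomputable section

namespace TripleTradeoff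

open Real Set

section Comparison

variable {z η Y k : ℝ}

/-- The conclusions say that the normalised weights average `w` and `y` to at most `x`. The gap
equals `k * ((z - η) * y - (x - w))`. It is nonnegative because `(x - w) * (x + w) = (z - η) * y ^
2` and `y ≤ x + w`, the latter from `x ^ 2 + w ^ 2 = Y + 2 * k`. -/
theorem convex_weight_bound (hη : 0 < η) (hz : η < z) (hz1 : z + η = 1) (hY : 0 < Y) (hk : 0 < k)
    {x y w : ℝ} (hx : 0 < x) (hy : 0 < y) (hw : 0 < w) (hX : x ^ 2 = z * Y + k) (hY' : y ^ 2 = Y)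
    (hZ : w ^ 2 = η * Y + k) :
    0 ≤ y * (z * w - η * x) ∧ 0 < w * (x - z * y) ∧ 0 < x * (w - η * y) ∧ w < x ∧
      w * (x - z * y) + y * (z * w - η * x) = x * (w - η * y) ∧
      w * (x - z * y) * w + y * (z * w - η * x) * y ≤ x * (w - η * y) * x := by
  have h0 : 0 < z := hη.trans hz
  have h1 : z * y < x := by
    refine lt_of_pow_lt_pow_left₀ 2 hx.le ?_
    rw [mul_pow, hX, hY']
    nlinarith
  have h2 : η * y < w := by
    refine lt_of_pow_lt_pow_left₀ 2 hw.le ?_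
    rw [mul_pow, hZ, hY']
    nlinarith
  have h3 : η * x ≤ z * w := by
    refine (sq_le_sq₀ (by positivity) (by positivity)).1 ?_
    rw [mul_pow, mul_pow, hX, hZ]
    have : 0 ≤ (z - η) * (z * η * Y + (z + η) * k) := by
      have := sub_pos.2 hz
      positivity
    nlinarith
  have h4 : w < x := by
    refine lt_of_pow_lt_pow_left₀ 2 hx.le ?_
    rw [hX, hZ]
    nlinarith
  have h5 : y ≤ x + w := by
    refine (sq_le_sq₀ (by positivity) (by positivity)).1 ?_
    nlinarith [mul_pos hx hw]
  refine ⟨mul_nonneg hy.le (by linarith), mul_pos hw (by linarith), mul_pos hx (by linarith), h4,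
    by ring, ?_⟩
  have e : x ^ 2 - w ^ 2 = (z - η) * y ^ 2 := by rw [hX, hZ, hY']; ring
  have h6 : x - w ≤ (z - η) * y := by
    have : y * (x - w) ≤ y * ((z - η) * y) := by
      nlinarith [mul_nonneg (sub_nonneg.2 h5) (sub_nonneg.2 h4.le)]
    exact le_of_mul_le_mul_left this hy
  have h7 : x * (w - η * y) * x - (w * (x - z * y) * w + y * (z * w - η * x) * y)
      = k * ((z - η) * y - (x - w)) := by
    have : x * (w - η * y) * x - (w * (x - z * y) * w + y * (z * w - η * x) * y)
      = x ^ 2 * (w - η * y) - w ^ 2 * (x - z * y) - y ^ 2 * (z * w - η * x) := by ring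
    rw [this, hX, hZ, hY']
    ring
  have := mul_nonneg hk.le (sub_nonneg.2 h6)
  linarith

theorem mul_le_of_convexOn {s : Set ℝ} {F : ℝ → ℝ} (hF : ConvexOn ℝ s F) (hanti : AntitoneOn F s)
    {a b c x y w : ℝ} (hb : 0 ≤ b) (hc : 0 ≤ c) (ha : 0 < a) (habc : b + c = a)
    (h : b * w + c * y ≤ a * x) (hx : x ∈ s) (hy : y ∈ s) (hw : w ∈ s) :
    a * F x ≤ b * F w + c * F y := by
  have hb' : 0 ≤ b / a := by positivity
  have hc' : 0 ≤ c / a := by positivity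
  have hbc : b / a + c / a = 1 := by rw [← add_div, habc, div_self ha.ne']
  have h1 := hF.2 hw hy hb' hc' hbc
  have hm := hF.1 hw hy hb' hc' hbc
  simp only [smul_eq_mul] at h1 hm
  have h2 : b / a * w + c / a * y ≤ x := by
    rw [div_mul_eq_mul_div, div_mul_eq_mul_div, ← add_div, div_le_iff₀ ha]
    linarith
  have h3 := (hanti hm hx h2).trans h1
  calc a * F x ≤ a * (b / a * F w + c / a * F y) := by gcongr
    _ = b * F w + c * F y := by field_simp

/-- The reciprocal slope `σ` of the entropy. -/
theorem inv_detSlope {D : ℝ} : 1 / detSlope D = √D * slopeRatio (halfAngle √D) := by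
  rw [detSlope, one_div_one_div]

/-- The weights of `convex_weight_bound` are those obtained by expanding both products here with `1
/ detSlope D = √D * slopeRatio (halfAngle √D)`. The inequality is then Jensen for a decreasing
convex function; `three_point_defect` is its increasing concave counterpart. -/
theorem three_point_slope (hη : 0 < η) (hz : η < z) (hz1 : z + η = 1) (hk : 0 < k)
    (hY : Y ∈ Ioo (0 : ℝ) (1 / 4)) (hX : z * Y + k ∈ Ioo (0 : ℝ) (1 / 4))
    (hZ : η * Y + k ∈ Ioo (0 : ℝ) (1 / 4)) :
    (1 / detSlope (z * Y + k) - z * (1 / detSlope Y)) * (√(η * Y + k) - η * √Y)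
      ≤ (1 / detSlope (η * Y + k) - η * (1 / detSlope Y)) * (√(z * Y + k) - z * √Y) := by
  obtain ⟨hb, hc, ha, -, hs, h⟩ := convex_weight_bound hη hz hz1 hY.1 hk (sqrt_pos.2 hX.1)
    (sqrt_pos.2 hY.1) (sqrt_pos.2 hZ.1) (sq_sqrt hX.1.le) (sq_sqrt hY.1.le) (sq_sqrt hZ.1.le)
  have := mul_le_of_convexOn slopeRatio_halfAngle_convexOn slopeRatio_halfAngle_antitoneOn
    hc.le hb ha hs h (sqrt_mem_Ioo hX) (sqrt_mem_Ioo hY) (sqrt_mem_Ioo hZ)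
  simp only [inv_detSlope] at *
  linarith

theorem three_point_defect (hη : 0 < η) (hz : η < z) (hz1 : z + η = 1) (hk : 0 < k)
    (hY : Y ∈ Ioo (0 : ℝ) (1 / 4)) (hX : z * Y + k ∈ Ioo (0 : ℝ) (1 / 4))
    (hZ : η * Y + k ∈ Ioo (0 : ℝ) (1 / 4)) :
    (detDefect (η * Y + k) - η * detDefect Y) * (√(z * Y + k) - z * √Y)
      ≤ (detDefect (z * Y + k) - z * detDefect Y) * (√(η * Y + k) - η * √Y) := by
  obtain ⟨hb, hc, ha, -, hs, h⟩ := convex_weight_bound hη hz hz1 hY.1 hk (sqrt_pos.2 hX.1)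
    (sqrt_pos.2 hY.1) (sqrt_pos.2 hZ.1) (sq_sqrt hX.1.le) (sq_sqrt hY.1.le) (sq_sqrt hZ.1.le)
  have := mul_le_of_convexOn defectRatio_halfAngle_concaveOn.neg
    (defectRatio_halfAngle_monotoneOn.neg)
    hc.le hb ha hs h (sqrt_mem_Ioo hX) (sqrt_mem_Ioo hY) (sqrt_mem_Ioo hZ)
  simp only [detDefect, Pi.neg_apply] at *
  linarith

theorem detSlope_antitoneOn : AntitoneOn detSlope (Ioo 0 (1 / 4)) := by
  refine antitoneOn_of_deriv_nonpos (convex_Ioo _ _)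
    (fun x hx => (hasDerivAt_detSlope hx).continuousAt.continuousWithinAt)
    (fun x hx => (hasDerivAt_detSlope (interior_subset hx)).differentiableAt.differentiableWithinAt)
    fun x hx => ?_
  have hx := interior_subset hx
  rw [(hasDerivAt_detSlope hx).deriv]
  have := detSlope_pos hx
  have := detDefect_pos hx
  have := hx.1
  have : 0 ≤ detSlope x / (detDefect x + 2 * x) := by positivity
  linarith

theorem sqrt_mul_detSlope_monotoneOn : MonotoneOn (fun D => √D * detSlope D) (Ioo 0 (1 / 4)) := by
  intro x hx y hy hxy
  have hx' := sqrt_mem_Ioo hx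
  have hy' := sqrt_mem_Ioo hy
  have e : ∀ D ∈ Ioo (0 : ℝ) (1 / 4), √D * detSlope D = 1 / slopeRatio (halfAngle √D) :=
    fun D hD => by
      have h := sqrt_mem_Ioo hD
      have h1 := h.1
      have h2 := slopeRatio_pos (halfAngle_pos h)
      rw [detSlope]
      field_simp
  simp only [e x hx, e y hy]
  exact one_div_le_one_div_of_le (slopeRatio_pos (halfAngle_pos hy'))
    (slopeRatio_halfAngle_antitoneOn hx' hy' (sqrt_le_sqrt hxy))

/-- Two cases as in `mul_detDefect_le`, now with the slope decreasing and `√D * detSlope D`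
increasing. -/
theorem mul_detSlope_lt {c V X : ℝ} (hc : c ∈ Ioo (0 : ℝ) 1) (hV : V ∈ Ioo (0 : ℝ) (1 / 4))
    (hX : X ∈ Ioo (0 : ℝ) (1 / 4)) (h : c * V ≤ X) : c * detSlope X < detSlope V := by
  have hfX := detSlope_pos hX
  have hfV := detSlope_pos hV
  rcases le_total V X with hVX | hVX
  · have := detSlope_antitoneOn hV hX hVX
    nlinarith [hc.1, hc.2]
  · have h1 := sqrt_mul_detSlope_monotoneOn hX hV hVX
    simp only at h1
    have hsV := sqrt_pos.2 hV.1
    have h2 : c * √V < √X := by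
      refine lt_of_pow_lt_pow_left₀ 2 (sqrt_nonneg _) ?_
      rw [mul_pow, sq_sqrt hV.1.le, sq_sqrt hX.1.le]
      have := mul_pos hc.1 hV.1
      nlinarith [hc.2]
    have : √V * (c * detSlope X) < √V * detSlope V := by nlinarith
    exact lt_of_mul_lt_mul_left this hsV.le

/-- With `z + η = 1` and `k = z * η * q ^ 2` the two sides are the Y-derivatives of E_η and E_z, so
this makes E_{1-η} - E_η strictly increasing in Y. -/
theorem mul_detSlope_lt_mul (hη : 0 < η) (hz : η < z) (hk : 0 < k)
    (hX : z * Y + k ∈ Ioo (0 : ℝ) (1 / 4)) (hZ : η * Y + k ∈ Ioo (0 : ℝ) (1 / 4)) :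
    η * detSlope (η * Y + k) < z * detSlope (z * Y + k) := by
  have h0 := hη.trans hz
  have h := mul_detSlope_lt (c := η / z) ⟨by positivity, (div_lt_one h0).2 hz⟩ hX hZ (by
    rw [div_mul_eq_mul_div, div_le_iff₀ h0]
    nlinarith)
  rw [div_mul_eq_mul_div, div_lt_iff₀ h0] at h
  linarith

/-- The positive multipliers for `lagrangian_nonpos`. The defect inequality is the product of
`three_point_slope` and `three_point_defect`: one bounds the ratio of `B` to `C`, the other that of
the defect increments, by reciprocal ratios of the increments of √D. -/
theorem three_point_weights (hη : 0 < η) (hz : η < z) (hz1 : z + η = 1) (hk : 0 < k)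
    (hY : Y ∈ Ioo (0 : ℝ) (1 / 4)) (hX : z * Y + k ∈ Ioo (0 : ℝ) (1 / 4))
    (hZ : η * Y + k ∈ Ioo (0 : ℝ) (1 / 4)) {B C : ℝ}
    (hB : B = 1 / detSlope (z * Y + k) - z * (1 / detSlope Y))
    (hC : C = 1 / detSlope (η * Y + k) - η * (1 / detSlope Y)) :
    0 < z * C - η * B ∧ 0 < B ∧ B ≤ C ∧
      (z * C - η * B) * detDefect Y + B * detDefect (η * Y + k) ≤ C * detDefect (z * Y + k) := by
  have h0 : 0 < z := hη.trans hz
  have hY0 := hY.1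
  have hslope := three_point_slope hη hz hz1 hk hY hX hZ
  have hdef := three_point_defect hη hz hz1 hk hY hX hZ
  obtain ⟨-, hr1, hr2, -, -, -⟩ := convex_weight_bound hη hz hz1 hY.1 hk (sqrt_pos.2 hX.1)
    (sqrt_pos.2 hY.1) (sqrt_pos.2 hZ.1) (sq_sqrt hX.1.le) (sq_sqrt hY.1.le) (sq_sqrt hZ.1.le)
  have hr1 := pos_of_mul_pos_right hr1 (sqrt_nonneg _)
  have hr2 := pos_of_mul_pos_right hr2 (sqrt_nonneg _)
  have hr : √(z * Y + k) - z * √Y ≤ √(η * Y + k) - η * √Y := by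
    have h4 : √(η * Y + k) ≤ √(z * Y + k) := sqrt_le_sqrt (by nlinarith)
    have h5 : √Y ≤ √(z * Y + k) + √(η * Y + k) := by
      refine (sq_le_sq₀ (by positivity) (by positivity)).1 ?_
      rw [add_sq, sq_sqrt hX.1.le, sq_sqrt hZ.1.le, sq_sqrt hY.1.le]
      have : 0 ≤ 2 * √(z * Y + k) * √(η * Y + k) := by positivity
      nlinarith
    have : √Y * (√(z * Y + k) - √(η * Y + k)) ≤ √Y * ((z - η) * √Y) := by
      have e1 := sq_sqrt hX.1.le
      have e2 := sq_sqrt hZ.1.le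
      have e3 := sq_sqrt hY.1.le
      nlinarith [mul_nonneg (sub_nonneg.2 h5) (sub_nonneg.2 h4)]
    have := le_of_mul_le_mul_left this (sqrt_pos.2 hY.1)
    linarith
  have hfY := detSlope_pos hY
  have hfX := detSlope_pos hX
  have hfZ := detSlope_pos hZ
  have d1 : z * detSlope (z * Y + k) < detSlope Y :=
    mul_detSlope_lt ⟨h0, by linarith⟩ hY hX (by linarith)
  have d2 : η * detSlope (η * Y + k) < detSlope Y :=
    mul_detSlope_lt ⟨hη, by linarith⟩ hY hZ (by linarith)
  have d3 := mul_detSlope_lt_mul hη hz hk hX hZ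
  have n2 := mul_detDefect_le ⟨hη.le, by linarith⟩ hY hZ (by linarith)
  rw [← hB, ← hC] at hslope
  have dX : 0 < B := by
    rw [hB, sub_pos, mul_one_div, div_lt_div_iff₀ hfY hfX]; linarith
  have dZ : 0 < C := by
    rw [hC, sub_pos, mul_one_div, div_lt_div_iff₀ hfY hfZ]; linarith
  have hA : 0 < z * C - η * B := by
    have : z * C - η * B = z / detSlope (η * Y + k) - η / detSlope (z * Y + k) := by
      rw [hB, hC]; ring
    rw [this, sub_pos, div_lt_div_iff₀ hfX hfZ]
    linarith
  generalize detDefect (z * Y + k) = OX at *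
  generalize detDefect (η * Y + k) = OZ at *
  generalize detDefect Y = OY at *
  generalize √(z * Y + k) - z * √Y = sX at *
  generalize √(η * Y + k) - η * √Y = sZ at *
  refine ⟨hA, dX, ?_, ?_⟩
  · have : B * sZ ≤ C * sZ := hslope.trans (mul_le_mul_of_nonneg_left hr dZ.le)
    exact le_of_mul_le_mul_right this hr2
  · have h1 : (OZ - η * OY) * B ≤ (OX - z * OY) * C := by
      have : sZ * ((OZ - η * OY) * B) ≤ sZ * ((OX - z * OY) * C) := by
        calc sZ * ((OZ - η * OY) * B) = (OZ - η * OY) * (B * sZ) := by ring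
          _ ≤ (OZ - η * OY) * (C * sX) := mul_le_mul_of_nonneg_left hslope (by linarith)
          _ = (OZ - η * OY) * sX * C := by ring
          _ ≤ (OX - z * OY) * sZ * C := mul_le_mul_of_nonneg_right hdef dZ.le
          _ = sZ * ((OX - z * OY) * C) := by ring
      exact le_of_mul_le_mul_left this hr2
    linarith

/-- The relation `A + η * B = z * C` cancels `T` and also gives `A * P + B * (η * P + K) + (C - B) *
K = C * (z * P + K)`. What remains is Cauchy-Schwarz with weights `A`, `B`, `C - B`. -/
theorem lagrangian_nonpos {A B C Wx Wy Wz P K T : ℝ} (hA : 0 < A) (hB : 0 < B) (hBC : B ≤ C)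
    (hABC : A + η * B = z * C) (hk : 0 < k) (hx : 0 < Wx) (hy : 0 < Wy) (hz : 0 < Wz)
    (h : A * Wy + B * Wz + (C - B) * (2 * k) ≤ C * Wx) :
    A * (T - P ^ 2 / Wy) + B * (η * T + K ^ 2 / (2 * k) - (η * P + K) ^ 2 / Wz)
      - C * (z * T + K ^ 2 / (2 * k) - (z * P + K) ^ 2 / Wx) ≤ 0 := by
  have hC : 0 < C := hB.trans_le hBC
  have hE := sub_nonneg.2 hBC
  have titu := sq_div_add_le hA.le hB.le hE hy hz hk (P := P) (Q := η * P + K) (K := K)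
  have e1 : A * P + B * (η * P + K) + (C - B) * K = C * (z * P + K) := by
    linear_combination P * hABC
  rw [e1] at titu
  have hR : 0 ≤ A * (P ^ 2 / Wy) + B * ((η * P + K) ^ 2 / Wz) + (C - B) * (K ^ 2 / (2 * k)) := by
    positivity
  have h3 := titu.trans (mul_le_mul_of_nonneg_right h hR)
  have h2 : C * ((z * P + K) ^ 2 / Wx) ≤
      A * (P ^ 2 / Wy) + B * ((η * P + K) ^ 2 / Wz) + (C - B) * (K ^ 2 / (2 * k)) := by
    rw [← mul_div_assoc, div_le_iff₀ hx]
    refine le_of_mul_le_mul_left ?_ hC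
    exact le_of_eq_of_le (by ring) (h3.trans_eq (by ring))
  have e2 : A * T + B * (η * T) = C * (z * T) := by linear_combination T * hABC
  linarith

/-- The second-order condition behind the trade-off between `f₁ - f₃` and `f₃ - f₂`. -/
theorem three_point_second_order (hη : 0 < η) (hz : η < z) (hz1 : z + η = 1) (hk : 0 < k)
    (hY : Y ∈ Ioo (0 : ℝ) (1 / 4)) (hX : z * Y + k ∈ Ioo (0 : ℝ) (1 / 4))
    (hZ : η * Y + k ∈ Ioo (0 : ℝ) (1 / 4)) (P K T : ℝ)
    (hN : detSlope (z * Y + k) * (z * T + K ^ 2 / (2 * k) -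
        (z * P + K) ^ 2 / (detDefect (z * Y + k) + 2 * (z * Y + k)))
      = detSlope (η * Y + k) * (η * T + K ^ 2 / (2 * k) -
        (η * P + K) ^ 2 / (detDefect (η * Y + k) + 2 * (η * Y + k)))) :
    detSlope Y * (T - P ^ 2 / (detDefect Y + 2 * Y)) - detSlope (z * Y + k) *
      (z * T + K ^ 2 / (2 * k) -
        (z * P + K) ^ 2 / (detDefect (z * Y + k) + 2 * (z * Y + k))) ≤ 0 := by
  obtain ⟨hA, hB, hBC, hO⟩ := three_point_weights hη hz hz1 hk hY hX hZ rfl rfl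
  have hfY := detSlope_pos hY
  have hfX := detSlope_pos hX
  have hfZ := detSlope_pos hZ
  have hL := lagrangian_nonpos (η := η) (z := z) (k := k) (P := P) (K := K) (T := T) hA hB hBC
    (by ring) hk (by linarith [detDefect_pos hX, hX.1]) (by linarith [detDefect_pos hY, hY.1])
    (by linarith [detDefect_pos hZ, hZ.1]) (Wx := detDefect (z * Y + k) + 2 * (z * Y + k))
    (Wy := detDefect Y + 2 * Y) (Wz := detDefect (η * Y + k) + 2 * (η * Y + k)) (by linarith)
  generalize z * T + K ^ 2 / (2 * k) -
    (z * P + K) ^ 2 / (detDefect (z * Y + k) + 2 * (z * Y + k)) = uX at *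
  generalize η * T + K ^ 2 / (2 * k) -
    (η * P + K) ^ 2 / (detDefect (η * Y + k) + 2 * (η * Y + k)) = uZ at *
  generalize T - P ^ 2 / (detDefect Y + 2 * Y) = uY at *
  generalize detSlope (z * Y + k) = fX at *
  generalize detSlope (η * Y + k) = fZ at *
  generalize detSlope Y = fY at *
  -- The constraint eliminates `uZ`. The multipliers are chosen so that the combination bounded by
  -- `hL`, times `fY`, becomes `A` times the goal.
  have hu : uZ = fX * uX / fZ := by rw [eq_div_iff hfZ.ne']; linarith
  refine le_of_mul_le_mul_left ?_ hA
  calc _ = fY * ((z * (1 / fZ - η * (1 / fY)) - η * (1 / fX - z * (1 / fY))) * uY +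
        (1 / fX - z * (1 / fY)) * uZ - (1 / fZ - η * (1 / fY)) * uX) := by
        rw [hu]
        field_simp
        ring
    _ ≤ fY * 0 := mul_le_mul_of_nonneg_left hL hfY.le
    _ = _ := by ring

end Comparison

end TripleTradeoff

/-! ### Jensen's inequality in the coordinates (q, U). -/

noncomputable section

namespace TripleTradeoff

open Real Set Filter Topology

section Jensen

/-- Pairs of an excited-state population `q` and a determinant `Y` of a mixed, full-rank qubit
state with nonzero coherence. -/
def mixedRegion : Set (ℝ × ℝ) := {x | 0 < x.1 ∧ x.1 < 1 ∧ 0 < x.2 ∧ x.2 < x.1 * (1 - x.1)}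

/-- Pairs of an excited-state population `q` and a determinant `Y` of a qubit state. -/
def stateRegion : Set (ℝ × ℝ) := {x | 0 ≤ x.1 ∧ x.1 ≤ 1 ∧ 0 ≤ x.2 ∧ x.2 ≤ x.1 * (1 - x.1)}

theorem isOpen_mixedRegion : IsOpen mixedRegion := by
  refine (isOpen_lt continuous_const continuous_fst).inter
    ((isOpen_lt continuous_fst continuous_const).inter
      ((isOpen_lt continuous_const continuous_snd).inter (isOpen_lt continuous_snd ?_)))
  fun_prop

variable {U V : ℝ × ℝ → ℝ}

/-- The image of `mixedRegion` under `(q, Y) ↦ (q, U (q, Y))`. -/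
def levelRegion (U : ℝ × ℝ → ℝ) : Set (ℝ × ℝ) :=
  {e | 0 < e.1 ∧ e.1 < 1 ∧ U (e.1, 0) < e.2 ∧ e.2 < U (e.1, e.1 * (1 - e.1))}

theorem strictMonoOn_slice (hUc : Continuous U) (hU : ∀ x ∈ mixedRegion, ContDiffAt ℝ 2 U x)
    (hUY : ∀ x ∈ mixedRegion, 0 < fderiv ℝ U x (0, 1)) {q : ℝ} (hq0 : 0 < q) (hq1 : q < 1) :
    StrictMonoOn (fun Y => U (q, Y)) (Icc 0 (q * (1 - q))) := by
  refine strictMonoOn_of_deriv_pos (convex_Icc _ _) (by fun_prop) fun Y hY => ?_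
  rw [interior_Icc] at hY
  have hm : (q, Y) ∈ mixedRegion := ⟨hq0, hq1, hY.1, hY.2⟩
  have h1 : HasDerivAt (fun Y : ℝ => ((q, Y) : ℝ × ℝ)) (0, 1) Y :=
    (hasDerivAt_const Y q).prodMk (hasDerivAt_id Y)
  have h2 := ((hU _ hm).differentiableAt (by norm_num)).hasFDerivAt.comp_hasDerivAt Y h1
  have h3 : deriv (fun Y => U (q, Y)) Y = _ := h2.deriv
  rw [h3]
  exact hUY _ hm

theorem exists_level (hUc : Continuous U) {e : ℝ × ℝ} (he : e ∈ levelRegion U) :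
    ∃ Y, (e.1, Y) ∈ mixedRegion ∧ U (e.1, Y) = e.2 := by
  obtain ⟨h0, h1, h2, h3⟩ := he
  have hle : 0 ≤ e.1 * (1 - e.1) := mul_nonneg h0.le (by linarith)
  obtain ⟨Y, hY, hUY⟩ := intermediate_value_Ioo (f := fun Y => U (e.1, Y)) hle (by fun_prop)
    (show e.2 ∈ Ioo _ _ from ⟨h2, h3⟩)
  exact ⟨Y, ⟨h0, h1, hY.1, hY.2⟩, hUY⟩

theorem level_mem (hmono : ∀ q, 0 < q → q < 1 → StrictMonoOn (fun Y => U (q, Y))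
    (Icc 0 (q * (1 - q)))) {x : ℝ × ℝ} (hx : x ∈ mixedRegion) : (x.1, U x) ∈ levelRegion U := by
  obtain ⟨h0, h1, h2, h3⟩ := hx
  have h := hmono x.1 h0 h1
  exact ⟨h0, h1, h ⟨le_rfl, h2.le.trans h3.le⟩ ⟨h2.le, h3.le⟩ h2,
    h ⟨h2.le, h3.le⟩ ⟨h2.le.trans h3.le, le_rfl⟩ h3⟩

/-- The region lies strictly between the value curves of pure states (Y = 0, below) and of diagonal
states (Y = q(1-q), above). -/
theorem convex_levelRegion (hbot : ConvexOn ℝ (Ioo 0 1) fun q => U (q, 0))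
    (htop : ConcaveOn ℝ (Ioo 0 1) fun q => U (q, q * (1 - q))) : Convex ℝ (levelRegion U) := by
  intro e he e' he' a b ha hb hab
  have hq : e.1 ∈ Ioo (0 : ℝ) 1 := ⟨he.1, he.2.1⟩
  have hq' : e'.1 ∈ Ioo (0 : ℝ) 1 := ⟨he'.1, he'.2.1⟩
  have hm := convex_Ioo (0 : ℝ) 1 hq hq' ha hb hab
  have h1 := hbot.2 hq hq' ha hb hab
  have h2 := htop.2 hq hq' ha hb hab
  have hs : a * U (e.1, 0) + b * U (e'.1, 0) < a * e.2 + b * e'.2 := by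
    rcases ha.eq_or_lt with h | h
    · have : b = 1 := by linarith
      subst h; subst this; linarith [he'.2.2.1]
    · nlinarith [he.2.2.1, he'.2.2.1]
  have hs' : a * e.2 + b * e'.2
      < a * U (e.1, e.1 * (1 - e.1)) + b * U (e'.1, e'.1 * (1 - e'.1)) := by
    rcases ha.eq_or_lt with h | h
    · have : b = 1 := by linarith
      subst h; subst this; linarith [he'.2.2.2]
    · nlinarith [he.2.2.2, he'.2.2.2]
  refine ⟨hm.1, hm.2, ?_, ?_⟩
  · exact h1.trans_lt hs
  · exact hs'.trans_le h2

/-- The inverse function theorem for `(q, Y) ↦ (q, U (q, Y))`: the smooth local inverse agrees with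
`inv` because `U` is injective in Y. -/
theorem contDiffAt_level (hU : ∀ x ∈ mixedRegion, ContDiffAt ℝ 2 U x)
    (hUY : ∀ x ∈ mixedRegion, 0 < fderiv ℝ U x (0, 1))
    (hmono : ∀ q, 0 < q → q < 1 → StrictMonoOn (fun Y => U (q, Y)) (Icc 0 (q * (1 - q))))
    {inv : ℝ × ℝ → ℝ}
    (hinv : ∀ e ∈ levelRegion U, (e.1, inv e) ∈ mixedRegion ∧ U (e.1, inv e) = e.2)
    {e : ℝ × ℝ} (he : e ∈ levelRegion U) :
    ContDiffAt ℝ 2 inv e ∧ ∀ᶠ y in 𝓝 e, y ∈ levelRegion U := by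
  obtain ⟨hx, hUx⟩ := hinv e he
  set x : ℝ × ℝ := (e.1, inv e) with hxdef
  have hC : ContDiffAt ℝ 2 (fun x : ℝ × ℝ => (x.1, U x)) x := contDiffAt_fst.prodMk (hU x hx)
  set L := fderiv ℝ U x
  have hL : HasFDerivAt U L x := ((hU x hx).differentiableAt (by norm_num)).hasFDerivAt
  have hb : L (0, 1) ≠ 0 := (hUY x hx).ne'
  have hLs : ∀ p q : ℝ, L (p, q) = p * L (1, 0) + q * L (0, 1) := fun p q => by
    have : ((p, q) : ℝ × ℝ) = p • (1, 0) + q • (0, 1) := by simp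
    rw [this, map_add, map_smul, map_smul, smul_eq_mul, smul_eq_mul]
  let A : (ℝ × ℝ) ≃L[ℝ] (ℝ × ℝ) := ContinuousLinearEquiv.equivOfInverse
    ((ContinuousLinearMap.fst ℝ ℝ ℝ).prod L)
    ((ContinuousLinearMap.fst ℝ ℝ ℝ).prod ((L (0, 1))⁻¹ •
      (ContinuousLinearMap.snd ℝ ℝ ℝ - L (1, 0) • ContinuousLinearMap.fst ℝ ℝ ℝ)))
    (fun p => by
      ext
      · simp
      · have := hLs p.1 p.2
        simp only [Prod.mk.eta] at this
        simp [this]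
        field_simp
        ring)
    (fun p => by
      ext
      · simp
      · have := hLs p.1 ((L (0, 1))⁻¹ * (p.2 - L (1, 0) * p.1))
        change L (p.1, (L (0, 1))⁻¹ * (p.2 - L (1, 0) * p.1)) = p.2
        rw [this]
        field_simp
        ring)
  have hF : HasFDerivAt (fun x : ℝ × ℝ => (x.1, U x)) (A : (ℝ × ℝ) →L[ℝ] (ℝ × ℝ)) x :=
    hasFDerivAt_fst.prodMk hL
  have h2 : (2 : WithTop ℕ∞) ≠ 0 := by norm_num
  have hloc := hC.to_localInverse hF h2
  have himg := hC.localInverse_apply_image hF h2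
  have hFx : (x.1, U x) = e := by rw [hUx]
  have hright := (hC.hasStrictFDerivAt' hF h2).eventually_right_inverse
  change ∀ᶠ y in 𝓝 (x.1, U x), (fun x : ℝ × ℝ => (x.1, U x)) (hC.localInverse hF h2 y) = y at hright
  simp only [hFx] at hloc himg hright
  set G := hC.localInverse hF h2
  have hGI : ∀ᶠ y in 𝓝 e, G y ∈ mixedRegion :=
    hloc.continuousAt.eventually_mem (isOpen_mixedRegion.mem_nhds (by rw [himg]; exact hx))
  have hJ : ∀ᶠ y in 𝓝 e, y ∈ levelRegion U := by
    filter_upwards [hright, hGI] with y h1 h2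
    rw [← h1]
    exact level_mem hmono h2
  refine ⟨?_, hJ⟩
  refine (hloc.snd).congr_of_eventuallyEq ?_
  filter_upwards [hright, hGI, hJ] with y h1 h2 h3
  obtain ⟨hy, hUy⟩ := hinv y h3
  have e1 : (G y).1 = y.1 := (Prod.ext_iff.1 h1).1
  have e2 : U (G y) = y.2 := (Prod.ext_iff.1 h1).2
  have hG : G y = (y.1, (G y).2) := Prod.ext e1 rfl
  refine (hmono y.1 h3.1 h3.2.1).injOn ⟨hy.2.2.1.le, hy.2.2.2.le⟩ ?_ ?_
  · rw [hG] at h2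
    exact ⟨h2.2.2.1.le, h2.2.2.2.le⟩
  · simp only
    rw [hUy, ← hG, e2]

/-- A segment in the (q, U)-plane lifts to a curve along which q and U are affine. There `hform`
gives V'' ≤ 0, hence concavity on each segment. -/
theorem concaveOn_level (hUc : Continuous U) (hU : ∀ x ∈ mixedRegion, ContDiffAt ℝ 2 U x)
    (hV : ∀ x ∈ mixedRegion, ContDiffAt ℝ 2 V x)
    (hUY : ∀ x ∈ mixedRegion, 0 < fderiv ℝ U x (0, 1))
    (hbot : ConvexOn ℝ (Ioo 0 1) fun q => U (q, 0))
    (htop : ConcaveOn ℝ (Ioo 0 1) fun q => U (q, q * (1 - q)))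
    (hform : ∀ (Q Y : ℝ → ℝ) (R t : ℝ), (∀ s, HasDerivAt Q R s) → ContDiffAt ℝ 2 Y t →
      (Q t, Y t) ∈ mixedRegion → deriv (deriv fun s => U (Q s, Y s)) t = 0 →
      deriv (deriv fun s => V (Q s, Y s)) t ≤ 0)
    {inv : ℝ × ℝ → ℝ}
    (hinv : ∀ e ∈ levelRegion U, (e.1, inv e) ∈ mixedRegion ∧ U (e.1, inv e) = e.2) :
    ConcaveOn ℝ (levelRegion U) fun e => V (e.1, inv e) := by
  have hmono := fun q h0 h1 => strictMonoOn_slice hUc hU hUY (q := q) h0 h1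
  have hconv := convex_levelRegion hbot htop
  refine ⟨hconv, fun e he e' he' a b ha hb hab => ?_⟩
  let E : ℝ → ℝ × ℝ := fun t => (e.1 + (e'.1 - e.1) * t, e.2 + (e'.2 - e.2) * t)
  have hEC : ContDiff ℝ 2 E := by fun_prop
  have hE : ∀ t ∈ Icc (0 : ℝ) 1, E t ∈ levelRegion U := fun t ht => by
    have := hconv he he' (sub_nonneg.2 ht.2) ht.1 (by ring)
    convert! this using 1
    ext
    · simp [E]; ring
    · simp [E]; ring
  have hYC : ∀ t ∈ Icc (0 : ℝ) 1, ContDiffAt ℝ 2 (fun s => inv (E s)) t := fun t ht =>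
    (contDiffAt_level hU hUY hmono hinv (hE t ht)).1.comp t hEC.contDiffAt
  have hgC : ∀ t ∈ Icc (0 : ℝ) 1, ContDiffAt ℝ 2 (fun s => V ((E s).1, inv (E s))) t :=
    fun t ht => (hV _ (hinv _ (hE t ht)).1).comp t
      ((hEC.fst.contDiffAt).prodMk (hYC t ht))
  have hg : ConcaveOn ℝ (Icc 0 1) fun s => V ((E s).1, inv (E s)) := by
    refine concaveOn_of_deriv2_nonpos' (convex_Icc 0 1)
      (fun t ht => ((hgC t ht).differentiableAt (by norm_num)).differentiableWithinAt)
      (fun t ht => ((ContDiffAt.derivWithin (m := 1) (hgC t ht) (by norm_num)).differentiableAt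
        (by norm_num)).differentiableWithinAt) fun t ht => ?_
    refine hform (fun s => (E s).1) (fun s => inv (E s)) (e'.1 - e.1) t (fun s => ?_) (hYC t ht)
      (hinv _ (hE t ht)).1 ?_
    · simpa [E] using ((hasDerivAt_id s).const_mul (e'.1 - e.1)).const_add e.1
    · have hev : (fun s => U ((E s).1, inv (E s))) =ᶠ[𝓝 t] fun s => e.2 + (e'.2 - e.2) * s := by
        have := hEC.continuous.continuousAt.eventually
          (contDiffAt_level hU hUY hmono hinv (hE t ht)).2
        filter_upwards [this] with s hs using (hinv _ hs).2
      rw [hev.deriv.deriv_eq]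
      have : deriv (fun s : ℝ => e.2 + (e'.2 - e.2) * s) = fun _ => e'.2 - e.2 := by
        ext s
        simp
      rw [this, deriv_const]
  have := hg.2 (left_mem_Icc.2 zero_le_one) (right_mem_Icc.2 zero_le_one) ha hb hab
  have hb' : a • (0 : ℝ) + b • (1 : ℝ) = b := by simp
  rw [hb'] at this
  have hE0 : E 0 = e := by simp [E]
  have hE1 : E 1 = e' := by simp [E]
  have hEb : E b = a • e + b • e' := by
    have : a = 1 - b := by linarith
    ext
    · simp [E, this]; ring
    · simp [E, this]; ring
  simpa only [hE0, hE1, hEb] using this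

theorem exists_jensen_of_mixed (hUc : Continuous U) (hU : ∀ x ∈ mixedRegion, ContDiffAt ℝ 2 U x)
    (hV : ∀ x ∈ mixedRegion, ContDiffAt ℝ 2 V x)
    (hUY : ∀ x ∈ mixedRegion, 0 < fderiv ℝ U x (0, 1))
    (hbot : ConvexOn ℝ (Ioo 0 1) fun q => U (q, 0))
    (htop : ConcaveOn ℝ (Ioo 0 1) fun q => U (q, q * (1 - q)))
    (hform : ∀ (Q Y : ℝ → ℝ) (R t : ℝ), (∀ s, HasDerivAt Q R s) → ContDiffAt ℝ 2 Y t →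
      (Q t, Y t) ∈ mixedRegion → deriv (deriv fun s => U (Q s, Y s)) t = 0 →
      deriv (deriv fun s => V (Q s, Y s)) t ≤ 0)
    {ι : Type*} [Fintype ι] {p : ι → ℝ} (hp : ∀ i, 0 ≤ p i) (hp1 : ∑ i, p i = 1)
    {x : ι → ℝ × ℝ} (hx : ∀ i, x i ∈ mixedRegion) :
    ∃ Y, (∑ i, p i * (x i).1, Y) ∈ stateRegion ∧
      U (∑ i, p i * (x i).1, Y) = ∑ i, p i * U (x i) ∧
      ∑ i, p i * V (x i) ≤ V (∑ i, p i * (x i).1, Y) := by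
  have hmono := fun q h0 h1 => strictMonoOn_slice hUc hU hUY (q := q) h0 h1
  choose! inv hinv using fun e (he : e ∈ levelRegion U) => exists_level hUc he
  have hc := concaveOn_level hUc hU hV hUY hbot htop hform hinv
  have hmem : ∀ i, ((x i).1, U (x i)) ∈ levelRegion U := fun i => level_mem hmono (hx i)
  have hJ := hc.le_map_sum (t := Finset.univ) (w := p) (p := fun i => ((x i).1, U (x i)))
    (fun i _ => hp i) hp1 (fun i _ => hmem i)
  have hM := hc.1.sum_mem (t := Finset.univ) (w := p) (z := fun i => ((x i).1, U (x i)))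
    (fun i _ => hp i) hp1 (fun i _ => hmem i)
  have hsum : ∑ i, p i • (((x i).1, U (x i)) : ℝ × ℝ)
      = (∑ i, p i * (x i).1, ∑ i, p i * U (x i)) := by
    ext <;> simp [Prod.fst_sum, Prod.snd_sum]
  rw [hsum] at hJ hM
  have hself : ∀ i, inv ((x i).1, U (x i)) = (x i).2 := fun i => by
    obtain ⟨h1, h2⟩ := hinv _ (hmem i)
    exact (hmono _ (hx i).1 (hx i).2.1).injOn ⟨h1.2.2.1.le, h1.2.2.2.le⟩
      ⟨(hx i).2.2.1.le, (hx i).2.2.2.le⟩ h2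
  obtain ⟨h1, h2⟩ := hinv _ hM
  refine ⟨_, ⟨h1.1.le, h1.2.1.le, h1.2.2.1.le, h1.2.2.2.le⟩, h2, ?_⟩
  simpa [hself] using hJ

/-- The interior case extends to pure and diagonal states by approximation; compactness supplies a
limit of the matching determinants. -/
theorem exists_jensen (hUc : Continuous U) (hVc : Continuous V)
    (hU : ∀ x ∈ mixedRegion, ContDiffAt ℝ 2 U x)
    (hV : ∀ x ∈ mixedRegion, ContDiffAt ℝ 2 V x)
    (hUY : ∀ x ∈ mixedRegion, 0 < fderiv ℝ U x (0, 1))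
    (hbot : ConvexOn ℝ (Ioo 0 1) fun q => U (q, 0))
    (htop : ConcaveOn ℝ (Ioo 0 1) fun q => U (q, q * (1 - q)))
    (hform : ∀ (Q Y : ℝ → ℝ) (R t : ℝ), (∀ s, HasDerivAt Q R s) → ContDiffAt ℝ 2 Y t →
      (Q t, Y t) ∈ mixedRegion → deriv (deriv fun s => U (Q s, Y s)) t = 0 →
      deriv (deriv fun s => V (Q s, Y s)) t ≤ 0)
    {ι : Type*} [Fintype ι] {p : ι → ℝ} (hp : ∀ i, 0 ≤ p i) (hp1 : ∑ i, p i = 1)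
    {x : ι → ℝ × ℝ} (hx : ∀ i, x i ∈ stateRegion) :
    ∃ Y, (∑ i, p i * (x i).1, Y) ∈ stateRegion ∧
      U (∑ i, p i * (x i).1, Y) = ∑ i, p i * U (x i) ∧
      ∑ i, p i * V (x i) ≤ V (∑ i, p i * (x i).1, Y) := by
  let ε : ℕ → ℝ := fun n => 1 / ((n : ℝ) + 1)
  have hε0 : ∀ n, 0 < ε n := fun n => Nat.one_div_pos_of_nat
  have hε1 : ∀ n, ε n ≤ 1 := fun n => by
    rw [div_le_one (by positivity)]
    have : (0 : ℝ) ≤ n := n.cast_nonneg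
    linarith
  have hεt : Tendsto ε atTop (𝓝 0) := tendsto_one_div_add_atTop_nhds_zero_nat
  -- (1/2, 1/8) is an interior point of the region, which is convex since q(1-q) is concave.
  let X : ℕ → ι → ℝ × ℝ := fun n i =>
    ((1 - ε n) * (x i).1 + ε n * (1 / 2), (1 - ε n) * (x i).2 + ε n * (1 / 8))
  have hX : ∀ n i, X n i ∈ mixedRegion := fun n i => by
    obtain ⟨h1, h2, h3, h4⟩ := hx i
    have e0 := hε0 n
    have e1 := sub_nonneg.2 (hε1 n)
    refine ⟨?_, ?_, ?_, ?_⟩ <;> simp only [X]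
    · positivity
    · nlinarith
    · positivity
    · have h5 : (1 - ε n) * (x i).2 ≤ (1 - ε n) * ((x i).1 * (1 - (x i).1)) :=
        mul_le_mul_of_nonneg_left h4 e1
      nlinarith [mul_nonneg (mul_nonneg e0.le e1) (sq_nonneg ((x i).1 - 1 / 2))]
  have hXt : ∀ i, Tendsto (fun n => X n i) atTop (𝓝 (x i)) := fun i => by
    have h1 : Tendsto (fun n => (1 - ε n) * (x i).1 + ε n * (1 / 2)) atTop
        (𝓝 ((1 - 0) * (x i).1 + 0 * (1 / 2))) :=
      ((tendsto_const_nhds.sub hεt).mul_const _).add (hεt.mul_const _)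
    have h2 : Tendsto (fun n => (1 - ε n) * (x i).2 + ε n * (1 / 8)) atTop
        (𝓝 ((1 - 0) * (x i).2 + 0 * (1 / 8))) :=
      ((tendsto_const_nhds.sub hεt).mul_const _).add (hεt.mul_const _)
    have h3 := h1.prodMk_nhds h2
    simp only [sub_zero, one_mul, zero_mul, add_zero] at h3
    exact h3
  choose Y hY hYU hYV using fun n =>
    exists_jensen_of_mixed hUc hU hV hUY hbot htop hform hp hp1 (hX n)
  have hYb : ∀ n, Y n ∈ Icc (0 : ℝ) (1 / 4) := fun n => by
    obtain ⟨-, -, h3, h4⟩ := hY n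
    simp only at h3 h4
    exact ⟨h3, by nlinarith [sq_nonneg (∑ i, p i * (X n i).1 - 1 / 2)]⟩
  obtain ⟨Y₀, -, s, hs, hYt⟩ := isCompact_Icc.tendsto_subseq hYb
  have hqt : Tendsto (fun n => ∑ i, p i * (X (s n) i).1) atTop (𝓝 (∑ i, p i * (x i).1)) :=
    tendsto_finsetSum _ fun i _ => (((continuous_fst.tendsto _).comp
      ((hXt i).comp hs.tendsto_atTop)).const_mul _)
  have hpt := hqt.prodMk_nhds hYt
  have hclosed : IsClosed stateRegion := by
    refine (isClosed_le continuous_const continuous_fst).inter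
      ((isClosed_le continuous_fst continuous_const).inter
        ((isClosed_le continuous_const continuous_snd).inter (isClosed_le continuous_snd ?_)))
    fun_prop
  have hsumt : ∀ W : ℝ × ℝ → ℝ, Continuous W → Tendsto (fun n => ∑ i, p i * W (X (s n) i)) atTop
      (𝓝 (∑ i, p i * W (x i))) := fun W hW => tendsto_finsetSum _ fun i _ =>
    (((hW.tendsto _).comp ((hXt i).comp hs.tendsto_atTop)).const_mul _)
  refine ⟨Y₀, hclosed.mem_of_tendsto hpt (Eventually.of_forall fun n => hY (s n)), ?_, ?_⟩
  · refine tendsto_nhds_unique ((hUc.tendsto _).comp hpt) ?_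
    exact (hsumt U hUc).congr fun n => (hYU (s n)).symm
  · exact le_of_tendsto_of_tendsto' (hsumt V hVc) ((hVc.tendsto _).comp hpt) fun n => hYV (s n)

end Jensen

end TripleTradeoff

/-! ### Output entropies and the dominating state. -/

noncomputable section

namespace TripleTradeoff

open Real Set Filter Topology

/-- The entropy of the output of the amplitude damping channel of transmissivity `z` on a qubit
state with excited-state population `x.1` and determinant `x.2`. -/
def outEntropy (z : ℝ) (x : ℝ × ℝ) : ℝ := detEntropy (z * (x.2 + (1 - z) * x.1 ^ 2))

theorem outEntropy_continuous (z : ℝ) : Continuous (outEntropy z) :=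
  detEntropy_continuous.comp (by fun_prop)

theorem outDet_mem_Icc {z : ℝ} (hz : z ∈ Icc (0 : ℝ) 1) {x : ℝ × ℝ} (hx : x ∈ stateRegion) :
    z * (x.2 + (1 - z) * x.1 ^ 2) ∈ Icc (0 : ℝ) (1 / 4) := by
  obtain ⟨h1, h2, h3, h4⟩ := hx
  have hz1 := sub_nonneg.2 hz.2
  have hz0 := hz.1
  refine ⟨by positivity, ?_⟩
  have : z * (x.2 + (1 - z) * x.1 ^ 2) ≤ z * (x.1 * (1 - x.1) + (1 - z) * x.1 ^ 2) := by gcongr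
  nlinarith [sq_nonneg (z * x.1 - 1 / 2)]

theorem outDet_mem_Ioo {z : ℝ} (hz : z ∈ Ioc (0 : ℝ) 1) {x : ℝ × ℝ} (hx : x ∈ mixedRegion) :
    z * (x.2 + (1 - z) * x.1 ^ 2) ∈ Ioo (0 : ℝ) (1 / 4) := by
  obtain ⟨h1, h2, h3, h4⟩ := hx
  have hz1 := sub_nonneg.2 hz.2
  have hz0 := hz.1
  refine ⟨by positivity, ?_⟩
  have : z * (x.2 + (1 - z) * x.1 ^ 2) < z * (x.1 * (1 - x.1) + (1 - z) * x.1 ^ 2) := by gcongr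
  nlinarith [sq_nonneg (z * x.1 - 1 / 2)]

theorem outEntropy_contDiffAt {z : ℝ} (hz : z ∈ Ioc (0 : ℝ) 1) {x : ℝ × ℝ}
    (hx : x ∈ mixedRegion) : ContDiffAt ℝ 2 (outEntropy z) x := by
  have h : ContDiff ℝ 2 fun x : ℝ × ℝ => z * (x.2 + (1 - z) * x.1 ^ 2) := by fun_prop
  exact (detEntropy_contDiffAt (outDet_mem_Ioo hz hx)).comp x h.contDiffAt

theorem fderiv_snd_eq {U : ℝ × ℝ → ℝ} {x : ℝ × ℝ} {d : ℝ} (hU : DifferentiableAt ℝ U x)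
    (h : HasDerivAt (fun Y => U (x.1, Y)) d x.2) : fderiv ℝ U x (0, 1) = d := by
  have h1 : HasDerivAt (fun Y : ℝ => ((x.1, Y) : ℝ × ℝ)) (0, 1) x.2 :=
    (hasDerivAt_const _ _).prodMk (hasDerivAt_id _)
  exact (hU.hasFDerivAt.comp_hasDerivAt x.2 h1).unique h

theorem hasDerivAt_outEntropy_snd {z : ℝ} (hz : z ∈ Ioc (0 : ℝ) 1) {x : ℝ × ℝ}
    (hx : x ∈ mixedRegion) : HasDerivAt (fun Y => outEntropy z (x.1, Y))
      (z * detSlope (z * (x.2 + (1 - z) * x.1 ^ 2))) x.2 := by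
  have h := ((hasDerivAt_id x.2).add_const ((1 - z) * x.1 ^ 2)).const_mul z
  refine ((hasDerivAt_detEntropy (outDet_mem_Ioo hz hx)).comp x.2 h).congr_deriv ?_
  ring

theorem outEntropy_strictMono {z : ℝ} (hz : z ∈ Ioc (0 : ℝ) 1) {q Y Y' : ℝ}
    (hY : (q, Y) ∈ stateRegion) (hY' : (q, Y') ∈ stateRegion) (h : Y < Y') :
    outEntropy z (q, Y) < outEntropy z (q, Y') :=
  detEntropy_strictMonoOn (outDet_mem_Icc ⟨hz.1.le, hz.2⟩ hY) (outDet_mem_Icc ⟨hz.1.le, hz.2⟩ hY')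
    (by have := hz.1; simp only; gcongr)

theorem deriv_deriv_detEntropy_comp {D : ℝ → ℝ} {t : ℝ} (hD : ContDiffAt ℝ 2 D t)
    (ht : D t ∈ Ioo (0 : ℝ) (1 / 4)) :
    deriv (deriv fun s => detEntropy (D s)) t = detSlope (D t) *
      (deriv (deriv D) t - deriv D t ^ 2 / (detDefect (D t) + 2 * D t)) := by
  have h1 : (deriv fun s => detEntropy (D s)) =ᶠ[𝓝 t] fun s => detSlope (D s) * deriv D s := by
    filter_upwards [hD.continuousAt.eventually_mem (isOpen_Ioo.mem_nhds ht),
      hD.eventually (by norm_num)] with s hs hs'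
    exact ((hasDerivAt_detEntropy hs).comp s (hs'.differentiableAt (by norm_num)).hasDerivAt).deriv
  rw [h1.deriv_eq]
  have h2 := (hasDerivAt_detSlope ht).comp t (hD.differentiableAt (by norm_num)).hasDerivAt
  have h3 := (ContDiffAt.derivWithin (m := 1) hD (by norm_num)).differentiableAt (by norm_num)
  refine (h2.mul h3.hasDerivAt).deriv.trans ?_
  simp only [Function.comp]
  ring

theorem contDiffAt_of_hasDerivAt_const {R t : ℝ} {Q : ℝ → ℝ} (hQ : ∀ s, HasDerivAt Q R s) :
    ContDiffAt ℝ 2 Q t := by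
  have h1 : ContDiff ℝ 1 (deriv Q) := by
    rw [show deriv Q = fun _ => R from funext fun s => (hQ s).deriv]
    exact contDiff_const
  have : ContDiff ℝ (1 + 1) Q := contDiff_succ_iff_deriv.2
    ⟨fun s => (hQ s).differentiableAt, by simp, h1⟩
  exact (this.of_le (by norm_num)).contDiffAt

theorem deriv_deriv_outEntropy {z R t : ℝ} {Q Y : ℝ → ℝ} (hz : z ∈ Ioc (0 : ℝ) 1)
    (hQ : ∀ s, HasDerivAt Q R s) (hY : ContDiffAt ℝ 2 Y t) (hx : (Q t, Y t) ∈ mixedRegion) :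
    deriv (deriv fun s => outEntropy z (Q s, Y s)) t =
      detSlope (z * Y t + z * (1 - z) * Q t ^ 2) *
      (z * deriv (deriv Y) t + 2 * (z * (1 - z)) * R ^ 2 -
        (z * deriv Y t + 2 * (z * (1 - z)) * Q t * R) ^ 2 /
        (detDefect (z * Y t + z * (1 - z) * Q t ^ 2) + 2 * (z * Y t + z * (1 - z) * Q t ^ 2))) := by
  set D : ℝ → ℝ := fun s => z * (Y s + (1 - z) * Q s ^ 2) with hDdef
  have hDt : D t = z * Y t + z * (1 - z) * Q t ^ 2 := by simp only [D]; ring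
  have hd1 : ∀ s, DifferentiableAt ℝ Y s →
      HasDerivAt D (z * deriv Y s + 2 * (z * (1 - z)) * (Q s * R)) s := fun s hs => by
    refine ((hs.hasDerivAt.add (((hQ s).pow 2).const_mul (1 - z))).const_mul z).congr_deriv ?_
    norm_num
    ring
  have hev : deriv D =ᶠ[𝓝 t] fun s => z * deriv Y s + 2 * (z * (1 - z)) * (Q s * R) := by
    filter_upwards [hY.eventually (by norm_num)] with s hs
    exact (hd1 s (hs.differentiableAt (by norm_num))).deriv
  have h3 := (ContDiffAt.derivWithin (m := 1) hY (by norm_num)).differentiableAt (by norm_num)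
  have hd2 : deriv (deriv D) t = z * deriv (deriv Y) t + 2 * (z * (1 - z)) * R ^ 2 := by
    rw [hev.deriv_eq]
    refine ((h3.hasDerivAt.const_mul z).add
      (((hQ t).mul_const R).const_mul (2 * (z * (1 - z))))).deriv.trans ?_
    ring
  have hDC : ContDiffAt ℝ 2 D t := by
    exact contDiffAt_const.mul (hY.add (contDiffAt_const.mul ((contDiffAt_of_hasDerivAt_const hQ).pow 2)))
  have := deriv_deriv_detEntropy_comp hDC (outDet_mem_Ioo hz hx)
  rw [hd2, hev.self_of_nhds, hDt] at this
  refine this.trans ?_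
  ring

theorem deriv_deriv_sub {f g : ℝ → ℝ} {t : ℝ} (hf : ContDiffAt ℝ 2 f t) (hg : ContDiffAt ℝ 2 g t) :
    deriv (deriv fun s => f s - g s) t = deriv (deriv f) t - deriv (deriv g) t := by
  have h1 : (deriv fun s => f s - g s) =ᶠ[𝓝 t] fun s => deriv f s - deriv g s := by
    filter_upwards [hf.eventually (by norm_num), hg.eventually (by norm_num)] with s h1 h2
    exact deriv_fun_sub (h1.differentiableAt (by norm_num)) (h2.differentiableAt (by norm_num))
  rw [h1.deriv_eq]
  exact deriv_fun_sub
    ((ContDiffAt.derivWithin (m := 1) hf (by norm_num)).differentiableAt (by norm_num))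
    ((ContDiffAt.derivWithin (m := 1) hg (by norm_num)).differentiableAt (by norm_num))

theorem contDiffAt_outEntropy_curve {z R t : ℝ} {Q Y : ℝ → ℝ} (hz : z ∈ Ioc (0 : ℝ) 1)
    (hQ : ∀ s, HasDerivAt Q R s) (hY : ContDiffAt ℝ 2 Y t) (hx : (Q t, Y t) ∈ mixedRegion) :
    ContDiffAt ℝ 2 (fun s => outEntropy z (Q s, Y s)) t := by
  exact ContDiffAt.comp (g := outEntropy z) (f := fun s => (Q s, Y s)) t
    (outEntropy_contDiffAt hz hx) ((contDiffAt_of_hasDerivAt_const hQ).prodMk hY)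

theorem detEntropy_mul_one_sub {u : ℝ} : detEntropy (u * (1 - u)) = binEntropy u := by
  have h : 1 - 4 * (u * (1 - u)) = (1 - 2 * u) ^ 2 := by ring
  rw [detEntropy, h, sqrt_sq_eq_abs]
  rcases abs_cases (1 - 2 * u) with ⟨h1, -⟩ | ⟨h1, -⟩
  · rw [h1, show (1 + (1 - 2 * u)) / 2 = 1 - u by ring, binEntropy_one_sub]
  · rw [h1, show (1 + -(1 - 2 * u)) / 2 = u by ring]

theorem outEntropy_top (z q : ℝ) : outEntropy z (q, q * (1 - q)) = binEntropy (z * q) := by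
  rw [← detEntropy_mul_one_sub, outEntropy]
  congr 1
  ring

theorem concaveOn_outEntropy_top {z : ℝ} (hz : z ∈ Ioc (0 : ℝ) 1) :
    ConcaveOn ℝ (Ioo 0 1) fun q => outEntropy z (q, q * (1 - q)) := by
  simp only [outEntropy_top]
  have h := strictConcave_binEntropy.concaveOn.comp_linearMap (LinearMap.mulLeft ℝ z)
  refine h.subset (fun q hq => ?_) (convex_Ioo _ _)
  have h0 := hz.1
  have h1 := hq.1
  exact ⟨by simp; positivity, by simp; nlinarith [hz.2, hq.2]⟩

theorem outDet_bot_mem {z : ℝ} (hz : z ∈ Ioo (0 : ℝ) 1) {q : ℝ} (hq : q ∈ Ioo (0 : ℝ) 1) :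
    z * (1 - z) * q ^ 2 ∈ Ioo (0 : ℝ) (1 / 4) := by
  have h0 := hz.1
  have h1 := sub_pos.2 hz.2
  have h2 := hq.1
  refine ⟨by positivity, ?_⟩
  have h3 : q ^ 2 < 1 := by nlinarith [hq.2]
  have h4 : z * (1 - z) * q ^ 2 < z * (1 - z) * 1 := by gcongr
  nlinarith [sq_nonneg (z - 1 / 2)]

/-- For pure inputs the output determinant is D = z(1-z)q², and the derivative in q is a constant
times `√D * detSlope D`, which is increasing. -/
theorem convexOn_outEntropy_bot {z : ℝ} (hz : z ∈ Ioo (0 : ℝ) 1) :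
    ConvexOn ℝ (Ioo 0 1) fun q => outEntropy z (q, 0) := by
  have hm : 0 < z * (1 - z) := mul_pos hz.1 (sub_pos.2 hz.2)
  have hd : ∀ q ∈ Ioo (0 : ℝ) 1, HasDerivAt (fun q => outEntropy z (q, 0))
      (2 * √(z * (1 - z)) * (√(z * (1 - z) * q ^ 2) * detSlope (z * (1 - z) * q ^ 2))) q := by
    intro q hq
    have h1 : HasDerivAt (fun q => z * (1 - z) * q ^ 2) (z * (1 - z) * (2 * q)) q := by
      simpa using (hasDerivAt_pow 2 q).const_mul (z * (1 - z))
    have h2 := (hasDerivAt_detEntropy (outDet_bot_mem hz hq)).comp q h1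
    have e : (fun q => outEntropy z (q, 0)) = detEntropy ∘ fun q => z * (1 - z) * q ^ 2 := by
      ext q
      simp only [outEntropy, Function.comp]
      congr 1
      ring
    rw [e]
    refine h2.congr_deriv ?_
    rw [sqrt_mul hm.le, sqrt_sq hq.1.le]
    have := mul_self_sqrt hm.le
    linear_combination (-2 * q * detSlope (z * (1 - z) * q ^ 2)) * this
  refine MonotoneOn.convexOn_of_deriv (convex_Ioo _ _)
    (fun x hx => (hd x hx).continuousAt.continuousWithinAt)
    (fun x hx => (hd x (interior_subset hx)).differentiableAt.differentiableWithinAt) ?_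
  rw [interior_Ioo]
  intro x hx y hy hxy
  rw [(hd x hx).deriv, (hd y hy).deriv]
  have h0 := hx.1
  have := sqrt_mul_detSlope_monotoneOn (outDet_bot_mem hz hx) (outDet_bot_mem hz hy)
    (by gcongr)
  simp only at this
  gcongr

theorem concaveOn_binEntropy_sub {z η : ℝ} (hη : 0 < η) (hz : η < z) (hz1 : z ≤ 1) :
    ConcaveOn ℝ (Ioo 0 1) fun q => binEntropy (z * q) - binEntropy (η * q) := by
  have hd : ∀ c : ℝ, 0 < c → c ≤ 1 → ∀ q ∈ Ioo (0 : ℝ) 1, HasDerivAt (fun q => binEntropy (c * q))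
      (c * (log (1 - c * q) - log (c * q))) q := fun c h0 h1 q hq => by
    have hq0 := hq.1
    have hcq : c * q < 1 := by nlinarith [hq.2]
    refine ((hasDerivAt_binEntropy (p := c * q) (by positivity) hcq.ne).comp q
      ((hasDerivAt_id q).const_mul c)).congr_deriv ?_
    ring
  have hd2 : ∀ c : ℝ, 0 < c → c ≤ 1 → ∀ q ∈ Ioo (0 : ℝ) 1,
      HasDerivAt (fun q => c * (log (1 - c * q) - log (c * q))) (-(c / (q * (1 - c * q)))) q :=
    fun c h0 h1 q hq => by
    have hq0 := hq.1
    have hcq : 0 < 1 - c * q := by nlinarith [hq.2]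
    have k1 := (((hasDerivAt_id q).const_mul c).const_sub 1).log hcq.ne'
    have k2 := ((hasDerivAt_id q).const_mul c).log (show c * q ≠ 0 by positivity)
    refine ((k1.sub k2).const_mul c).congr_deriv ?_
    simp only [id]
    field_simp
    ring
  have h0 := hη.trans hz
  refine concaveOn_of_hasDerivWithinAt2_nonpos (convex_Ioo _ _)
    (f' := fun q => z * (log (1 - z * q) - log (z * q)) - η * (log (1 - η * q) - log (η * q)))
    (f'' := fun q => -(z / (q * (1 - z * q))) - -(η / (q * (1 - η * q))))
    (fun q hq => ((hd z h0 hz1 q hq).sub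
      (hd η hη (by linarith) q hq)).continuousAt.continuousWithinAt) ?_ ?_ ?_
  · intro q hq
    have hq := interior_subset hq
    exact ((hd z h0 hz1 q hq).sub (hd η hη (by linarith) q hq)).hasDerivWithinAt
  · intro q hq
    have hq := interior_subset hq
    exact ((hd2 z h0 hz1 q hq).sub (hd2 η hη (by linarith) q hq)).hasDerivWithinAt
  · intro q hq
    have hq := interior_subset hq
    have hq0 := hq.1
    have hcq : 0 < 1 - z * q := by nlinarith [hq.2]
    have hcq' : 0 < 1 - η * q := by nlinarith [hq.2]
    have : η / (q * (1 - η * q)) ≤ z / (q * (1 - z * q)) := by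
      rw [div_le_div_iff₀ (by positivity) (by positivity)]
      nlinarith
    linarith

section Matching

variable {ι : Type*} [Fintype ι] {p : ι → ℝ} {x : ι → ℝ × ℝ}

theorem sq_div_eq {m q R : ℝ} (hm : 0 < m) (hq : 0 < q) :
    (2 * m * q * R) ^ 2 / (2 * (m * q ^ 2)) = 2 * m * R ^ 2 := by
  field_simp

/-- Matching the output entropy does not decrease the input entropy. -/
theorem exists_match_input {z : ℝ} (hz : z ∈ Ioo (0 : ℝ) 1) (hp : ∀ i, 0 ≤ p i)
    (hp1 : ∑ i, p i = 1) (hx : ∀ i, x i ∈ stateRegion) :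
    ∃ Y, (∑ i, p i * (x i).1, Y) ∈ stateRegion ∧
      outEntropy z (∑ i, p i * (x i).1, Y) = ∑ i, p i * outEntropy z (x i) ∧
      ∑ i, p i * outEntropy 1 (x i) ≤ outEntropy 1 (∑ i, p i * (x i).1, Y) := by
  have hz' : z ∈ Ioc (0 : ℝ) 1 := ⟨hz.1, hz.2.le⟩
  have h1' : (1 : ℝ) ∈ Ioc (0 : ℝ) 1 := ⟨one_pos, le_rfl⟩
  refine exists_jensen (outEntropy_continuous z) (outEntropy_continuous 1)
    (fun x hx => outEntropy_contDiffAt hz' hx) (fun x hx => outEntropy_contDiffAt h1' hx)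
    (fun x hx => ?_) (convexOn_outEntropy_bot hz) (concaveOn_outEntropy_top hz') ?_ hp hp1 hx
  · rw [fderiv_snd_eq ((outEntropy_contDiffAt hz' hx).differentiableAt (by norm_num))
      (hasDerivAt_outEntropy_snd hz' hx)]
    exact mul_pos hz.1 (detSlope_pos (outDet_mem_Ioo hz' hx))
  · intro Q Y R t hQ hY hm h
    rw [deriv_deriv_outEntropy hz' hQ hY hm] at h
    rw [deriv_deriv_outEntropy h1' hQ hY hm]
    have hX := outDet_mem_Ioo hz' hm
    have hV := outDet_mem_Ioo h1' hm
    have hk : 0 < z * (1 - z) := mul_pos hz.1 (sub_pos.2 hz.2)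
    have hq := hm.1
    simp only [sub_self, mul_zero, zero_mul, add_zero, one_mul] at hX hV hq ⊢
    rw [show z * (Y t + (1 - z) * Q t ^ 2) = z * Y t + z * (1 - z) * Q t ^ 2 by ring] at hX
    have key := detDefect_sq_le (P := deriv Y t) (K := 2 * (z * (1 - z)) * Q t * R) hz' hV hX
      (by positivity) rfl
    rw [sq_div_eq hk hq] at key
    have h2 := (mul_eq_zero.1 h).resolve_left (detSlope_pos hX).ne'
    refine mul_nonpos_of_nonneg_of_nonpos (detSlope_pos hV).le ?_
    refine le_of_mul_le_mul_left (a := z) ?_ hz.1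
    rw [mul_zero, mul_sub, ← mul_div_assoc]
    -- The vanishing second derivative of the matched entropy replaces the left side of `key` by
    -- D''; the common term 2z(1-z)R² cancels.
    linarith

/-- Matching the entropy of the noisier output does not decrease that of the other output. -/
theorem exists_match_output {η : ℝ} (h2 : 1 / 2 < η) (h1 : η < 1) (hp : ∀ i, 0 ≤ p i)
    (hp1 : ∑ i, p i = 1) (hx : ∀ i, x i ∈ stateRegion) :
    ∃ Y, (∑ i, p i * (x i).1, Y) ∈ stateRegion ∧
      outEntropy (1 - η) (∑ i, p i * (x i).1, Y) = ∑ i, p i * outEntropy (1 - η) (x i) ∧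
      ∑ i, p i * outEntropy η (x i) ≤ outEntropy η (∑ i, p i * (x i).1, Y) := by
  have h0 : 0 < η := by linarith
  have hz : 1 - η ∈ Ioo (0 : ℝ) 1 := ⟨by linarith, by linarith⟩
  have hz' : 1 - η ∈ Ioc (0 : ℝ) 1 := ⟨hz.1, hz.2.le⟩
  have hη' : η ∈ Ioc (0 : ℝ) 1 := ⟨h0, h1.le⟩
  refine exists_jensen (outEntropy_continuous _) (outEntropy_continuous _)
    (fun x hx => outEntropy_contDiffAt hz' hx) (fun x hx => outEntropy_contDiffAt hη' hx)
    (fun x hx => ?_) (convexOn_outEntropy_bot hz) (concaveOn_outEntropy_top hz') ?_ hp hp1 hx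
  · rw [fderiv_snd_eq ((outEntropy_contDiffAt hz' hx).differentiableAt (by norm_num))
      (hasDerivAt_outEntropy_snd hz' hx)]
    exact mul_pos hz.1 (detSlope_pos (outDet_mem_Ioo hz' hx))
  · intro Q Y R t hQ hY hm h
    rw [deriv_deriv_outEntropy hz' hQ hY hm] at h
    rw [deriv_deriv_outEntropy hη' hQ hY hm]
    have hX := outDet_mem_Ioo hz' hm
    have hV := outDet_mem_Ioo hη' hm
    have hk : 0 < η * (1 - η) := mul_pos h0 hz.1
    have hq := hm.1
    simp only at hX hV hq
    rw [show (1 - η) * (Y t + (1 - (1 - η)) * Q t ^ 2)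
      = (1 - η) * Y t + (1 - η) * (1 - (1 - η)) * Q t ^ 2 by ring] at hX
    rw [show η * (Y t + (1 - η) * Q t ^ 2) = η * Y t + η * (1 - η) * Q t ^ 2 by ring] at hV
    have h3 := (mul_eq_zero.1 h).resolve_left (detSlope_pos hX).ne'
    refine mul_nonpos_of_nonneg_of_nonpos (detSlope_pos hV).le ?_
    -- Transmissivity 1-η is transmissivity η followed by c, so the two-point comparison applies to
    -- the two outputs instead of input and output.
    set c := (1 - η) / η with hc
    have hcη : c * η = 1 - η := div_mul_cancel₀ _ h0.ne'
    have hc0 : 0 < c := div_pos hz.1 h0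
    have hc1 : c < 1 := (div_lt_one h0).2 (by linarith)
    have hc1' := sub_pos.2 hc1
    have key := detDefect_sq_le (c := c) (P := η * deriv Y t + 2 * (η * (1 - η)) * Q t * R)
      (K := 2 * ((1 - c) * (η * (1 - η))) * Q t * R) (e := (1 - c) * (η * (1 - η)) * Q t ^ 2)
      ⟨hc0, hc1.le⟩ hV hX (by positivity)
      (by linear_combination (-(Y t)) * hcη)
    rw [sq_div_eq (by positivity) hq] at key
    have e1 : c * (η * deriv Y t + 2 * (η * (1 - η)) * Q t * R) +
        2 * ((1 - c) * (η * (1 - η))) * Q t * R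
        = (1 - η) * deriv Y t + 2 * ((1 - η) * (1 - (1 - η))) * Q t * R := by
      linear_combination (deriv Y t) * hcη
    rw [e1] at key
    refine le_of_mul_le_mul_left (a := c) ?_ hc0
    rw [mul_zero, mul_sub, ← mul_div_assoc]
    have e2 : c * (η * deriv (deriv Y) t + 2 * (η * (1 - η)) * R ^ 2)
        = (1 - η) * deriv (deriv Y) t + 2 * ((1 - η) * (1 - (1 - η))) * R ^ 2
          - 2 * ((1 - c) * (η * (1 - η))) * R ^ 2 := by
      linear_combination (deriv (deriv Y) t) * hcη
    rw [e2]
    linarith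

/-- For a noisy channel, matching the coherent information does not decrease the conditional
entropy of the output given the environment. -/
theorem exists_match_coherent {η : ℝ} (h0 : 0 < η) (h2 : η < 1 / 2) (hp : ∀ i, 0 ≤ p i)
    (hp1 : ∑ i, p i = 1) (hx : ∀ i, x i ∈ stateRegion) :
    ∃ Y, (∑ i, p i * (x i).1, Y) ∈ stateRegion ∧
      outEntropy (1 - η) (∑ i, p i * (x i).1, Y) - outEntropy η (∑ i, p i * (x i).1, Y) =
        ∑ i, p i * (outEntropy (1 - η) (x i) - outEntropy η (x i)) ∧
      ∑ i, p i * (outEntropy 1 (x i) - outEntropy (1 - η) (x i)) ≤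
        outEntropy 1 (∑ i, p i * (x i).1, Y) - outEntropy (1 - η) (∑ i, p i * (x i).1, Y) := by
  have hz : 1 - η ∈ Ioo (0 : ℝ) 1 := ⟨by linarith, by linarith⟩
  have hz' : 1 - η ∈ Ioc (0 : ℝ) 1 := ⟨hz.1, hz.2.le⟩
  have hη' : η ∈ Ioc (0 : ℝ) 1 := ⟨h0, by linarith⟩
  have h1' : (1 : ℝ) ∈ Ioc (0 : ℝ) 1 := ⟨one_pos, le_rfl⟩
  have hk : 0 < η * (1 - η) := mul_pos h0 hz.1
  have eX : ∀ y q : ℝ, (1 - η) * (y + (1 - (1 - η)) * q ^ 2)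
      = (1 - η) * y + η * (1 - η) * q ^ 2 := fun y q => by ring
  have eZ : ∀ y q : ℝ, η * (y + (1 - η) * q ^ 2) = η * y + η * (1 - η) * q ^ 2 :=
    fun y q => by ring
  refine exists_jensen (U := fun x => outEntropy (1 - η) x - outEntropy η x)
    (V := fun x => outEntropy 1 x - outEntropy (1 - η) x)
    ((outEntropy_continuous _).sub (outEntropy_continuous _))
    ((outEntropy_continuous _).sub (outEntropy_continuous _))
    (fun x hx => (outEntropy_contDiffAt hz' hx).sub (outEntropy_contDiffAt hη' hx))
    (fun x hx => (outEntropy_contDiffAt h1' hx).sub (outEntropy_contDiffAt hz' hx))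
    (fun x hx => ?_) ?_ ?_ ?_ hp hp1 hx
  · have hq := hx.1
    rw [fderiv_snd_eq (((outEntropy_contDiffAt hz' hx).sub
      (outEntropy_contDiffAt hη' hx)).differentiableAt (by norm_num))
      ((hasDerivAt_outEntropy_snd hz' hx).sub (hasDerivAt_outEntropy_snd hη' hx)), sub_pos]
    have hX := outDet_mem_Ioo hz' hx
    have hZ := outDet_mem_Ioo hη' hx
    rw [eX] at hX ⊢
    rw [eZ] at hZ ⊢
    exact mul_detSlope_lt_mul h0 (by linarith) (by positivity) hX hZ
  -- On pure inputs output and environment have equal entropies, so the lower boundary is flat.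
  · have : (fun q : ℝ => outEntropy (1 - η) (q, 0) - outEntropy η (q, 0)) = fun _ => 0 := by
      ext q
      simp only [outEntropy]
      rw [eX, eZ]
      simp
    simp only [this]
    exact convexOn_const 0 (convex_Ioo _ _)
  · simp only [outEntropy_top]
    exact concaveOn_binEntropy_sub h0 (by linarith) hz.2.le
  · intro Q Y R t hQ hY hm h
    rw [deriv_deriv_sub (contDiffAt_outEntropy_curve hz' hQ hY hm)
      (contDiffAt_outEntropy_curve hη' hQ hY hm), deriv_deriv_outEntropy hz' hQ hY hm,
      deriv_deriv_outEntropy hη' hQ hY hm] at h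
    rw [deriv_deriv_sub (contDiffAt_outEntropy_curve h1' hQ hY hm)
      (contDiffAt_outEntropy_curve hz' hQ hY hm), deriv_deriv_outEntropy hz' hQ hY hm,
      deriv_deriv_outEntropy h1' hQ hY hm]
    have hX := outDet_mem_Ioo hz' hm
    have hZ := outDet_mem_Ioo hη' hm
    have hV := outDet_mem_Ioo h1' hm
    have hq := hm.1
    simp only at hX hZ hV hq
    rw [eX] at hX
    rw [eZ] at hZ
    simp only [sub_self, mul_zero, zero_mul, add_zero, one_mul] at hV ⊢
    rw [show (1 - η) * (1 - (1 - η)) = η * (1 - η) by ring] at h ⊢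
    have key := three_point_second_order (k := η * (1 - η) * Q t ^ 2) h0 (by linarith : η < 1 - η)
      (by ring) (by positivity) hV hX hZ (deriv Y t) (2 * (η * (1 - η)) * Q t * R)
      (deriv (deriv Y) t) (by rw [sq_div_eq hk hq]; linarith)
    rw [sq_div_eq hk hq] at key
    exact key

/-- Every finite mixture of qubit states is dominated by a single state of the same mean
excited-state population. -/
theorem exists_dominating {η : ℝ} (hη : η ∈ Icc (0 : ℝ) 1) (hp : ∀ i, 0 ≤ p i)
    (hp1 : ∑ i, p i = 1) (hx : ∀ i, x i ∈ stateRegion) :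
    ∃ Y, (∑ i, p i * (x i).1, Y) ∈ stateRegion ∧
      ∑ i, p i * (outEntropy 1 (x i) - outEntropy (1 - η) (x i)) ≤
        outEntropy 1 (∑ i, p i * (x i).1, Y) - outEntropy (1 - η) (∑ i, p i * (x i).1, Y) ∧
      ∑ i, p i * (outEntropy η (x i) - outEntropy (1 - η) (x i)) ≤
        outEntropy η (∑ i, p i * (x i).1, Y) - outEntropy (1 - η) (∑ i, p i * (x i).1, Y) ∧
      outEntropy (1 - η) (∑ i, p i * (x i).1, Y) ≤ ∑ i, p i * outEntropy (1 - η) (x i) := by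
  have hq0 : 0 ≤ ∑ i, p i * (x i).1 :=
    Finset.sum_nonneg fun i _ => mul_nonneg (hp i) (hx i).1
  have hq1 : ∑ i, p i * (x i).1 ≤ 1 := by
    rw [← hp1]
    exact Finset.sum_le_sum fun i _ => mul_le_of_le_one_right (hp i) (hx i).2.1
  have hzero : detEntropy 0 = 0 := by simp [detEntropy]
  have hE0 : ∀ x, outEntropy 0 x = 0 := fun x => by simp [outEntropy, hzero]
  have hE1 : ∀ x, outEntropy 1 x = detEntropy x.2 := fun x => by simp [outEntropy]
  have hnn : ∀ x ∈ stateRegion, 0 ≤ outEntropy 1 x := fun x hx => by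
    rw [hE1, ← hzero]
    have := outDet_mem_Icc ⟨zero_le_one, le_rfl⟩ hx
    simp only [sub_self, zero_mul, add_zero, one_mul] at this
    exact detEntropy_strictMonoOn.monotoneOn ⟨le_rfl, by norm_num⟩ this this.1
  simp only [mul_sub, Finset.sum_sub_distrib]
  rcases hη.1.eq_or_lt with h0 | h0
  · subst h0
    -- At η = 0 a pure state dominates, since E_0 vanishes and only -E_1 is left to maximise.
    refine ⟨0, ⟨hq0, hq1, le_rfl, mul_nonneg hq0 (sub_nonneg.2 hq1)⟩, ?_, ?_, ?_⟩
    · simp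
    · simp only [sub_zero, hE0, mul_zero, Finset.sum_const_zero, zero_sub, neg_le_neg_iff]
      rw [hE1, hzero]
      exact Finset.sum_nonneg fun i _ => mul_nonneg (hp i) (hnn _ (hx i))
    · rw [sub_zero, hE1, hzero]
      exact Finset.sum_nonneg fun i _ => mul_nonneg (hp i) (hnn _ (hx i))
  rcases hη.2.eq_or_lt with h1 | h1
  · subst h1
    have hb : ∑ i, p i * outEntropy 1 (x i) ≤ binEntropy (∑ i, p i * (x i).1) := by
      have h1 : ∀ i, outEntropy 1 (x i) ≤ binEntropy (x i).1 := fun i => by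
        rw [hE1, ← detEntropy_mul_one_sub]
        have hq : ((x i).1, (x i).1 * (1 - (x i).1)) ∈ stateRegion :=
          ⟨(hx i).1, (hx i).2.1, mul_nonneg (hx i).1 (sub_nonneg.2 (hx i).2.1), le_rfl⟩
        have k1 := outDet_mem_Icc ⟨zero_le_one, le_rfl⟩ (hx i)
        have k2 := outDet_mem_Icc ⟨zero_le_one, le_rfl⟩ hq
        simp only [sub_self, zero_mul, add_zero, one_mul] at k1 k2
        exact detEntropy_strictMonoOn.monotoneOn k1 k2 (hx i).2.2.2
      calc ∑ i, p i * outEntropy 1 (x i) ≤ ∑ i, p i * binEntropy (x i).1 :=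
            Finset.sum_le_sum fun i _ => mul_le_mul_of_nonneg_left (h1 i) (hp i)
        _ ≤ _ := strictConcave_binEntropy.concaveOn.le_map_sum (fun i _ => hp i) hp1
            (fun i _ => ⟨(hx i).1, (hx i).2.1⟩)
    refine ⟨_, ⟨hq0, hq1, mul_nonneg hq0 (sub_nonneg.2 hq1), le_rfl⟩, ?_, ?_, ?_⟩
    · simpa [hE0, outEntropy_top] using hb
    · simpa [hE0, outEntropy_top] using hb
    · simp [hE0]
  have hz : 1 - η ∈ Ioo (0 : ℝ) 1 := ⟨by linarith, by linarith⟩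
  have hz' : 1 - η ∈ Ioc (0 : ℝ) 1 := ⟨hz.1, hz.2.le⟩
  have hη' : η ∈ Ioc (0 : ℝ) 1 := ⟨h0, h1.le⟩
  obtain ⟨Y, hY, hY3, hY1⟩ := exists_match_input hz hp hp1 hx
  rcases lt_trichotomy η (1 / 2) with h | h | h
  -- `Y` matches E_{1-η}, `Y₂` matches E_η and `Y₀` matches E_{1-η} - E_η; the last will dominate.
  -- From Y ≤ Y₂, E_η at `Y` is at most its average, so E_{1-η} - E_η at `Y` is at least its
  -- average. Monotonicity in the determinant gives Y₀ ≤ Y, which bounds E_{1-η} at `Y₀`.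
  · obtain ⟨Y₂, hY₂, hm₂, hle₂⟩ := exists_match_output (η := 1 - η) (by linarith) (by linarith)
      hp hp1 hx
    rw [sub_sub_cancel] at hm₂
    obtain ⟨Y₀, hY₀, hm₀, hle₀⟩ := exists_match_coherent h0 h hp hp1 hx
    simp only [mul_sub, Finset.sum_sub_distrib] at hm₀ hle₀
    set q := ∑ i, p i * (x i).1
    have hYY₂ : Y ≤ Y₂ := by
      by_contra! hlt
      have := outEntropy_strictMono hz' hY₂ hY hlt
      linarith
    have hE2 : outEntropy η (q, Y) ≤ outEntropy η (q, Y₂) := by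
      rcases hYY₂.eq_or_lt with h | h
      · rw [h]
      · exact (outEntropy_strictMono hη' hY hY₂ h).le
    have hYY₀ : Y₀ ≤ Y := by
      by_contra! hlt
      -- For q = 0 or q = 1 the only admissible determinant is 0, which contradicts Y < Y₀.
      have hq0' : 0 < q := by
        refine hq0.lt_of_ne fun h => ?_
        have h3 := hY.2.2.1
        have h4 := hY₀.2.2.2
        simp only [← h] at h3 h4
        linarith
      have hq1' : q < 1 := by
        refine hq1.lt_of_ne fun h => ?_
        have h3 := hY.2.2.1
        have h4 := hY₀.2.2.2
        simp only [h] at h3 h4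
        linarith
      have hmono : StrictMonoOn (fun Y => outEntropy (1 - η) (q, Y) - outEntropy η (q, Y))
          (Icc 0 (q * (1 - q))) := by
        refine strictMonoOn_slice (U := fun x => outEntropy (1 - η) x - outEntropy η x)
          ((outEntropy_continuous _).sub (outEntropy_continuous _))
          (fun x hx => (outEntropy_contDiffAt hz' hx).sub (outEntropy_contDiffAt hη' hx))
          (fun x hx => ?_) hq0' hq1'
        have hq := hx.1
        have hk : 0 < η * (1 - η) := mul_pos h0 hz.1
        rw [fderiv_snd_eq (((outEntropy_contDiffAt hz' hx).sub
          (outEntropy_contDiffAt hη' hx)).differentiableAt (by norm_num))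
          ((hasDerivAt_outEntropy_snd hz' hx).sub (hasDerivAt_outEntropy_snd hη' hx)), sub_pos]
        have hX := outDet_mem_Ioo hz' hx
        have hZ := outDet_mem_Ioo hη' hx
        rw [show (1 - η) * (x.2 + (1 - (1 - η)) * x.1 ^ 2)
          = (1 - η) * x.2 + η * (1 - η) * x.1 ^ 2 by ring] at hX ⊢
        rw [show η * (x.2 + (1 - η) * x.1 ^ 2) = η * x.2 + η * (1 - η) * x.1 ^ 2 by ring] at hZ ⊢
        exact mul_detSlope_lt_mul h0 (by linarith) (by positivity) hX hZ
      have := hmono ⟨hY.2.2.1, hY.2.2.2⟩ ⟨hY₀.2.2.1, hY₀.2.2.2⟩ hlt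
      simp only at this
      linarith
    refine ⟨Y₀, hY₀, hle₀, by linarith, ?_⟩
    rw [← hY3]
    rcases hYY₀.eq_or_lt with h | h
    · rw [h]
    · exact (outEntropy_strictMono hz' hY₀ hY h).le
  · refine ⟨Y, hY, by linarith, ?_, hY3.le⟩
    rw [show 1 - η = η by linarith]
    simp
  · obtain ⟨Y₂, hY₂, hm₂, hle₂⟩ := exists_match_output h h1 hp hp1 hx
    have hYe : Y₂ = Y := by
      rcases lt_trichotomy Y₂ Y with h | h | h
      · have := outEntropy_strictMono hz' hY₂ hY h
        linarith
      · exact h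
      · have := outEntropy_strictMono hz' hY hY₂ h
        linarith
    subst hYe
    exact ⟨Y₂, hY₂, by linarith, by linarith, hY3.le⟩

end Matching

end TripleTradeoff

/-! ### Entropy through the characteristic polynomial. -/

noncomputable section

namespace TripleTradeoff

open Real Polynomial

section Spectral

variable {ι m n : Type*} [Fintype ι] [DecidableEq ι] [Fintype m] [DecidableEq m] [Fintype n]
  [DecidableEq n]

/-- The sum of `-t log t` over the real parts of the roots of a polynomial. -/
def rootEntropy (P : ℂ[X]) : ℝ := (P.roots.map fun t => negMulLog t.re).sum

theorem rootEntropy_mul {P Q : ℂ[X]} (hP : P ≠ 0) (hQ : Q ≠ 0) :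
    rootEntropy (P * Q) = rootEntropy P + rootEntropy Q := by
  simp [rootEntropy, roots_mul (mul_ne_zero hP hQ)]

theorem rootEntropy_prod {κ : Type*} (s : Finset κ) {P : κ → ℂ[X]} (hP : ∀ i, P i ≠ 0) :
    rootEntropy (∏ i ∈ s, P i) = ∑ i ∈ s, rootEntropy (P i) := by
  classical
  induction s using Finset.induction_on with
  | empty => simp [rootEntropy]
  | insert i s hi ih =>
    rw [Finset.prod_insert hi, Finset.sum_insert hi,
      rootEntropy_mul (hP i) (Finset.prod_ne_zero_iff.2 fun j _ => hP j), ih]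

theorem rootEntropy_X_pow (k : ℕ) : rootEntropy (X ^ k) = 0 := by
  simp [rootEntropy, Multiset.map_nsmul, Multiset.sum_nsmul]

theorem rootEntropy_X_sub_C (t : ℂ) : rootEntropy (X - C t) = negMulLog t.re := by
  simp [rootEntropy]

theorem vnEntropy_eq_rootEntropy {ρ : Matrix n n ℂ} (hρ : ρ.IsHermitian) :
    vnEntropy ρ = rootEntropy ρ.charpoly / log 2 := by
  rw [vnEntropy, dif_pos hρ, rootEntropy, hρ.roots_charpoly_eq_eigenvalues, Multiset.map_map,
    Finset.sum_map_val, Finset.sum_div]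
  refine Finset.sum_congr rfl fun i _ => ?_
  simp only [Function.comp, RCLike.ofReal_eq_complex_ofReal, Complex.ofReal_re, negMulLog, logb]
  ring

/-- The two marginals of a pure state have equal entropy: the characteristic polynomials agree up to
powers of `X`, and zero eigenvalues contribute nothing. -/
theorem vnEntropy_mul_conjTranspose (M : Matrix m n ℂ) :
    vnEntropy (M * Mᴴ) = vnEntropy (Mᴴ * M) := by
  rw [vnEntropy_eq_rootEntropy (Matrix.isHermitian_mul_conjTranspose_self M),
    vnEntropy_eq_rootEntropy (Matrix.isHermitian_conjTranspose_mul_self M)]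
  have h := congrArg rootEntropy (Matrix.charpoly_mul_comm' M Mᴴ)
  rw [rootEntropy_mul (pow_ne_zero _ X_ne_zero) (Matrix.charpoly_monic _).ne_zero,
    rootEntropy_mul (pow_ne_zero _ X_ne_zero) (Matrix.charpoly_monic _).ne_zero,
    rootEntropy_X_pow, rootEntropy_X_pow, zero_add, zero_add] at h
  rw [h]

theorem vnEntropy_smul_mul_conjTranspose {p : ℝ} (hp : 0 ≤ p) (M : Matrix m n ℂ) :
    vnEntropy ((p : ℂ) • (M * Mᴴ)) = vnEntropy ((p : ℂ) • (Mᴴ * M)) := by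
  have hs : ((√p : ℝ) : ℂ) * ((√p : ℝ) : ℂ) = p := by
    rw [← Complex.ofReal_mul, mul_self_sqrt hp]
  have := vnEntropy_mul_conjTranspose (((√p : ℝ) : ℂ) • M)
  rw [Matrix.conjTranspose_smul, Matrix.smul_mul, Matrix.mul_smul, smul_smul, Matrix.smul_mul,
    Matrix.mul_smul, smul_smul, Complex.star_def, Complex.conj_ofReal, hs] at this
  exact this

/-- The block diagonal matrix with blocks `N x`, where the block index comes first. -/
def blockMat {ι k : Type*} [DecidableEq ι] (N : ι → Matrix k k ℂ) : Matrix (ι × k) (ι × k) ℂ :=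
  Matrix.reindex (Equiv.prodComm k ι) (Equiv.prodComm k ι) (Matrix.blockDiagonal N)

theorem blockMat_apply {ι k : Type*} [DecidableEq ι] (N : ι → Matrix k k ℂ) (i j : ι × k) :
    blockMat N i j = if i.1 = j.1 then N i.1 i.2 j.2 else 0 := by
  simp [blockMat, Matrix.blockDiagonal_apply]

theorem charpoly_blockMat (N : ι → Matrix n n ℂ) :
    (blockMat N).charpoly = ∏ x, (N x).charpoly := by
  have h : (Matrix.blockDiagonal N).charmatrix =
      Matrix.blockDiagonal fun x => (N x).charmatrix := by
    ext ⟨i, x⟩ ⟨j, y⟩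
    by_cases hxy : x = y
    · subst hxy
      by_cases hij : i = j
      · subst hij
        simp [Matrix.charmatrix_apply_eq, Matrix.blockDiagonal_apply]
      · simp [Matrix.blockDiagonal_apply, hij]
    · simp [Matrix.blockDiagonal_apply, hxy]
  rw [blockMat, Matrix.charpoly_reindex, Matrix.charpoly, h, Matrix.det_blockDiagonal]
  rfl

theorem vnEntropy_blockMat {N : ι → Matrix n n ℂ} (hN : ∀ x, (N x).IsHermitian) :
    vnEntropy (blockMat N) = ∑ x, vnEntropy (N x) := by
  have h : (blockMat N).IsHermitian := by
    rw [Matrix.IsHermitian.ext_iff]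
    intro i j
    rw [blockMat_apply, blockMat_apply]
    by_cases hij : i.1 = j.1
    · rw [if_pos hij, if_pos hij.symm, ← hij]
      exact (hN i.1).apply i.2 j.2
    · rw [if_neg hij, if_neg (Ne.symm hij), star_zero]
  rw [vnEntropy_eq_rootEntropy h, charpoly_blockMat,
    rootEntropy_prod _ fun x => (Matrix.charpoly_monic _).ne_zero, Finset.sum_div]
  exact Finset.sum_congr rfl fun x _ => (vnEntropy_eq_rootEntropy (hN x)).symm

theorem vnEntropy_diagonal (p : n → ℝ) :
    vnEntropy (Matrix.diagonal fun i => (p i : ℂ)) = (∑ i, negMulLog (p i)) / log 2 := by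
  rw [vnEntropy_eq_rootEntropy, Matrix.charpoly_diagonal,
    rootEntropy_prod _ fun x => X_sub_C_ne_zero _]
  · simp [rootEntropy_X_sub_C]
  · exact Matrix.isHermitian_diagonal_of_self_adjoint _ (by ext i; simp)

/-- The Hermitian qubit matrix of trace one with entries `a`, `1 - a` on the diagonal. -/
def qubit (a : ℝ) (c : ℂ) : Matrix (Fin 2) (Fin 2) ℂ :=
  !![(a : ℂ), c; star c, ((1 - a : ℝ) : ℂ)]

theorem qubit_isHermitian (a : ℝ) (c : ℂ) : (qubit a c).IsHermitian := by
  ext i j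
  fin_cases i <;> fin_cases j <;> simp [qubit]

theorem isHermitian_ofReal_smul {k : Type*} {ρ : Matrix k k ℂ} (hρ : ρ.IsHermitian) (p : ℝ) :
    ((p : ℂ) • ρ).IsHermitian := by
  rw [Matrix.IsHermitian, Matrix.conjTranspose_smul, hρ.eq]
  simp

theorem vnEntropy_smul_qubit (p a : ℝ) (c : ℂ) :
    vnEntropy ((p : ℂ) • qubit a c) =
      (negMulLog p + p * detEntropy (a * (1 - a) - Complex.normSq c)) / log 2 := by
  set D := a * (1 - a) - Complex.normSq c with hD
  have hD4 : 0 ≤ 1 - 4 * D := by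
    have := Complex.normSq_nonneg c
    nlinarith [sq_nonneg (1 - 2 * a)]
  -- `u` and `1 - u` are the eigenvalues of the unscaled matrix.
  set u := (1 + √(1 - 4 * D)) / 2 with hu
  have huD : u * (1 - u) = D := by
    have := mul_self_sqrt hD4
    rw [hu]
    linear_combination (-1 / 4) * this
  have hc : ((p : ℂ) • qubit a c).charpoly =
      (X - C ((p * u : ℝ) : ℂ)) * (X - C ((p * (1 - u) : ℝ) : ℂ)) := by
    have htr : ((p : ℂ) • qubit a c).trace = ((p * u : ℝ) : ℂ) + ((p * (1 - u) : ℝ) : ℂ) := by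
      simp [qubit, Matrix.trace_fin_two]
      ring
    have hdet : ((p : ℂ) • qubit a c).det = ((p * u : ℝ) : ℂ) * ((p * (1 - u) : ℝ) : ℂ) := by
      have h1 : c * star c = (Complex.normSq c : ℂ) := Complex.mul_conj c
      have h2 : ((p * u : ℝ) : ℂ) * ((p * (1 - u) : ℝ) : ℂ) = p * p * (D : ℂ) := by
        rw [← huD]
        push_cast
        ring
      rw [h2, hD, Matrix.det_fin_two]
      simp only [qubit, Matrix.smul_apply, smul_eq_mul, Matrix.of_apply, Matrix.cons_val',
        Matrix.cons_val_zero, Matrix.cons_val_one, Matrix.cons_val_fin_one]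
      push_cast
      linear_combination (-(p : ℂ) * p) * h1
    rw [Matrix.charpoly_fin_two, htr, hdet]
    simp only [map_add, map_mul]
    ring
  rw [vnEntropy_eq_rootEntropy (isHermitian_ofReal_smul (qubit_isHermitian a c) p), hc,
    rootEntropy_mul (X_sub_C_ne_zero _) (X_sub_C_ne_zero _), rootEntropy_X_sub_C,
    rootEntropy_X_sub_C, Complex.ofReal_re, Complex.ofReal_re, negMulLog_mul, negMulLog_mul,
    detEntropy, ← hu, binEntropy_eq_negMulLog_add_negMulLog_one_sub]
  ring

end Spectral

end TripleTradeoff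
end

/-! ### The classical-quantum state and its marginals. -/

noncomputable section

namespace TripleTradeoff

open Real

section States

theorem cqState_apply {κ X A A' B : Type*} [Fintype κ] [Fintype X] [DecidableEq X] [Fintype A]
    [DecidableEq A] [Fintype A'] (K : κ → Matrix B A' ℂ) (p : X → ℝ) (φ : X → A × A' → ℂ)
    (i j : X × A × B) :
    cqState K p φ i j = if i.1 = j.1 then (p i.1 : ℂ) * ∑ k,
      (∑ l, K k i.2.2 l * φ i.1 (i.2.1, l)) * star (∑ l, K k j.2.2 l * φ i.1 (j.2.1, l))
      else 0 := by
  obtain ⟨x, a, b⟩ := i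
  obtain ⟨y, a', b'⟩ := j
  have hK : ∀ x, applyKraus K (Matrix.vecMulVec (φ x) (star (φ x))) (a, b) (a', b') =
      ∑ k, (∑ l, K k b l * φ x (a, l)) * star (∑ l, K k b' l * φ x (a', l)) := by
    intro x
    have h : ∀ k a b, (((1 : Matrix A A ℂ) ⊗ₖ K k) *ᵥ φ x) (a, b) = ∑ l, K k b l * φ x (a, l) := by
      intro k a b
      simp [Matrix.mulVec, dotProduct, Fintype.sum_prod_type, Matrix.one_apply]
    rw [applyKraus, Matrix.sum_apply]
    refine Finset.sum_congr rfl fun k _ => ?_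
    rw [Matrix.mul_vecMulVec, Matrix.vecMulVec_mul, ← Matrix.star_mulVec, Matrix.vecMulVec_apply,
      Pi.star_apply, h, h]
  simp only [cqState, Matrix.sum_apply, Matrix.smul_apply, Matrix.kroneckerMap_apply, hK,
    Matrix.single_apply, smul_eq_mul]
  rw [Finset.sum_eq_single x]
  · by_cases h : x = y <;> simp [h]
  · intro z _ hz
    simp [hz]
  · simp

variable {X A : Type*}

/-- The pure state `φ` on `AA'` as a matrix. -/
def stateMat (φ : A × Fin 2 → ℂ) : Matrix A (Fin 2) ℂ := Matrix.of fun a i => φ (a, i)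

/-- The matrix of the amplitude damped state: column `k` is `(1 ⊗ K k) φ`. -/
def dampedMat (η : ℝ) (φ : A × Fin 2 → ℂ) : Matrix (A × Fin 2) (Fin 2) ℂ :=
  Matrix.of fun i k => ∑ l, ampDampKraus η k i.2 l * φ (i.1, l)

theorem dampedMat_zero_zero (η : ℝ) (φ : A × Fin 2 → ℂ) (a : A) :
    dampedMat η φ (a, 0) 0 = (√η : ℝ) * φ (a, 0) := by
  simp [dampedMat, ampDampKraus]

theorem dampedMat_one_zero (η : ℝ) (φ : A × Fin 2 → ℂ) (a : A) :
    dampedMat η φ (a, 1) 0 = φ (a, 1) := by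
  simp [dampedMat, ampDampKraus]

theorem dampedMat_zero_one (η : ℝ) (φ : A × Fin 2 → ℂ) (a : A) :
    dampedMat η φ (a, 0) 1 = 0 := by
  simp [dampedMat, ampDampKraus]

theorem dampedMat_one_one (η : ℝ) (φ : A × Fin 2 → ℂ) (a : A) :
    dampedMat η φ (a, 1) 1 = (√(1 - η) : ℝ) * φ (a, 0) := by
  simp [dampedMat, ampDampKraus]

variable [Fintype A]

/-- The population of `|0⟩` in the reduced state on `A'`. -/
def population (φ : A × Fin 2 → ℂ) : ℝ := ∑ a, Complex.normSq (φ (a, 0))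

/-- The off-diagonal entry of the reduced state on `A'`. -/
def coherence (φ : A × Fin 2 → ℂ) : ℂ := ∑ a, φ (a, 0) * star (φ (a, 1))

theorem sum_normSq_one {φ : A × Fin 2 → ℂ} (hφ : ∑ i, ‖φ i‖ ^ 2 = 1) :
    ∑ a, Complex.normSq (φ (a, 1)) = 1 - population φ := by
  rw [Fintype.sum_prod_type] at hφ
  simp only [Fin.sum_univ_two, Finset.sum_add_distrib, ← Complex.normSq_eq_norm_sq] at hφ
  rw [population]
  linarith

theorem population_eq (φ : A × Fin 2 → ℂ) :
    ∑ a, φ (a, 0) * star (φ (a, 0)) = (population φ : ℂ) := by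
  simp only [population, Complex.ofReal_sum, Complex.star_def, Complex.mul_conj]

theorem one_sub_population_eq {φ : A × Fin 2 → ℂ} (hφ : ∑ i, ‖φ i‖ ^ 2 = 1) :
    ∑ a, φ (a, 1) * star (φ (a, 1)) = ((1 - population φ : ℝ) : ℂ) := by
  simp only [← sum_normSq_one hφ, Complex.ofReal_sum, Complex.star_def, Complex.mul_conj]

theorem star_coherence (φ : A × Fin 2 → ℂ) :
    star (coherence φ) = ∑ a, φ (a, 1) * star (φ (a, 0)) := by
  simp [coherence, mul_comm]

/-- The population and the determinant of the reduced state on `A'`. -/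
def statePoint (φ : A × Fin 2 → ℂ) : ℝ × ℝ :=
  (population φ, population φ * (1 - population φ) - Complex.normSq (coherence φ))

theorem statePoint_mem {φ : A × Fin 2 → ℂ} (hφ : ∑ i, ‖φ i‖ ^ 2 = 1) :
    statePoint φ ∈ stateRegion := by
  have h1 := sum_normSq_one hφ
  have h0 : 0 ≤ population φ := Finset.sum_nonneg fun a _ => Complex.normSq_nonneg _
  have h2 : 0 ≤ 1 - population φ := h1 ▸ Finset.sum_nonneg fun a _ => Complex.normSq_nonneg _
  refine ⟨h0, by simp only [statePoint]; linarith, sub_nonneg.2 ?_,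
    sub_le_self _ (Complex.normSq_nonneg _)⟩
  have h3 : ‖coherence φ‖ ≤ ∑ a, ‖φ (a, 0)‖ * ‖φ (a, 1)‖ := by
    refine (norm_sum_le _ _).trans (le_of_eq ?_)
    simp
  rw [Complex.normSq_eq_norm_sq, ← h1, population]
  simp only [Complex.normSq_eq_norm_sq]
  exact (pow_le_pow_left₀ (norm_nonneg _) h3 2).trans (Finset.sum_mul_sq_le_sq_mul_sq _ _ _)

/-- This Gram matrix is the transpose of the reduced state on `A'`, hence the conjugated coherence;
the determinant is unaffected. -/
theorem stateMat_gram {φ : A × Fin 2 → ℂ} (hφ : ∑ i, ‖φ i‖ ^ 2 = 1) :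
    (stateMat φ)ᴴ * stateMat φ = qubit (population φ) (star (coherence φ)) := by
  ext i j
  rw [star_coherence]
  fin_cases i <;> fin_cases j <;>
    simp [stateMat, qubit, Matrix.mul_apply, ← population_eq, ← one_sub_population_eq hφ, mul_comm]

/-- A sum of quadratic expressions in the amplitudes of a state, through the reduced state. -/
theorem sum_eq_of_quadratic {φ : A × Fin 2 → ℂ} (hφ : ∑ i, ‖φ i‖ ^ 2 = 1) {F : A → ℂ}
    (α β γ δ : ℂ) (hF : ∀ a, F a = α * (φ (a, 0) * star (φ (a, 0))) +
      β * (φ (a, 1) * star (φ (a, 1))) + γ * (φ (a, 0) * star (φ (a, 1))) +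
      δ * (φ (a, 1) * star (φ (a, 0)))) :
    ∑ a, F a = α * population φ + β * (1 - population φ) + γ * coherence φ +
      δ * star (coherence φ) := by
  have e1 := one_sub_population_eq hφ
  push_cast at e1
  rw [star_coherence, coherence, ← e1, ← population_eq]
  simp only [hF, Finset.sum_add_distrib, Finset.mul_sum]

theorem ofReal_sqrt_mul_self {t : ℝ} (ht : 0 ≤ t) : ((√t : ℝ) : ℂ) * ((√t : ℝ) : ℂ) = t := by
  rw [← Complex.ofReal_mul, mul_self_sqrt ht]

/-- Up to transposition this is the environment state, indexed by the Kraus label. Index 1 records a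
decay, so the diagonal entries appear in the opposite order to the output of transmissivity `1 - η`.
-/
theorem dampedMat_gram {η : ℝ} (hη : η ∈ Set.Icc (0 : ℝ) 1) {φ : A × Fin 2 → ℂ}
    (hφ : ∑ i, ‖φ i‖ ^ 2 = 1) :
    (dampedMat η φ)ᴴ * dampedMat η φ =
      qubit (1 - (1 - η) * population φ) ((√(1 - η) : ℝ) * coherence φ) := by
  have hs := ofReal_sqrt_mul_self hη.1
  have hs' := ofReal_sqrt_mul_self (sub_nonneg.2 hη.2)
  push_cast at hs'
  have key : ∀ i j, ((dampedMat η φ)ᴴ * dampedMat η φ) i j = ∑ a, (star (dampedMat η φ (a, 0) i) *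
      dampedMat η φ (a, 0) j + star (dampedMat η φ (a, 1) i) * dampedMat η φ (a, 1) j) := by
    intro i j
    simp [Matrix.mul_apply, Fintype.sum_prod_type]
  ext i j
  rw [key]
  fin_cases i <;> fin_cases j <;>
    simp only [Fin.zero_eta, Fin.mk_one, dampedMat_zero_zero, dampedMat_one_zero,
      dampedMat_zero_one, dampedMat_one_one, Complex.star_def, map_mul, map_zero,
      Complex.conj_ofReal, qubit, Matrix.of_apply, Matrix.cons_val', Matrix.cons_val_zero,
      Matrix.cons_val_one, Matrix.cons_val_fin_one]
  · refine (sum_eq_of_quadratic hφ η 1 0 0 fun a => ?_).trans ?_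
    · simp only [Complex.star_def]
      linear_combination (starRingEnd ℂ (φ (a, 0)) * φ (a, 0)) * hs
    · push_cast
      ring
  · refine (sum_eq_of_quadratic hφ 0 0 (√(1 - η) : ℝ) 0 fun a => ?_).trans ?_
    · simp only [Complex.star_def]
      ring
    · ring
  · refine (sum_eq_of_quadratic hφ 0 0 0 (√(1 - η) : ℝ) fun a => ?_).trans ?_
    · simp only [Complex.star_def]
      ring
    · rw [zero_mul, zero_mul, zero_mul, zero_add, zero_add, zero_add, Complex.star_def]
  · refine (sum_eq_of_quadratic hφ (1 - η) 0 0 0 fun a => ?_).trans ?_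
    · simp only [Complex.star_def]
      linear_combination (starRingEnd ℂ (φ (a, 0)) * φ (a, 0)) * hs'
    · push_cast
      ring

/-- The reduced output state on `B`. -/
theorem dampedMat_output {η : ℝ} (hη : η ∈ Set.Icc (0 : ℝ) 1) {φ : A × Fin 2 → ℂ}
    (hφ : ∑ i, ‖φ i‖ ^ 2 = 1) (b b' : Fin 2) :
    ∑ a, ∑ k, dampedMat η φ (a, b) k * star (dampedMat η φ (a, b') k) =
      qubit (η * population φ) ((√η : ℝ) * coherence φ) b b' := by
  have hs := ofReal_sqrt_mul_self hη.1
  have hs' := ofReal_sqrt_mul_self (sub_nonneg.2 hη.2)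
  push_cast at hs'
  fin_cases b <;> fin_cases b' <;>
    simp only [Fin.zero_eta, Fin.mk_one, dampedMat_zero_zero, dampedMat_one_zero, Fin.sum_univ_two,
      dampedMat_zero_one, dampedMat_one_one, Complex.star_def, map_mul, map_zero,
      Complex.conj_ofReal, qubit, Matrix.of_apply, Matrix.cons_val', Matrix.cons_val_zero,
      Matrix.cons_val_one, Matrix.cons_val_fin_one]
  · refine (sum_eq_of_quadratic hφ η 0 0 0 fun a => ?_).trans ?_
    · simp only [Complex.star_def]
      linear_combination (starRingEnd ℂ (φ (a, 0)) * φ (a, 0)) * hs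
    · push_cast
      ring
  · refine (sum_eq_of_quadratic hφ 0 0 (√η : ℝ) 0 fun a => ?_).trans ?_
    · simp only [Complex.star_def]
      ring
    · ring
  · refine (sum_eq_of_quadratic hφ 0 0 0 (√η : ℝ) fun a => ?_).trans ?_
    · simp only [Complex.star_def]
      ring
    · rw [zero_mul, zero_mul, zero_mul, zero_add, zero_add, zero_add, Complex.star_def]
  · refine (sum_eq_of_quadratic hφ (1 - η) 1 0 0 fun a => ?_).trans ?_
    · simp only [Complex.star_def]
      linear_combination (starRingEnd ℂ (φ (a, 0)) * φ (a, 0)) * hs'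
    · push_cast
      ring

/-- The damping does not change the reduced state on the reference. -/
theorem dampedMat_reference {A : Type*} {η : ℝ} (hη : η ∈ Set.Icc (0 : ℝ) 1)
    (φ : A × Fin 2 → ℂ) (a a' : A) :
    ∑ b, ∑ k, dampedMat η φ (a, b) k * star (dampedMat η φ (a', b) k) =
      (stateMat φ * (stateMat φ)ᴴ) a a' := by
  have hs := ofReal_sqrt_mul_self hη.1
  have hs' := ofReal_sqrt_mul_self (sub_nonneg.2 hη.2)
  push_cast at hs'
  simp only [dampedMat_zero_zero, dampedMat_one_zero, Fin.sum_univ_two, dampedMat_zero_one,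
    dampedMat_one_one, Complex.star_def, map_mul, map_zero, Complex.conj_ofReal,
    Matrix.mul_apply, Matrix.conjTranspose_apply, stateMat, Matrix.of_apply]
  linear_combination (φ (a, 0) * starRingEnd ℂ (φ (a', 0))) * (hs + hs')

/-! ### The entropies of the classical-quantum state -/

variable [Fintype X] [DecidableEq X] [DecidableEq A] {p : X → ℝ} {φ : X → A × Fin 2 → ℂ} {η : ℝ}

theorem cqState_eq_blockMat (η : ℝ) (p : X → ℝ) (φ : X → A × Fin 2 → ℂ) :
    cqState (ampDampKraus η) p φ =
      blockMat fun x => (p x : ℂ) • (dampedMat η (φ x) * (dampedMat η (φ x))ᴴ) := by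
  ext i j
  rw [cqState_apply, blockMat_apply]
  by_cases h : i.1 = j.1
  · rw [if_pos h, if_pos h, Matrix.smul_apply, Matrix.mul_apply, smul_eq_mul]
    rfl
  · rw [if_neg h, if_neg h]

theorem cqState_eq_ite (η : ℝ) (p : X → ℝ) (φ : X → A × Fin 2 → ℂ) (x y : X) (a a' : A)
    (b b' : Fin 2) :
    cqState (ampDampKraus η) p φ (x, a, b) (y, a', b') = if x = y then (p x : ℂ) *
      ∑ k, dampedMat η (φ x) (a, b) k * star (dampedMat η (φ x) (a', b') k) else 0 := by
  rw [cqState_apply]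
  rfl

theorem margXA_cqState (hη : η ∈ Set.Icc (0 : ℝ) 1) (p : X → ℝ) (φ : X → A × Fin 2 → ℂ) :
    margXA (cqState (ampDampKraus η) p φ) =
      blockMat fun x => (p x : ℂ) • (stateMat (φ x) * (stateMat (φ x))ᴴ) := by
  ext ⟨x, a⟩ ⟨y, a'⟩
  simp only [margXA, Matrix.of_apply, cqState_eq_ite, blockMat_apply]
  by_cases h : x = y
  · simp only [if_pos h, Matrix.smul_apply, smul_eq_mul, ← Finset.mul_sum, dampedMat_reference hη]
  · simp [h]

theorem margXB_cqState (hη : η ∈ Set.Icc (0 : ℝ) 1) (p : X → ℝ) (hφ : ∀ x, ∑ i, ‖φ x i‖ ^ 2 = 1) :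
    margXB (cqState (ampDampKraus η) p φ) = blockMat fun x =>
      (p x : ℂ) • qubit (η * population (φ x)) ((√η : ℝ) * coherence (φ x)) := by
  ext ⟨x, b⟩ ⟨y, b'⟩
  simp only [margXB, Matrix.of_apply, cqState_eq_ite, blockMat_apply]
  by_cases h : x = y
  · simp only [if_pos h, Matrix.smul_apply, smul_eq_mul, ← Finset.mul_sum,
      dampedMat_output hη (hφ x)]
  · simp [h]

theorem margX_cqState (hη : η ∈ Set.Icc (0 : ℝ) 1) (p : X → ℝ) (hφ : ∀ x, ∑ i, ‖φ x i‖ ^ 2 = 1) :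
    margX (cqState (ampDampKraus η) p φ) = Matrix.diagonal fun x => (p x : ℂ) := by
  ext x y
  simp only [margX, Matrix.of_apply, cqState_eq_ite]
  by_cases h : x = y
  · subst h
    rw [Finset.sum_comm]
    simp only [if_true, ← Finset.mul_sum, dampedMat_output hη (hφ x), Matrix.diagonal_apply_eq]
    simp [qubit]
  · simp [h]

theorem margB_cqState (hη : η ∈ Set.Icc (0 : ℝ) 1) (hp1 : ∑ x, p x = 1)
    (hφ : ∀ x, ∑ i, ‖φ x i‖ ^ 2 = 1) :
    margB (cqState (ampDampKraus η) p φ) = qubit (η * ∑ x, p x * population (φ x))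
      ((√η : ℝ) * ∑ x, (p x : ℂ) * coherence (φ x)) := by
  have hp1' : ∑ x, (p x : ℂ) = 1 := by
    rw [← Complex.ofReal_sum, hp1, Complex.ofReal_one]
  ext b b'
  simp only [margB, Matrix.of_apply, cqState_eq_ite, if_true, ← Finset.mul_sum,
    dampedMat_output hη (hφ _)]
  fin_cases b <;> fin_cases b' <;> simp [qubit]
  · simp only [Finset.mul_sum]
    exact Finset.sum_congr rfl fun x _ => by ring
  · simp only [Finset.mul_sum]
    exact Finset.sum_congr rfl fun x _ => by ring
  · simp only [Finset.mul_sum]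
    exact Finset.sum_congr rfl fun x _ => by ring
  · simp only [mul_sub, mul_one, Finset.sum_sub_distrib, hp1', Finset.mul_sum]
    congr 1
    exact Finset.sum_congr rfl fun x _ => by ring

theorem sum_vnEntropy_smul_qubit {X : Type*} [Fintype X] (p a : X → ℝ) (c : X → ℂ) :
    ∑ x, vnEntropy ((p x : ℂ) • qubit (a x) (c x)) = ((∑ x, negMulLog (p x)) +
      ∑ x, p x * detEntropy (a x * (1 - a x) - Complex.normSq (c x))) / log 2 := by
  simp only [vnEntropy_smul_qubit, ← Finset.sum_div, Finset.sum_add_distrib]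

/-- Conditioned on `X`, the pure state of reference, output and environment lets the entropy of `AB`
be computed on the environment, a qubit whatever the dimension of `A`. -/
theorem vnEntropy_cqState (hη : η ∈ Set.Icc (0 : ℝ) 1) (hp : ∀ x, 0 ≤ p x)
    (hφ : ∀ x, ∑ i, ‖φ x i‖ ^ 2 = 1) :
    vnEntropy (cqState (ampDampKraus η) p φ) = ((∑ x, negMulLog (p x)) +
      ∑ x, p x * outEntropy (1 - η) (statePoint (φ x))) / log 2 := by
  rw [cqState_eq_blockMat, vnEntropy_blockMat fun x =>
    isHermitian_ofReal_smul (Matrix.isHermitian_mul_conjTranspose_self _) _]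
  simp only [vnEntropy_smul_mul_conjTranspose (hp _), dampedMat_gram hη (hφ _)]
  rw [sum_vnEntropy_smul_qubit]
  congr 2
  refine Finset.sum_congr rfl fun x _ => ?_
  rw [outEntropy, statePoint, Complex.normSq_mul, Complex.normSq_ofReal,
    mul_self_sqrt (sub_nonneg.2 hη.2)]
  ring_nf

theorem vnEntropy_margXA (hη : η ∈ Set.Icc (0 : ℝ) 1) (hp : ∀ x, 0 ≤ p x)
    (hφ : ∀ x, ∑ i, ‖φ x i‖ ^ 2 = 1) :
    vnEntropy (margXA (cqState (ampDampKraus η) p φ)) = ((∑ x, negMulLog (p x)) +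
      ∑ x, p x * outEntropy 1 (statePoint (φ x))) / log 2 := by
  rw [margXA_cqState hη, vnEntropy_blockMat fun x =>
    isHermitian_ofReal_smul (Matrix.isHermitian_mul_conjTranspose_self _) _]
  simp only [vnEntropy_smul_mul_conjTranspose (hp _), stateMat_gram (hφ _)]
  rw [sum_vnEntropy_smul_qubit]
  congr 2
  refine Finset.sum_congr rfl fun x _ => ?_
  rw [outEntropy, statePoint, Complex.star_def, Complex.normSq_conj]
  ring_nf

theorem vnEntropy_margXB (hη : η ∈ Set.Icc (0 : ℝ) 1) (hφ : ∀ x, ∑ i, ‖φ x i‖ ^ 2 = 1) :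
    vnEntropy (margXB (cqState (ampDampKraus η) p φ)) = ((∑ x, negMulLog (p x)) +
      ∑ x, p x * outEntropy η (statePoint (φ x))) / log 2 := by
  rw [margXB_cqState hη p hφ, vnEntropy_blockMat fun x =>
    isHermitian_ofReal_smul (qubit_isHermitian _ _) _, sum_vnEntropy_smul_qubit]
  congr 2
  refine Finset.sum_congr rfl fun x _ => ?_
  rw [outEntropy, statePoint, Complex.normSq_mul, Complex.normSq_ofReal, mul_self_sqrt hη.1]
  ring_nf

theorem vnEntropy_margX (hη : η ∈ Set.Icc (0 : ℝ) 1) (hφ : ∀ x, ∑ i, ‖φ x i‖ ^ 2 = 1) :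
    vnEntropy (margX (cqState (ampDampKraus η) p φ)) = (∑ x, negMulLog (p x)) / log 2 := by
  rw [margX_cqState hη p hφ, vnEntropy_diagonal]

theorem vnEntropy_margB (hη : η ∈ Set.Icc (0 : ℝ) 1) (hp1 : ∑ x, p x = 1)
    (hφ : ∀ x, ∑ i, ‖φ x i‖ ^ 2 = 1) :
    vnEntropy (margB (cqState (ampDampKraus η) p φ)) =
      detEntropy ((η * ∑ x, p x * population (φ x)) * (1 - η * ∑ x, p x * population (φ x)) -
        η * Complex.normSq (∑ x, (p x : ℂ) * coherence (φ x))) / log 2 := by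
  have := vnEntropy_smul_qubit 1 (η * ∑ x, p x * population (φ x))
    ((√η : ℝ) * ∑ x, (p x : ℂ) * coherence (φ x))
  rw [Complex.ofReal_one, one_smul, negMulLog_one, zero_add, one_mul, Complex.normSq_mul,
    Complex.normSq_ofReal, mul_self_sqrt hη.1] at this
  rw [margB_cqState hη hp1 hφ, this]

end States

end TripleTradeoff
end

/-! ### The rates, the output bound and the trial states. -/

noncomputable section

namespace TripleTradeoff

open Real

section Rates

variable {X A : Type*} [Fintype X] [DecidableEq X] [Fintype A] [DecidableEq A] {p : X → ℝ}
  {φ : X → A × Fin 2 → ℂ} {η : ℝ}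

/-- The determinant of the average output state. -/
def outputDet (η : ℝ) (p : X → ℝ) (φ : X → A × Fin 2 → ℂ) : ℝ :=
  (η * ∑ x, p x * population (φ x)) * (1 - η * ∑ x, p x * population (φ x)) -
    η * Complex.normSq (∑ x, (p x : ℂ) * coherence (φ x))

theorem mutualInfo_cqState (hη : η ∈ Set.Icc (0 : ℝ) 1) (hp : ∀ x, 0 ≤ p x)
    (hp1 : ∑ x, p x = 1) (hφ : ∀ x, ∑ i, ‖φ x i‖ ^ 2 = 1) :
    mutualInfo (cqState (ampDampKraus η) p φ) = (detEntropy (outputDet η p φ) +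
      ∑ x, p x * (outEntropy 1 (statePoint (φ x)) - outEntropy (1 - η) (statePoint (φ x)))) /
      log 2 := by
  rw [mutualInfo, vnEntropy_margXA hη hp hφ, vnEntropy_margB hη hp1 hφ, vnEntropy_cqState hη hp hφ]
  simp only [mul_sub, Finset.sum_sub_distrib, outputDet]
  ring

theorem coherentInfo_cqState (hη : η ∈ Set.Icc (0 : ℝ) 1) (hp : ∀ x, 0 ≤ p x)
    (hφ : ∀ x, ∑ i, ‖φ x i‖ ^ 2 = 1) :
    coherentInfo (cqState (ampDampKraus η) p φ) = (∑ x, p x * (outEntropy η (statePoint (φ x)) -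
      outEntropy (1 - η) (statePoint (φ x)))) / log 2 := by
  rw [coherentInfo, vnEntropy_margXB hη hφ, vnEntropy_cqState hη hp hφ]
  simp only [mul_sub, Finset.sum_sub_distrib]
  ring

theorem holevoInfo_add_coherentInfo_cqState (hη : η ∈ Set.Icc (0 : ℝ) 1) (hp : ∀ x, 0 ≤ p x)
    (hp1 : ∑ x, p x = 1) (hφ : ∀ x, ∑ i, ‖φ x i‖ ^ 2 = 1) :
    holevoInfo (cqState (ampDampKraus η) p φ) + coherentInfo (cqState (ampDampKraus η) p φ) =
      (detEntropy (outputDet η p φ) - ∑ x, p x * outEntropy (1 - η) (statePoint (φ x))) /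
      log 2 := by
  rw [holevoInfo, coherentInfo, vnEntropy_margX hη hφ, vnEntropy_margB hη hp1 hφ,
    vnEntropy_margXB hη hφ, vnEntropy_cqState hη hp hφ, outputDet]
  ring

theorem h2_eq (y : ℝ) : h2 y = binEntropy y / log 2 := by
  simp only [h2, logb, binEntropy_eq_negMulLog_add_negMulLog_one_sub, negMulLog]
  ring

theorem g_eq (q z ν : ℝ) : g q z ν = outEntropy z (q, q * (1 - q) * (1 - ν ^ 2)) / log 2 := by
  rw [g, h2_eq, outEntropy, detEntropy]
  ring_nf

/-- Nonnegativity of the determinant of the average input state, from the individual states by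
convexity of the square. -/
theorem normSq_mean_coherence_le {X A : Type*} [Fintype X] [Fintype A] {p : X → ℝ}
    {φ : X → A × Fin 2 → ℂ} (hp : ∀ x, 0 ≤ p x) (hp1 : ∑ x, p x = 1)
    (hφ : ∀ x, ∑ i, ‖φ x i‖ ^ 2 = 1) :
    Complex.normSq (∑ x, (p x : ℂ) * coherence (φ x)) ≤
      (∑ x, p x * population (φ x)) * (1 - ∑ x, p x * population (φ x)) := by
  have h1 : ‖∑ x, (p x : ℂ) * coherence (φ x)‖ ≤ ∑ x, p x * ‖coherence (φ x)‖ := by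
    refine (norm_sum_le _ _).trans (le_of_eq (Finset.sum_congr rfl fun x _ => ?_))
    rw [norm_mul, Complex.norm_real, norm_of_nonneg (hp x)]
  have h3 := pow_arith_mean_le_arith_mean_pow_of_even Finset.univ p
    (fun x => ‖coherence (φ x)‖) (fun x _ => hp x) hp1 even_two
  have h4 := pow_arith_mean_le_arith_mean_pow_of_even Finset.univ p
    (fun x => population (φ x)) (fun x _ => hp x) hp1 even_two
  have h5 : ∑ x, p x * ‖coherence (φ x)‖ ^ 2 ≤
      ∑ x, p x * (population (φ x) * (1 - population (φ x))) := by
    refine Finset.sum_le_sum fun x _ => mul_le_mul_of_nonneg_left ?_ (hp x)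
    rw [← Complex.normSq_eq_norm_sq]
    exact sub_nonneg.1 (statePoint_mem (hφ x)).2.2.1
  have h6 : ∑ x, p x * (population (φ x) * (1 - population (φ x))) =
      ∑ x, p x * population (φ x) - ∑ x, p x * population (φ x) ^ 2 := by
    rw [← Finset.sum_sub_distrib]
    exact Finset.sum_congr rfl fun x _ => by ring
  rw [Complex.normSq_eq_norm_sq]
  have h7 := pow_le_pow_left₀ (norm_nonneg _) h1 2
  linarith

theorem mean_population_mem {X A : Type*} [Fintype X] [Fintype A] {p : X → ℝ}
    {φ : X → A × Fin 2 → ℂ} (hp : ∀ x, 0 ≤ p x) (hp1 : ∑ x, p x = 1)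
    (hφ : ∀ x, ∑ i, ‖φ x i‖ ^ 2 = 1) : ∑ x, p x * population (φ x) ∈ Set.Icc (0 : ℝ) 1 := by
  refine ⟨Finset.sum_nonneg fun x _ => mul_nonneg (hp x) (statePoint_mem (hφ x)).1, ?_⟩
  rw [← hp1]
  exact Finset.sum_le_sum fun x _ => mul_le_of_le_one_right (hp x) (statePoint_mem (hφ x)).2.1

/-- Erasing the coherence of the average output raises its determinant and hence its entropy. -/
theorem detEntropy_outputDet_le {X A : Type*} [Fintype X] [Fintype A] {p : X → ℝ}
    {φ : X → A × Fin 2 → ℂ} (hη : η ∈ Set.Icc (0 : ℝ) 1) (hp : ∀ x, 0 ≤ p x)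
    (hp1 : ∑ x, p x = 1) (hφ : ∀ x, ∑ i, ‖φ x i‖ ^ 2 = 1) :
    detEntropy (outputDet η p φ) ≤ binEntropy (η * ∑ x, p x * population (φ x)) := by
  rw [← detEntropy_mul_one_sub, outputDet]
  have h1 := normSq_mean_coherence_le hp hp1 hφ
  have h2 := mean_population_mem hp hp1 hφ
  have h3 := Complex.normSq_nonneg (∑ x, (p x : ℂ) * coherence (φ x))
  set q := ∑ x, p x * population (φ x)
  set w := Complex.normSq (∑ x, (p x : ℂ) * coherence (φ x))
  have h4 : η * q * (1 - η * q) ≤ 1 / 4 := by nlinarith [sq_nonneg (1 - 2 * (η * q))]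
  have h5 : 0 ≤ η * w := mul_nonneg hη.1 h3
  have h6 : η * w ≤ η * (q * (1 - q)) := mul_le_mul_of_nonneg_left h1 hη.1
  have h7 : 0 ≤ (η * (1 - η)) * q ^ 2 :=
    mul_nonneg (mul_nonneg hη.1 (sub_nonneg.2 hη.2)) (sq_nonneg _)
  exact detEntropy_strictMonoOn.monotoneOn ⟨by linarith, by linarith⟩
    ⟨by linarith, h4⟩ (by linarith)

theorem exists_coherence_parameter {x : ℝ × ℝ} (hx : x ∈ stateRegion) :
    ∃ ν ∈ Set.Icc (0 : ℝ) 1, x.2 = x.1 * (1 - x.1) * (1 - ν ^ 2) := by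
  obtain ⟨-, -, h2, h3⟩ := hx
  set m := x.1 * (1 - x.1)
  rcases (h2.trans h3).eq_or_lt with hm | hm
  -- For q(1-q) = 0 the determinant is 0 and any ν would do.
  · exact ⟨0, by simp, by rw [← hm] at h3 ⊢; linarith⟩
  · have h4 : 0 ≤ 1 - x.2 / m := sub_nonneg.2 ((div_le_one hm).2 h3)
    refine ⟨√(1 - x.2 / m), ⟨sqrt_nonneg _, sqrt_le_one.2 ?_⟩, ?_⟩
    · linarith [div_nonneg h2 hm.le]
    · rw [sq_sqrt h4]
      field_simp
      ring

/-- A pure state of two qubits whose reduced state on `A'` has population `q` and coherence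
`ν √(q (1 - q))`. -/
def trialState (q ν : ℝ) : Fin 2 × Fin 2 → ℂ := fun i =>
  ((!![√q, ν * √(1 - q); 0, √(1 - ν ^ 2) * √(1 - q)] i.1 i.2 : ℝ) : ℂ)

theorem trialState_norm {q ν : ℝ} (hq : q ∈ Set.Icc (0 : ℝ) 1) (hν : ν ^ 2 ≤ 1) :
    ∑ i, ‖trialState q ν i‖ ^ 2 = 1 := by
  simp [trialState, Fintype.sum_prod_type, mul_pow, sq_sqrt hq.1, sq_sqrt (sub_nonneg.2 hq.2),
    sq_sqrt (sub_nonneg.2 hν)]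
  ring

theorem population_trialState {q ν : ℝ} (hq : q ∈ Set.Icc (0 : ℝ) 1) :
    population (trialState q ν) = q := by
  simp [population, trialState, Complex.normSq_ofReal, mul_self_sqrt hq.1]

theorem coherence_trialState (q ν : ℝ) :
    coherence (trialState q ν) = ((ν * (√q * √(1 - q)) : ℝ) : ℂ) := by
  simp [coherence, trialState]
  ring

theorem statePoint_trialState {q ν : ℝ} (hq : q ∈ Set.Icc (0 : ℝ) 1) :
    statePoint (trialState q ν) = (q, q * (1 - q) * (1 - ν ^ 2)) := by
  rw [statePoint, population_trialState hq, coherence_trialState, Complex.normSq_ofReal]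
  congr 1
  have h1 := mul_self_sqrt hq.1
  have h2 := mul_self_sqrt (sub_nonneg.2 hq.2)
  linear_combination (-ν ^ 2 * √(1 - q) * √(1 - q)) * h1 - ν ^ 2 * q * h2

end Rates

end TripleTradeoff

end

/-! ### The two inclusions. -/

open TripleTradeoff Real in
theorem tripleRegion_ampDampKraus_subset {η : ℝ} (hη : η ∈ Set.Icc (0 : ℝ) 1) {r : ℝ × ℝ × ℝ}
    (hr : r ∈ tripleRegion (ampDampKraus η)) :
    ∃ p q ν : Fin 2 → ℝ,
        p 0 ∈ Set.Icc (0 : ℝ) 1 ∧ p 1 = 1 - p 0 ∧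
        (∀ x, q x ∈ Set.Icc (0 : ℝ) 1) ∧ (∀ x, ν x ∈ Set.Icc (0 : ℝ) 1) ∧
        r ∈ ratePolyhedron
          (h2 (η * ∑ x, p x * q x) + ∑ x, p x * (g (q x) 1 (ν x) - g (q x) (1 - η) (ν x)))
          (∑ x, p x * (g (q x) η (ν x) - g (q x) (1 - η) (ν x)))
          (h2 (η * ∑ x, p x * q x) - ∑ x, p x * g (q x) (1 - η) (ν x)) := by
  obtain ⟨n, d, p, φ, hp, hp1, hφ, hr⟩ := hr
  rw [holevoInfo_add_coherentInfo_cqState hη hp hp1 hφ, mutualInfo_cqState hη hp hp1 hφ,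
    coherentInfo_cqState hη hp hφ] at hr
  obtain ⟨Y, hY, h1, h2, h3⟩ := exists_dominating hη hp hp1 fun x => statePoint_mem (hφ x)
  obtain ⟨ν, hν, hYν⟩ := exists_coherence_parameter hY
  have hB := detEntropy_outputDet_le hη hp hp1 hφ
  have hl : 0 < log 2 := log_pos one_lt_two
  have hq := mean_population_mem hp hp1 hφ
  obtain ⟨r1, r2, r3⟩ := hr
  -- One dominating state is enough, so the second letter gets probability 0.
  refine ⟨![1, 0], fun _ => ∑ x, p x * population (φ x), fun _ => ν, by simp, by simp,
    fun _ => hq, fun _ => hν, ?_⟩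
  simp only [statePoint] at h1 h2 h3 r1 r2 r3 hYν
  simp only [g_eq, h2_eq, Fin.sum_univ_two, Matrix.cons_val_zero, Matrix.cons_val_one, one_mul,
    zero_mul, add_zero, ← sub_div, ← add_div, ← hYν]
  refine ⟨r1.trans ?_, r2.trans ?_, r3.trans ?_⟩ <;> gcongr

-- Each letter is split into two equiprobable states with coherences of opposite sign. The
-- conditional entropies see only ν², while the average coherence vanishes, so the output entropy
-- attains its bound h₂(ηp).
open TripleTradeoff Real in
theorem mem_tripleRegion_ampDampKraus {η : ℝ} (hη : η ∈ Set.Icc (0 : ℝ) 1) {r : ℝ × ℝ × ℝ}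
    {p q ν : Fin 2 → ℝ} (hp0 : p 0 ∈ Set.Icc (0 : ℝ) 1) (hp1 : p 1 = 1 - p 0)
    (hq : ∀ x, q x ∈ Set.Icc (0 : ℝ) 1) (hν : ∀ x, ν x ∈ Set.Icc (0 : ℝ) 1)
    (hr : r ∈ ratePolyhedron
      (h2 (η * ∑ x, p x * q x) + ∑ x, p x * (g (q x) 1 (ν x) - g (q x) (1 - η) (ν x)))
      (∑ x, p x * (g (q x) η (ν x) - g (q x) (1 - η) (ν x)))
      (h2 (η * ∑ x, p x * q x) - ∑ x, p x * g (q x) (1 - η) (ν x))) :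
    r ∈ tripleRegion (ampDampKraus η) := by
  set P : Fin 4 → ℝ := ![p 0 / 2, p 0 / 2, p 1 / 2, p 1 / 2] with hP
  set φ : Fin 4 → Fin 2 × Fin 2 → ℂ := ![trialState (q 0) (ν 0), trialState (q 0) (-ν 0),
    trialState (q 1) (ν 1), trialState (q 1) (-ν 1)] with hφdef
  have hν2 : ∀ x, ν x ^ 2 ≤ 1 := fun x => pow_le_one₀ (hν x).1 (hν x).2
  have hν2' : ∀ x, (-ν x) ^ 2 ≤ 1 := fun x => by rw [neg_sq]; exact hν2 x
  have h0 : 0 ≤ p 0 / 2 := by linarith [hp0.1]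
  have h1 : 0 ≤ p 1 / 2 := by linarith [hp0.2]
  have hPn : ∀ x, 0 ≤ P x := by
    intro x
    fin_cases x <;> simp only [hP] <;> assumption
  have hP1 : ∑ x, P x = 1 := by
    simp [hP, Fin.sum_univ_four, hp1]
    ring
  have hφ : ∀ x, ∑ i, ‖φ x i‖ ^ 2 = 1 := by
    intro x
    fin_cases x
    · exact trialState_norm (hq 0) (hν2 0)
    · exact trialState_norm (hq 0) (hν2' 0)
    · exact trialState_norm (hq 1) (hν2 1)
    · exact trialState_norm (hq 1) (hν2' 1)
  refine ⟨4, 2, P, φ, hPn, hP1, hφ, ?_⟩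
  have hsum : ∀ z, ∑ x, P x * outEntropy z (statePoint (φ x)) =
      ∑ x, p x * outEntropy z (q x, q x * (1 - q x) * (1 - ν x ^ 2)) := by
    intro z
    simp [hP, hφdef, Fin.sum_univ_four, statePoint_trialState (hq _)]
    ring
  have hpop : ∑ x, P x * population (φ x) = ∑ x, p x * q x := by
    simp [hP, hφdef, Fin.sum_univ_four, population_trialState (hq _)]
    ring
  have hcoh : ∑ x, (P x : ℂ) * coherence (φ x) = 0 := by
    simp [hP, hφdef, Fin.sum_univ_four, coherence_trialState]
  have hB : detEntropy (outputDet η P φ) = binEntropy (η * ∑ x, p x * q x) := by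
    rw [← detEntropy_mul_one_sub, outputDet, hpop, hcoh, map_zero, mul_zero, sub_zero]
  rw [holevoInfo_add_coherentInfo_cqState hη hPn hP1 hφ, mutualInfo_cqState hη hPn hP1 hφ,
    coherentInfo_cqState hη hPn hφ, hB]
  simp only [mul_sub, Finset.sum_sub_distrib, hsum]
  simp only [g_eq, h2_eq, mul_sub, Finset.sum_sub_distrib, ← mul_div_assoc, ← Finset.sum_div,
    ← sub_div, ← add_div] at hr
  exact hr

theorem mainTheorem4 (η : ℝ) (hη : η ∈ Set.Icc (0 : ℝ) 1) :
    TripleTradeoff.tripleRegion (TripleTradeoff.ampDampKraus η) =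
      {r : ℝ × ℝ × ℝ | ∃ p q ν : Fin 2 → ℝ,
        p 0 ∈ Set.Icc (0 : ℝ) 1 ∧ p 1 = 1 - p 0 ∧
        (∀ x, q x ∈ Set.Icc (0 : ℝ) 1) ∧ (∀ x, ν x ∈ Set.Icc (0 : ℝ) 1) ∧
        r ∈ TripleTradeoff.ratePolyhedron
          (TripleTradeoff.h2 (η * ∑ x, p x * q x) +
            ∑ x, p x * (TripleTradeoff.g (q x) 1 (ν x) - TripleTradeoff.g (q x) (1 - η) (ν x)))
          (∑ x, p x * (TripleTradeoff.g (q x) η (ν x) - TripleTradeoff.g (q x) (1 - η) (ν x)))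
          (TripleTradeoff.h2 (η * ∑ x, p x * q x) -
            ∑ x, p x * TripleTradeoff.g (q x) (1 - η) (ν x))} := by
  refine Set.Subset.antisymm (fun r hr => tripleRegion_ampDampKraus_subset hη hr) ?_
  rintro r ⟨p, q, ν, hp0, hp1, hq, hν, hr⟩
  exact mem_tripleRegion_ampDampKraus hη hp0 hp1 hq hν hr
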